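/- Let $(M,g)$ be a smooth Lorentzian manifold of signature $(-,+,\dots,+)$ with timelike boundary $\partial M$ and outward unit normal $\nu$. Write $\partial TM$ for the tangent vectors of $M$ at points of $\partial M$, and $\partial_-TM$, $\partial_+TM$ for those $(x,v)\in\partial TM$ with $g(v,\nu)<0$ (inward), respectively $g(v,\nu)>0$ (outward). Let $LM=\{(x,v): v\neq 0,\ g(v,v)=0\}$, let $\partial LM=LM\cap\partial TM$ and $\partial_-LM=LM\cap\partial_-TM$. For $(x,v)\in\partial_-TM$ with geodesic $\gamma$, put $\tau^{in}(x,v)=\sup\{t>0:\gamma((0,t))\subset M^\circ\}$ and, if this is finite and $\gamma$ is defined there, $S^{in}(x,v)=(\gamma(\tau^{in}(x,v)),\dot\gamma(\tau^{in}(x,v)))$. A geodesic is non-trapping if it exits $M$ in finite time, that is, its forward maximal geodesic in $M$ is defined exactly on a compact interval $[0,T]$. Assume that all lightlike geodesics of $M$ are non-trapping. Let $\mathcal U'$ be a conic neighborhood of $\partial LM$, open in $\partial TM$, all of whose vectors generate non-trapping geodesics, and let $\mathcal U_-$ be the set of inward pointing causal vectors ($v\ne0$, $g(v,v)\le 0$)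 in $\mathcal U'$. Then $S^{in}$ is well defined on $\mathcal U_-\supset\partial_-LM$, and the lightlike interior travel time data $(S^{in},\tau^{in})|_{\partial_-LM}$ are determined by the boundary metric $g|_{T\partial M\times T\partial M}$ and by $S^{in}|_{\mathcal U_-}$, in the following sense. (a) For every $(x,v)\in\partial_-LM$, with $(y,w)=S^{in}(x,v)$, there are $\varepsilon>0$, a smooth family $w(\lambda)\in T_yM$, $0\le\lambda<\varepsilon$, and vectors $(x(\lambda),v(\lambda))\in\mathcal U_-$ such that $w(0)=w$, $w(\lambda)$ is timelike and outward pointing for $\lambda>0$, $\frac{d}{d\lambda}g(w(\lambda),w(\lambda))|_{\lambda=0}=-2$, $(x(0),v(0))=(x,v)$, $(x(\lambda),v(\lambda))\to(x,v)$ as $\lambda\to0$, and $S^{in}(x(\lambda),v(\lambda))=(y,w(\lambda))$ for all $0\le\lambda<\varepsilon$. For every such family $x'(0)$ exists and $$\tau^{in}(x,v)=g(x'(0),v).$$ (b) Let $(M_1,g_1,\mathcal U'_1)$ and $(M_2,g_2,\mathcal U'_2)$ be two such objects, and let $\varphi_0:\partial M_1\to\partial M_2$ be an isometry of the boundary metrics,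 whose differential is extended to $(\varphi_0)_*:\partial TM_1\to\partial TM_2$ by sending the unit outward normal to the unit outward normal. If $(\varphi_0)_*(\mathcal U_{1,-})=\mathcal U_{2,-}$ and $(\varphi_0)_*\circ S^{in}_1=S^{in}_2\circ(\varphi_0)_*$ on $\mathcal U_{1,-}$, then $(\varphi_0)_*(\partial_-LM_1)=\partial_-LM_2$, and on $\partial_-LM_1$ both travel times are finite and positive and $$(\varphi_0)_*\circ S^{in}_1=S^{in}_2\circ(\varphi_0)_*,\qquad \tau^{in}_1=\tau^{in}_2\circ(\varphi_0)_*.$$ -/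

import Mathlib

open Set Bundle
open scoped Manifold ContDiff Topology

noncomputable section

namespace LorentzScattering

/-- The model vector space `ℝⁿ`. -/
abbrev Vec (n : ℕ) : Type := EuclideanSpace ℝ (Fin n)

/-- A symmetric bilinear form `B` restricted to the linear subspace cut out by `W` has signature
`(-, +, …, +)`: there is a vector of negative square in `W` on whose orthogonal complement in `W`
the form is positive definite. -/
def IsLorentzForm {V : Type*} [AddCommGroup V] (W : V → Prop) (B : V → V → ℝ) : Prop :=
  ∃ u, W u ∧ B u u < 0 ∧ ∀ w, W w → w ≠ 0 → B u w = 0 → 0 < B w w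

variable {n : ℕ} [NeZero n]
variable {M : Type*} [TopologicalSpace M] [ChartedSpace (EuclideanHalfSpace n) M]
variable {M' : Type*} [TopologicalSpace M'] [ChartedSpace (EuclideanHalfSpace n) M']

/-- The component of `v ∈ T_x M` along the coordinate `x₀ ≥ 0` that defines the half space, in the
preferred chart at `x`. For `x ∈ ∂M` it vanishes exactly on `T_x ∂M`, and it is negative exactly on
the vectors that point out of `M`. -/
def normalCoord (x : M) (v : TangentSpace (𝓡∂ n) x) : ℝ :=
  (show Vec n from v) 0

/-- `v ∈ T_x ∂M`, for a boundary point `x`. -/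
def TangentToBoundary (x : M) (v : TangentSpace (𝓡∂ n) x) : Prop :=
  normalCoord x v = 0

variable (n M) in
/-- A smooth Lorentzian metric, of signature `(-, +, …, +)`, on a smooth manifold with boundary. -/
structure LorentzMetric [IsManifold (𝓡∂ n) ∞ M] where
  /-- The scalar product on each tangent space. -/
  inner (x : M) :
    TangentSpace (𝓡∂ n) x →L[ℝ] TangentSpace (𝓡∂ n) x →L[ℝ] ℝ
  symm (x : M) (v w : TangentSpace (𝓡∂ n) x) : inner x v w = inner x w v
  lorentzian (x : M) :
    IsLorentzForm (fun _ : TangentSpace (𝓡∂ n) x => True) (fun v w => inner x v w)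
  contMDiff : ContMDiff (𝓡∂ n) ((𝓡∂ n).prod 𝓘(ℝ, Vec n →L[ℝ] Vec n →L[ℝ] ℝ)) ∞
    (fun x ↦ TotalSpace.mk' (Vec n →L[ℝ] Vec n →L[ℝ] ℝ)
      (E := fun x : M ↦ TangentSpace (𝓡∂ n) x →L[ℝ] TangentSpace (𝓡∂ n) x →L[ℝ] ℝ) x (inner x))

variable [IsManifold (𝓡∂ n) ∞ M] [IsManifold (𝓡∂ n) ∞ M']

/-- The boundary is timelike: the metric induced on every `T_x ∂M` is Lorentzian. -/
def HasTimelikeBoundary (g : LorentzMetric n M) : Prop :=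
  ∀ x ∈ (𝓡∂ n).boundary M, IsLorentzForm (TangentToBoundary x) (fun v w => g.inner x v w)

/-- `ν` is the outward unit normal at the boundary point `x`. -/
structure IsOutwardUnitNormal (g : LorentzMetric n M) (x : M) (ν : TangentSpace (𝓡∂ n) x) :
    Prop where
  unit : g.inner x ν ν = 1
  normal : ∀ u, TangentToBoundary x u → g.inner x ν u = 0
  outward : normalCoord x ν < 0

/-! ### Sets of tangent vectors -/

/-- The scalar square `g(v, v)` of a tangent vector `(x, v)`. -/
def LorentzMetric.sq (g : LorentzMetric n M) (ξ : TangentBundle (𝓡∂ n) M) : ℝ :=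
  g.inner ξ.proj ξ.2 ξ.2

variable (n M) in
/-- `∂TM`: the tangent vectors of `M` at boundary points. -/
def boundaryTM : Set (TangentBundle (𝓡∂ n) M) :=
  {ξ | ξ.proj ∈ (𝓡∂ n).boundary M}

/-- `∂₋TM`: the inward pointing vectors at boundary points. -/
def inwardTM (g : LorentzMetric n M) : Set (TangentBundle (𝓡∂ n) M) :=
  {ξ | ξ ∈ boundaryTM n M ∧ ∃ ν, IsOutwardUnitNormal g ξ.proj ν ∧ g.inner ξ.proj ξ.2 ν < 0}

/-- `∂₊TM`: the outward pointing vectors at boundary points. -/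
def outwardTM (g : LorentzMetric n M) : Set (TangentBundle (𝓡∂ n) M) :=
  {ξ | ξ ∈ boundaryTM n M ∧ ∃ ν, IsOutwardUnitNormal g ξ.proj ν ∧ 0 < g.inner ξ.proj ξ.2 ν}

/-- `LM`: the lightlike vectors. -/
def lightTM (g : LorentzMetric n M) : Set (TangentBundle (𝓡∂ n) M) :=
  {ξ | ξ.2 ≠ 0 ∧ g.sq ξ = 0}

/-- `JM`: the causal vectors. -/
def causalTM (g : LorentzMetric n M) : Set (TangentBundle (𝓡∂ n) M) :=
  {ξ | ξ.2 ≠ 0 ∧ g.sq ξ ≤ 0}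

/-! ### Geodesics -/

/-- The metric in the preferred chart at `p`: for `z` in the target of the chart, this is
`∑ g_{ij}(z) aⁱ bʲ`. -/
def coordMetric (g : LorentzMetric n M) (p : M) (z a b : Vec n) : ℝ :=
  let q : M := (extChartAt (𝓡∂ n) p).symm z
  g.inner q (tangentCoordChange (𝓡∂ n) p q q a) (tangentCoordChange (𝓡∂ n) p q q b)

/-- The directional derivative at `z` along `c` of `∑ g_{ij} aⁱ bʲ` in the chart at `p`, one-sided
where `z` lies on the boundary of the half space. -/
def coordMetricDeriv (g : LorentzMetric n M) (p : M) (z c a b : Vec n) : ℝ :=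
  fderivWithin ℝ (fun z' => coordMetric g p z' a b) (range (𝓡∂ n)) z c

/-- The Christoffel symbols of the first kind in the chart at `p`:
`∑ Γ_{k,ij} uⁱ vʲ bᵏ` with `Γ_{k,ij} = (∂ᵢ g_{jk} + ∂ⱼ g_{ik} - ∂ₖ g_{ij}) / 2`. -/
def christoffel (g : LorentzMetric n M) (p : M) (z u v b : Vec n) : ℝ :=
  (coordMetricDeriv g p z u v b + coordMetricDeriv g p z v u b - coordMetricDeriv g p z b u v) / 2

/-- The curve `β = (γ, γ')` in the tangent bundle is the lift of a geodesic `γ` of `M` on the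
interval `s`. At each time `t`, in the preferred chart at `γ(t)`, the vector part of `β` is the
velocity of `γ`, and its derivative `a` is the acceleration of `γ` and satisfies
`∑ g_{kl} aˡ + ∑ Γ_{k,ij} γ'ⁱ γ'ʲ = 0` for all `k`. -/
structure IsGeodesicOn (g : LorentzMetric n M) (β : ℝ → TangentBundle (𝓡∂ n) M) (s : Set ℝ) :
    Prop where
  continuousOn : ContinuousOn (fun t => (β t).proj) s
  velocity : ∀ t ∈ s, HasDerivWithinAt (fun r => extChartAt (𝓡∂ n) (β t).proj (β r).proj)
    (show Vec n from (β t).2) s t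
  acceleration : ∀ t ∈ s, ∃ a : Vec n,
    HasDerivWithinAt
      (fun r => tangentCoordChange (𝓡∂ n) (β r).proj (β t).proj (β r).proj (β r).2) a s t ∧
    ∀ b : Vec n,
      coordMetric g (β t).proj (extChartAt (𝓡∂ n) (β t).proj (β t).proj) a b +
        christoffel g (β t).proj (extChartAt (𝓡∂ n) (β t).proj (β t).proj) (β t).2 (β t).2 b = 0

/-- The geodesic with initial vector `ξ` is non-trapping: it exits `M` in finite time. That is, the
forward geodesic in `M` exists exactly on a compact time interval `[0, T]`. -/
def IsNonTrapping (g : LorentzMetric n M) (ξ : TangentBundle (𝓡∂ n) M) : Prop :=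
  ∃ T : ℝ, 0 ≤ T ∧ (∃ β, IsGeodesicOn g β (Icc 0 T) ∧ β 0 = ξ) ∧
    ∀ T' > T, ¬ ∃ β, IsGeodesicOn g β (Icc 0 T') ∧ β 0 = ξ

/-! ### Interior travel time data -/

/-- The interior travel time `τⁱⁿ(x, v) = sup {t > 0 : γ((0, t)) ⊆ M°}` for the geodesic `γ` with
initial vector `(x, v)`. -/
def interiorTravelTime (g : LorentzMetric n M) (ξ : TangentBundle (𝓡∂ n) M) : EReal :=
  sSup {τ : EReal | ∃ t : ℝ, τ = t ∧ 0 < t ∧ ∃ β : ℝ → TangentBundle (𝓡∂ n) M,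
    IsGeodesicOn g β (Ico 0 t) ∧ β 0 = ξ ∧ ∀ r ∈ Ioo 0 t, (β r).proj ∈ (𝓡∂ n).interior M}

/-- The graph of the interior scattering relation: `Sⁱⁿ(ξ)` is defined and equal to `η`, that is,
`ξ ∈ ∂₋TM`, the interior travel time `T` of `ξ` is finite and `η = (γ(T), γ'(T))`. -/
def InteriorScattering (g : LorentzMetric n M) (ξ η : TangentBundle (𝓡∂ n) M) : Prop :=
  ξ ∈ inwardTM g ∧ ∃ T : ℝ, interiorTravelTime g ξ = T ∧
    ∃ β : ℝ → TangentBundle (𝓡∂ n) M, IsGeodesicOn g β (Icc 0 T) ∧ β 0 = ξ ∧ β T = η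

/-- `U` is a conic neighborhood of `∂LM`, open in `∂TM`, of non-trapping directions. -/
structure IsNonTrappingConicNhd (g : LorentzMetric n M) (U : Set (TangentBundle (𝓡∂ n) M)) :
    Prop where
  isOpen : ∃ O : Set (TangentBundle (𝓡∂ n) M), IsOpen O ∧ U = O ∩ boundaryTM n M
  conic : ∀ ξ ∈ U, ∀ c : ℝ, 0 < c → (⟨ξ.proj, c • ξ.2⟩ : TangentBundle (𝓡∂ n) M) ∈ U
  light_subset : lightTM g ∩ boundaryTM n M ⊆ U
  nonTrapping : ∀ ξ ∈ U, IsNonTrapping g ξ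

/-- The inward pointing causal vectors in `U`. -/
def inwardCausal (g : LorentzMetric n M) (U : Set (TangentBundle (𝓡∂ n) M)) :
    Set (TangentBundle (𝓡∂ n) M) :=
  U ∩ causalTM g ∩ inwardTM g

/-- A one-parameter family, `0 ≤ l < ε`, of inward pointing causal vectors
`α(l) = (x(l), v(l)) ∈ U` with `Sⁱⁿ(x(l), v(l)) = (y, w(l))` for a fixed boundary point `y`.
It starts at a lightlike vector, is continuous at `l = 0`, and `w(l)` is smooth in `l`, timelike
and outward pointing for `l > 0`, with `(d/dl) g(w(l), w(l)) = -2` at `l = 0`. -/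
structure IsScatteringFamily (g : LorentzMetric n M) (U : Set (TangentBundle (𝓡∂ n) M)) (y : M)
    (ε : ℝ) (w : ℝ → Vec n) (α : ℝ → TangentBundle (𝓡∂ n) M) : Prop where
  pos : 0 < ε
  smooth : ContDiffOn ℝ ∞ w (Ico 0 ε)
  outward : ∀ l ∈ Ioo 0 ε, (⟨y, w l⟩ : TangentBundle (𝓡∂ n) M) ∈ outwardTM g
  timelike : ∀ l ∈ Ioo 0 ε, g.sq ⟨y, w l⟩ < 0
  deriv_sq : HasDerivWithinAt (fun l => g.sq ⟨y, w l⟩) (-2) (Ico 0 ε) 0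
  light : α 0 ∈ lightTM g
  continuousAt : ContinuousWithinAt α (Ico 0 ε) 0
  mem : ∀ l ∈ Ico 0 ε, α l ∈ inwardCausal g U
  scattering : ∀ l ∈ Ico 0 ε, InteriorScattering g (α l) ⟨y, w l⟩

/-! ### Boundary isometries -/

/-- An isometry `φ : ∂M → ∂M'` for the induced boundary metrics, with its differential extended
from `T∂M` to `∂TM` by sending the unit normal to the unit normal, as in boundary normal
coordinates, `(x, v', vⁿ) ↦ (φ(x), φ_* v', vⁿ)`. The values of `φ` off the boundary play no role.
The map `push x` is determined by `φ` at every boundary point `x`: a derivative within the boundary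
is unique on `T_x ∂M`, and this hyperplane and the normal span `T_x M`. -/
structure BoundaryIsometry (g : LorentzMetric n M) (g' : LorentzMetric n M') where
  /-- The bijection of the boundaries. -/
  φ : PartialEquiv M M'
  source_eq : φ.source = (𝓡∂ n).boundary M
  target_eq : φ.target = (𝓡∂ n).boundary M'
  contMDiffOn : ContMDiffOn (𝓡∂ n) (𝓡∂ n) ∞ φ ((𝓡∂ n).boundary M)
  contMDiffOn_symm : ContMDiffOn (𝓡∂ n) (𝓡∂ n) ∞ φ.symm ((𝓡∂ n).boundary M')
  /-- The extended differential at each boundary point. -/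
  push (x : M) : TangentSpace (𝓡∂ n) x →L[ℝ] TangentSpace (𝓡∂ n) (φ x)
  hasMFDerivWithinAt : ∀ x ∈ (𝓡∂ n).boundary M,
    HasMFDerivWithinAt (𝓡∂ n) (𝓡∂ n) φ ((𝓡∂ n).boundary M) x (push x)
  push_normal : ∀ x ∈ (𝓡∂ n).boundary M, ∀ ν, IsOutwardUnitNormal g x ν →
    IsOutwardUnitNormal g' (φ x) (push x ν)
  isometry : ∀ x ∈ (𝓡∂ n).boundary M, ∀ u v, TangentToBoundary x u → TangentToBoundary x v →
    g'.inner (φ x) (push x u) (push x v) = g.inner x u v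

/-- The extended differential `φ_* : ∂TM → ∂TM'` as a map of tangent vectors. -/
def BoundaryIsometry.map {g : LorentzMetric n M} {g' : LorentzMetric n M'}
    (Φ : BoundaryIsometry g g') (ξ : TangentBundle (𝓡∂ n) M) : TangentBundle (𝓡∂ n) M' :=
  ⟨Φ.φ ξ.proj, Φ.push ξ.proj ξ.2⟩

end LorentzScattering

end

open Set Bundle
open scoped Manifold ContDiff Topology

set_option linter.unusedSectionVars false

noncomputable section

namespace LorentzScattering

/-! ### Ordinary differential equations -/

section ODE

open Metric
open scoped NNReal

/-! The travel time formula is a first variation argument. Reverse the geodesics of a scattering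
family: `θ l` starts at the common point `y` with velocity `-w l` and reaches the boundary at the
foot point `x(l)` of `α l` with velocity `-v(l)`. Let `J` be the variation field at `l = 0`. The
scalar square of the velocity is constant along each geodesic and has `l`-derivative `-2`, so the
geodesic equation gives `d/dt g(J, θ₀') = (1/2) ∂ₗ g(θ', θ') = -1`. The starting point is fixed,
hence `g(J, θ₀') = 0` at time `0` and `-τ` at the arrival time `τ`. The derivative `x'(0)` of the
arrival points is `J(τ)` plus a multiple of the velocity, and since the velocity is null this
correction does not change the product. So `g(x'(0), -v) = -τ`. The reversal is essential: the
arrival at `x` is transversal because `v` points inward, whereas `w` may be tangent to the boundary.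
The steps are `firstVariation_inner`, `HasVariation.propagate`, `exists_arrival_derivative` and
`travelTime_formula`; the arrival times converge by `tendsto_arrivalTime`.

A scattering family is made by turning the exit vector: `w + l u` with `g(w, u) = -1` and `u`
outward has square `-2 l + O(l²)`. Such a `u` exists even for tangential `w`, since the boundary
metric is nondegenerate (`exists_turning_vector`). Reversed geodesics with these initial vectors are
assembled from three pieces in `IsScatteringGeodesic.exists_nearby`. At the start the turn lifts the
geodesic off the boundary by comparison with the unperturbed one, in the middle the interior is
open, and at the end the arrival is transversal.

All of this takes place in a manifold with boundary, without enlarging it. In a chart, geodesics are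
integral curves of a `C¹` field on the half space. Composed with the retraction onto the half space,
the field becomes locally Lipschitz on both sides, which gives flow boxes, uniqueness and continuous
dependence. The linearised equation uses only the original field, on a compact convex piece of the
half space.

For the comparison of two manifolds, the boundary isometry carries a scattering family to a family
whose vectors are not known to vary continuously. Therefore `travelTime_formula` asks only for
continuity of the foot points and a uniform bound on the normal component. Both survive the
isometry, `x'(0)` is carried to its image by the chain rule, and the products agree. -/

/-- A reflexive and transitive relation on times which holds locally holds on a whole compact
interval. -/
theorem rel_of_locally_rel {P : ℝ → ℝ → Prop} {a b : ℝ} (hab : a ≤ b)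
    (refl : ∀ t ∈ Icc a b, P t t)
    (trans : ∀ r ∈ Icc a b, ∀ s ∈ Icc a b, ∀ t ∈ Icc a b, r ≤ s → s ≤ t → P r s → P s t → P r t)
    (loc : ∀ t ∈ Icc a b, ∃ δ > 0, ∀ r ∈ Icc a b, ∀ s ∈ Icc a b, r ≤ s →
      |r - t| < δ → |s - t| < δ → P r s) : P a b := by
  have haI : a ∈ Icc a b := ⟨le_rfl, hab⟩
  let S : Set ℝ := {t | t ∈ Icc a b ∧ P a t}
  have hne : S.Nonempty := ⟨a, haI, refl a haI⟩
  have hbd : BddAbove S := ⟨b, fun t ht => ht.1.2⟩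
  have hc : sSup S ∈ Icc a b :=
    ⟨le_csSup hbd ⟨haI, refl a haI⟩, csSup_le hne fun t ht => ht.1.2⟩
  obtain ⟨δ, hδ, hloc⟩ := loc _ hc
  obtain ⟨t, ⟨htI, hPt⟩, ht⟩ := exists_lt_of_lt_csSup hne (show sSup S - δ < sSup S by linarith)
  have htS : t ≤ sSup S := le_csSup hbd ⟨htI, hPt⟩
  -- If the supremum were below `b`, the local relation would carry `P a` from a time just below the
  -- supremum to a time beyond it. So `s` can only be `b`.
  set s := min b (sSup S + δ / 2) with hs
  have hsI : s ∈ Icc a b := ⟨le_min hab (by linarith [hc.1]), min_le_left _ _⟩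
  have hts : t ≤ s := le_min htI.2 (by linarith)
  have h1 : sSup S ≤ s := le_min hc.2 (by linarith)
  have h2 : s ≤ sSup S + δ / 2 := min_le_right _ _
  have hPs : P a s := trans a haI t htI s hsI htI.1 hts hPt
    (hloc t htI s hsI hts (by rw [abs_lt]; constructor <;> linarith)
      (by rw [abs_lt]; constructor <;> linarith))
  have h3 : s ≤ sSup S := le_csSup hbd ⟨hsI, hPs⟩
  rcases min_choice b (sSup S + δ / 2) with h | h
  · rwa [hs, h] at hPs
  · rw [← hs] at h
    linarith

variable {E : Type*} [NormedAddCommGroup E] [NormedSpace ℝ E]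

/-- The local flow of a vector field that is Lipschitz on a closed ball. -/
theorem exists_localFlow [CompleteSpace E] {f : E → E} {x₀ : E} {a K : ℝ≥0} (ha : 0 < a)
    (hf : LipschitzOnWith K f (closedBall x₀ a)) :
    ∃ r > 0, ∃ ε > 0, ∃ α : E × ℝ → E,
      (∀ x ∈ closedBall x₀ r, α (x, 0) = x ∧ ∀ t ∈ Icc (-ε) ε,
        HasDerivWithinAt (fun t => α (x, t)) (f (α (x, t))) (Icc (-ε) ε) t ∧
        α (x, t) ∈ closedBall x₀ a) ∧
      ContinuousOn α (closedBall x₀ r ×ˢ Icc (-ε) ε) ∧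
      ∃ C : ℝ≥0, ∀ t ∈ Icc (-ε) ε, LipschitzOnWith C (fun x => α (x, t)) (closedBall x₀ r) := by
  classical
  -- A bound for the speed on the ball; the added one only makes it positive, so that it can be
  -- divided by.
  set L : ℝ≥0 := K * a + ‖f x₀‖₊ + 1 with hL
  have hLpos : 0 < L := by positivity
  have hb : ∀ x ∈ closedBall x₀ (a : ℝ), ‖f x‖ ≤ L := by
    intro x hx
    have h1 := hf.norm_sub_le hx (mem_closedBall_self a.2)
    have h2 : ‖x - x₀‖ ≤ a := by rwa [← mem_closedBall_iff_norm]
    have h3 : ‖f x‖ ≤ ‖f x - f x₀‖ + ‖f x₀‖ := norm_le_norm_sub_add _ _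
    have h4 : (K : ℝ) * ‖x - x₀‖ ≤ K * a := by gcongr
    rw [hL]; push_cast; linarith
  -- At speed at most `L`, a trajectory from the ball of radius `a / 2` stays for this time in the
  -- ball of radius `a`.
  set ε : ℝ := a / 2 / L with hε
  have hεpos : 0 < ε := by positivity
  have h0 : (0 : ℝ) ∈ Icc (-ε) ε := ⟨by linarith, hεpos.le⟩
  have hm : (L : ℝ) * max (ε - (⟨0, h0⟩ : Icc (-ε) ε)) ((⟨0, h0⟩ : Icc (-ε) ε) - -ε) ≤
      a - (a / 2 : ℝ≥0) := by
    have h2 : (L : ℝ) * (a / 2 / L) = a / 2 := by field_simp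
    simp only [sub_zero, sub_neg_eq_add, zero_add, max_self, hε, h2]
    push_cast; linarith
  have hpl : IsPicardLindelof (fun _ => f) (⟨0, h0⟩ : Icc (-ε) ε) x₀ a (a / 2) L K :=
    IsPicardLindelof.of_time_independent hb hf hm
  have (x) (hx : x ∈ closedBall x₀ ((a / 2 : ℝ≥0) : ℝ)) :=
    ODE.FunSpace.exists_isFixedPt_next hpl hx
  choose α hα using this
  let α' : E × ℝ → E := fun y => if hx : y.1 ∈ closedBall x₀ ((a / 2 : ℝ≥0) : ℝ) then
    (α y.1 hx).compProj y.2 else 0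
  have hα' : ∀ x (hx : x ∈ closedBall x₀ ((a / 2 : ℝ≥0) : ℝ)), ∀ t,
      α' (x, t) = (α x hx).compProj t := fun x hx t => dif_pos hx
  have hder : ∀ x ∈ closedBall x₀ ((a / 2 : ℝ≥0) : ℝ), α' (x, 0) = x ∧ ∀ t ∈ Icc (-ε) ε,
      HasDerivWithinAt (fun t => α' (x, t)) (f (α' (x, t))) (Icc (-ε) ε) t ∧
      α' (x, t) ∈ closedBall x₀ (a : ℝ) := by
    intro x hx
    refine ⟨?_, fun t ht => ⟨?_, ?_⟩⟩
    · have h1 : (α x hx).compProj ((⟨0, h0⟩ : Icc (-ε) ε) : ℝ) = x := by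
        rw [ODE.FunSpace.compProj_val, ← hα x hx, ODE.FunSpace.next_apply₀]
      rw [hα' x hx]
      exact h1
    · simp only [hα' x hx]
      apply ODE.hasDerivWithinAt_picard_Icc (t₀ := ((⟨0, h0⟩ : Icc (-ε) ε) : ℝ)) h0
        hpl.continuousOn_uncurry
        (α x hx |>.continuous_compProj.continuousOn)
        (fun _ ht' ↦ α x hx |>.compProj_mem_closedBall hpl.mul_max_le)
        x ht |>.congr_of_mem _ ht
      intro t' ht'
      nth_rw 1 [← hα x hx]
      rw [ODE.FunSpace.compProj_of_mem ht', ODE.FunSpace.next_apply]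
    · rw [hα' x hx]
      exact (α x hx).compProj_mem_closedBall hpl.mul_max_le
  obtain ⟨C, hC⟩ := ODE.FunSpace.exists_forall_closedBall_funSpace_dist_le_mul hpl
  have hlip : ∀ t ∈ Icc (-ε) ε,
      LipschitzOnWith C (fun x => α' (x, t)) (closedBall x₀ ((a / 2 : ℝ≥0) : ℝ)) := by
    refine fun t ht ↦ LipschitzOnWith.of_dist_le_mul fun x hx y hy ↦ ?_
    rw [hα' x hx, hα' y hy, ODE.FunSpace.compProj_apply, ODE.FunSpace.compProj_apply,
      ← ODE.FunSpace.toContinuousMap_apply_eq_apply, ← ODE.FunSpace.toContinuousMap_apply_eq_apply]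
    have : Nonempty (Icc (-ε) ε) := ⟨⟨0, h0⟩⟩
    apply ContinuousMap.dist_le_iff_of_nonempty.mp
    exact hC x y hx hy (α x hx) (α y hy) (hα x hx) (hα y hy)
  refine ⟨(a / 2 : ℝ≥0), by positivity, ε, hεpos, α', hder, ?_, C, hlip⟩
  apply continuousOn_prod_of_continuousOn_lipschitzOnWith α' C _ hlip
  exact fun x hx ↦ HasDerivWithinAt.continuousOn fun t ht => ((hder x hx).2 t ht).1

/-- Short time existence for linear equations. -/
theorem exists_linearODE [CompleteSpace E] {A : ℝ → E →L[ℝ] E} {a b : ℝ} (hab : a ≤ b) {L : ℝ≥0}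
    (hA : ContinuousOn A (Icc a b)) (hL : ∀ t ∈ Icc a b, ‖A t‖ ≤ L) (hLab : L * (b - a) ≤ 1 / 2)
    (x : E) : ∃ J : ℝ → E, J a = x ∧ ∀ t ∈ Icc a b, HasDerivWithinAt J (A t (J t)) (Icc a b) t := by
  have haI : a ∈ Icc a b := ⟨le_rfl, hab⟩
  -- On the ball of radius `‖x‖ + 1` about `x` norms are at most `2 * ‖x‖ + 1`. By `hLab` a solution
  -- then moves by at most `‖x‖ + 1 / 2` and stays in the ball.
  have hpl : IsPicardLindelof (fun t y => A t y) (⟨a, haI⟩ : Icc a b) x (‖x‖₊ + 1) 0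
      (L * (2 * ‖x‖₊ + 1)) L := by
    refine ⟨fun t ht => ?_, fun y _ => hA.clm_apply continuousOn_const, fun t ht y hy => ?_, ?_⟩
    · exact ((A t).lipschitz.weaken (hL t ht)).lipschitzOnWith
    · have h1 : ‖y‖ ≤ 2 * ‖x‖ + 1 := by
        have h2 : ‖y - x‖ ≤ ‖x‖ + 1 := by
          have := mem_closedBall_iff_norm.1 hy
          simpa using this
        have := norm_le_norm_sub_add y x
        linarith
      calc ‖A t y‖ ≤ ‖A t‖ * ‖y‖ := (A t).le_opNorm y
        _ ≤ L * (2 * ‖x‖ + 1) := by gcongr; exact hL t ht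
        _ = _ := by push_cast; rfl
    · have h1 : max (b - a) (a - a) = b - a := by
        rw [sub_self]; exact max_eq_left (by linarith)
      simp only [h1]
      push_cast
      have : (L : ℝ) * (2 * ‖x‖ + 1) * (b - a) = (L * (b - a)) * (2 * ‖x‖ + 1) := by ring
      rw [this]
      have h3 : (L * (b - a)) * (2 * ‖x‖ + 1) ≤ 1 / 2 * (2 * ‖x‖ + 1) := by gcongr
      linarith [norm_nonneg x]
  exact hpl.exists_eq_forall_mem_Icc_hasDerivWithinAt₀

/-- First order Taylor expansion, uniformly on a compact convex set. -/
theorem uniform_taylor {f : E → E} {f' : E → E →L[ℝ] E} {s : Set E} (hs : IsCompact s)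
    (hc : Convex ℝ s) (hf : ∀ x ∈ s, HasFDerivWithinAt f (f' x) s x) (hf' : ContinuousOn f' s)
    {η : ℝ} (hη : 0 < η) :
    ∃ δ > 0, ∀ x ∈ s, ∀ y ∈ s, ‖y - x‖ < δ → ‖f y - f x - f' x (y - x)‖ ≤ η * ‖y - x‖ := by
  obtain ⟨δ, hδ, hu⟩ := Metric.uniformContinuousOn_iff.1
    (hs.uniformContinuousOn_of_continuous hf') η hη
  refine ⟨δ, hδ, fun x hx y hy hxy => ?_⟩
  -- On this convex set `f'` differs from `f' x` by at most `η`, so the mean value inequality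
  -- applies to `f` minus its linear part.
  have hconv : Convex ℝ (s ∩ ball x δ) := hc.inter (convex_ball x δ)
  refine hconv.norm_image_sub_le_of_norm_hasFDerivWithin_le'
    (fun z hz => (hf z hz.1).mono inter_subset_left) (fun z hz => ?_) ⟨hx, mem_ball_self hδ⟩
    ⟨hy, by rwa [mem_ball_iff_norm]⟩
  have := hu z hz.1 x hx hz.2
  rw [dist_eq_norm] at this
  exact this.le

/-- Gronwall and uniqueness arguments use right derivatives, while geodesics are differentiated
within closed intervals. -/
theorem hasDerivWithinAt_Ici_of_Icc {f : ℝ → E} {f' : E} {a b t : ℝ}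
    (h : HasDerivWithinAt f f' (Icc a b) t) (ht : t ∈ Ico a b) : HasDerivWithinAt f f' (Ici t) t :=
  h.mono_of_mem_nhdsWithin (Filter.mem_of_superset
    (Filter.inter_mem (mem_nhdsWithin_of_mem_nhds (Iio_mem_nhds ht.2)) self_mem_nhdsWithin)
    fun _ hr => ⟨ht.1.trans hr.2, hr.1.le⟩)

/-- Differentiable dependence on a parameter: if the initial values of a family of solutions have
the first order expansion `z₀(a) + cᵢ J(a) + o(cᵢ)` and `J` solves the linearized equation along
`z₀`, then `zᵢ(t) = z₀(t) + cᵢ J(t) + o(cᵢ)`, uniformly in `t`. The time intervals `[a, bᵢ]` of the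
solutions may depend on the parameter. -/
theorem flow_first_order {f : E → E} {f' : E → E →L[ℝ] E} {s : Set E} (hs : IsCompact s)
    (hc : Convex ℝ s) (hf : ∀ x ∈ s, HasFDerivWithinAt f (f' x) s x) (hf' : ContinuousOn f' s)
    {a b : ℝ} {z₀ J : ℝ → E}
    (hz₀ : ∀ t ∈ Icc a b, HasDerivWithinAt z₀ (f (z₀ t)) (Icc a b) t)
    (hz₀s : ∀ t ∈ Icc a b, z₀ t ∈ s)
    (hJ : ∀ t ∈ Icc a b, HasDerivWithinAt J (f' (z₀ t) (J t)) (Icc a b) t)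
    {ι : Type*} {l : Filter ι} {c : ι → ℝ} (hc0 : Filter.Tendsto c l (𝓝 0)) {bi : ι → ℝ}
    {z : ι → ℝ → E} (hbi : ∀ᶠ i in l, bi i ≤ b)
    (hz : ∀ᶠ i in l, ∀ t ∈ Icc a (bi i), HasDerivWithinAt (z i) (f (z i t)) (Icc a (bi i)) t)
    (hzs : ∀ᶠ i in l, ∀ t ∈ Icc a (bi i), z i t ∈ s)
    (hinit : ∀ η > 0, ∀ᶠ i in l, ‖z i a - z₀ a - c i • J a‖ ≤ η * |c i|)
    {η : ℝ} (hη : 0 < η) :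
    ∀ᶠ i in l, ∀ t ∈ Icc a (bi i), ‖z i t - z₀ t - c i • J t‖ ≤ η * |c i| := by
  -- a bound for the derivative and for `J`
  obtain ⟨K, hK⟩ := hs.exists_bound_of_continuousOn hf'
  obtain ⟨R, hR⟩ := isCompact_Icc.exists_bound_of_continuousOn
    (HasDerivWithinAt.continuousOn hJ)
  -- The added one keeps the constant positive, so that the Gronwall bound has its exponential
  -- closed form.
  set K' : ℝ≥0 := ‖K‖₊ + 1 with hK'
  have hKK' : ∀ x ∈ s, ‖f' x‖ ≤ K' := fun x hx => by
    have := (hK x hx).trans (le_abs_self K)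
    rw [hK']; push_cast; rw [Real.norm_eq_abs]; linarith
  have hK'pos : (0 : ℝ) < K' := by rw [hK']; positivity
  have hlip : LipschitzOnWith K' f s := hc.lipschitzOnWith_of_nnnorm_hasFDerivWithin_le hf
    fun x hx => hKK' x hx
  set R' : ℝ := |R| + 1
  have hR'pos : 0 < R' := by positivity
  have hRR' : ∀ t ∈ Icc a b, ‖J t‖ ≤ R' := fun t ht => (hR t ht).trans
    ((le_abs_self R).trans (by simp [R']))
  set G : ℝ := Real.exp (K' * (b - a)) with hG
  have hGpos : 0 < G := Real.exp_pos _
  set Q : ℝ := (1 + R') * G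
  have hQpos : 0 < Q := by positivity
  -- smallness of the constants
  set η' : ℝ := η / (2 * G) with hη'
  have hη'pos : 0 < η' := by positivity
  set η'' : ℝ := η * K' / (2 * G * Q) with hη''
  have hη''pos : 0 < η'' := by positivity
  obtain ⟨δ, hδ, htay⟩ := uniform_taylor hs hc hf hf' hη''pos
  have hsmall : ∀ᶠ i in l, Q * |c i| < δ := by
    have : Filter.Tendsto (fun i => Q * |c i|) l (𝓝 (Q * |(0 : ℝ)|)) := (hc0.abs).const_mul Q
    rw [abs_zero, mul_zero] at this
    exact this.eventually_lt_const hδ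
  filter_upwards [hbi, hz, hzs, hinit 1 one_pos, hinit η' hη'pos, hsmall] with i h1 h2 h3 h4 h5 h6
  intro t ht
  have hsub : Icc a (bi i) ⊆ Icc a b := Icc_subset_Icc_right h1
  have hab : a ≤ b := (ht.1.trans ht.2).trans h1
  have haI : a ∈ Icc a b := ⟨le_rfl, hab⟩
  have hz₀' : ∀ t ∈ Icc a (bi i), HasDerivWithinAt z₀ (f (z₀ t)) (Icc a (bi i)) t :=
    fun t ht => (hz₀ t (hsub ht)).mono hsub
  have hJ' : ∀ t ∈ Icc a (bi i), HasDerivWithinAt J (f' (z₀ t) (J t)) (Icc a (bi i)) t :=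
    fun t ht => (hJ t (hsub ht)).mono hsub
  have hIco : ∀ {t}, t ∈ Ico a (bi i) → t ∈ Icc a (bi i) := fun h => Ico_subset_Icc_self h
  -- Lipschitz estimate
  have hd0 : dist (z i a) (z₀ a) ≤ (1 + R') * |c i| := by
    rw [dist_eq_norm]
    have e1 : z i a - z₀ a = (z i a - z₀ a - c i • J a) + c i • J a := by abel
    rw [e1]
    refine (norm_add_le _ _).trans ?_
    rw [norm_smul, Real.norm_eq_abs]
    have := mul_le_mul_of_nonneg_left (hRR' a haI) (abs_nonneg (c i))
    linarith
  have hd : ∀ t ∈ Icc a (bi i), ‖z i t - z₀ t‖ ≤ Q * |c i| := by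
    intro t ht
    have := dist_le_of_trajectories_ODE_of_mem (v := fun _ => f) (s := fun _ => s)
      (fun _ _ => hlip) (HasDerivWithinAt.continuousOn h2)
      (fun t ht => hasDerivWithinAt_Ici_of_Icc (h2 t (hIco ht)) ht) (fun t ht => h3 t (hIco ht))
      (HasDerivWithinAt.continuousOn hz₀')
      (fun t ht => hasDerivWithinAt_Ici_of_Icc (hz₀' t (hIco ht)) ht)
      (fun t ht => hz₀s t (hsub (hIco ht))) hd0 t ht
    rw [dist_eq_norm] at this
    have hexp : Real.exp (K' * (t - a)) ≤ G := by
      rw [hG, Real.exp_le_exp]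
      have := (hsub ht).2
      gcongr
    calc ‖z i t - z₀ t‖ ≤ (1 + R') * |c i| * Real.exp (K' * (t - a)) := this
      _ ≤ (1 + R') * |c i| * G := by gcongr
      _ = Q * |c i| := by simp only [Q]; ring
  -- the remainder
  have hder : ∀ t ∈ Ico a (bi i), HasDerivWithinAt (fun t => z i t - z₀ t - c i • J t)
      (f (z i t) - f (z₀ t) - c i • f' (z₀ t) (J t)) (Ici t) t := fun t ht =>
    hasDerivWithinAt_Ici_of_Icc
      (((h2 t (hIco ht)).sub (hz₀' t (hIco ht))).sub ((hJ' t (hIco ht)).const_smul (c i))) ht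
  have hcont : ContinuousOn (fun t => z i t - z₀ t - c i • J t) (Icc a (bi i)) :=
    HasDerivWithinAt.continuousOn fun t ht =>
      ((h2 t ht).sub (hz₀' t ht)).sub ((hJ' t ht).const_smul (c i))
  have hbound : ∀ t ∈ Ico a (bi i), ‖f (z i t) - f (z₀ t) - c i • f' (z₀ t) (J t)‖ ≤
      K' * ‖z i t - z₀ t - c i • J t‖ + η'' * Q * |c i| := by
    intro t ht
    have hm0 := hz₀s t (hsub (hIco ht))
    have e1 : f (z i t) - f (z₀ t) - c i • f' (z₀ t) (J t) =
        f' (z₀ t) (z i t - z₀ t - c i • J t) +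
          (f (z i t) - f (z₀ t) - f' (z₀ t) (z i t - z₀ t)) := by
      rw [map_sub (f' (z₀ t)) (z i t - z₀ t), map_smul]; abel
    rw [e1]
    refine (norm_add_le _ _).trans (add_le_add ?_ ?_)
    · exact ((f' (z₀ t)).le_opNorm _).trans (by gcongr; exact hKK' _ hm0)
    · refine (htay _ hm0 _ (h3 t (hIco ht)) ((hd t (hIco ht)).trans_lt h6)).trans ?_
      rw [mul_assoc]
      gcongr
      exact hd t (hIco ht)
  have hgr := norm_le_gronwallBound_of_norm_deriv_right_le hcont hder h5 hbound t ht
  refine hgr.trans ?_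
  -- The two terms are the initial error and the accumulated Taylor error; `η'` and `η''` were
  -- chosen so that each is at most `η / 2 * |c i|`.
  rw [gronwallBound_of_K_ne_0 hK'pos.ne']
  have hexp : Real.exp (K' * (t - a)) ≤ G := by
    rw [hG, Real.exp_le_exp]
    have := (hsub ht).2
    gcongr
  have e2 : η' * |c i| * Real.exp (K' * (t - a)) ≤ η / 2 * |c i| := by
    calc η' * |c i| * Real.exp (K' * (t - a)) ≤ η' * |c i| * G := by gcongr
      _ = η / 2 * |c i| := by rw [hη']; field_simp
  have e3 : η'' * Q * |c i| / K' * (Real.exp (K' * (t - a)) - 1) ≤ η / 2 * |c i| := by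
    calc η'' * Q * |c i| / K' * (Real.exp (K' * (t - a)) - 1) ≤ η'' * Q * |c i| / K' * G := by
          gcongr; linarith
      _ = η / 2 * |c i| := by rw [hη'']; field_simp
  linarith

end ODE

/-! ### The geodesic spray of a field of bilinear forms on a vector space -/

section Spray

variable {E : Type*} [NormedAddCommGroup E] [NormedSpace ℝ E]

instance instNormedAddCommGroupForm : NormedAddCommGroup (E →L[ℝ] E →L[ℝ] ℝ) :=
  ContinuousLinearMap.toNormedAddCommGroup

instance instNormedSpaceForm : NormedSpace ℝ (E →L[ℝ] E →L[ℝ] ℝ) :=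
  ContinuousLinearMap.toNormedSpace

instance instNormedAddCommGroupTrilinear : NormedAddCommGroup (E →L[ℝ] E →L[ℝ] E →L[ℝ] ℝ) :=
  ContinuousLinearMap.toNormedAddCommGroup

instance instNormedSpaceTrilinear : NormedSpace ℝ (E →L[ℝ] E →L[ℝ] E →L[ℝ] ℝ) :=
  ContinuousLinearMap.toNormedSpace

/-- A one-sided chain rule: coordinate expressions are differentiable only within the half space,
and a curve has to lie there only near the time in question. -/
theorem hasDerivWithinAt_comp_of_eventually_mem {F : Type*} [NormedAddCommGroup F]
    [NormedSpace ℝ F] {l : E → F} {l' : E →L[ℝ] F} {t : Set E} {f : ℝ → E} {f' : E} {s : Set ℝ}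
    {x : ℝ} (hl : HasFDerivWithinAt l l' t (f x)) (hf : HasDerivWithinAt f f' s x)
    (hft : ∀ᶠ r in 𝓝[s] x, f r ∈ t) : HasDerivWithinAt (fun r => l (f r)) (l' f') s x := by
  have h := HasFDerivWithinAt.comp_hasDerivWithinAt x (t := t) (s := s ∩ f ⁻¹' t) hl
    (hf.mono inter_subset_left) fun r hr => hr.2
  exact h.mono_of_mem_nhdsWithin (Filter.inter_mem self_mem_nhdsWithin hft)

/-- The derivative along `c` of `A z a b`, one-sided at the boundary of `H`. -/
def formDeriv (A : E → E →L[ℝ] E →L[ℝ] ℝ) (H : Set E) (z c a b : E) : ℝ :=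
  fderivWithin ℝ A H z c a b

theorem fderivWithin_form_apply {A : E → E →L[ℝ] E →L[ℝ] ℝ} {H : Set E} {z : E}
    (hH : UniqueDiffWithinAt ℝ H z) (hA : DifferentiableWithinAt ℝ A H z) (c a b : E) :
    fderivWithin ℝ (fun z' => A z' a b) H z c = formDeriv A H z c a b := by
  have h := ((hA.hasFDerivWithinAt.clm_apply (hasFDerivWithinAt_const a z H)).clm_apply
    (hasFDerivWithinAt_const b z H)).fderivWithin hH
  rw [h]
  simp [formDeriv]

theorem hasDerivWithinAt_form_apply {A : E → E →L[ℝ] E →L[ℝ] ℝ} {H : Set E} {z u w : ℝ → E}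
    {z' u' w' : E} {s : Set ℝ} {t : ℝ} (hA : DifferentiableWithinAt ℝ A H (z t))
    (hz : HasDerivWithinAt z z' s t) (hu : HasDerivWithinAt u u' s t)
    (hw : HasDerivWithinAt w w' s t) (hzH : ∀ᶠ r in 𝓝[s] t, z r ∈ H) :
    HasDerivWithinAt (fun r => A (z r) (u r) (w r))
      (formDeriv A H (z t) z' (u t) (w t) + A (z t) u' (w t) + A (z t) (u t) w') s t := by
  have h1 : HasDerivWithinAt (fun r => A (z r)) (fderivWithin ℝ A H (z t) z') s t :=
    hasDerivWithinAt_comp_of_eventually_mem hA.hasFDerivWithinAt hz hzH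
  have h2 := (h1.clm_apply hu).clm_apply hw
  simpa only [formDeriv, add_apply] using h2

/-- The functional `b ↦ ∑ Γ_{k,ij} vⁱ vʲ bᵏ` of the Christoffel symbols of the first kind. -/
def christoffelForm (A : E → E →L[ℝ] E →L[ℝ] ℝ) (H : Set E) (z v : E) : E →L[ℝ] ℝ :=
  fderivWithin ℝ A H z v v - (1 / 2 : ℝ) • ((fderivWithin ℝ A H z).flip v).flip v

theorem christoffelForm_apply (A : E → E →L[ℝ] E →L[ℝ] ℝ) (H : Set E) (z v b : E) :
    christoffelForm A H z v b = formDeriv A H z v v b - 1 / 2 * formDeriv A H z b v v := by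
  simp [christoffelForm, formDeriv]

/-- The geodesic spray. -/
def spray (A : E → E →L[ℝ] E →L[ℝ] ℝ) (H : Set E) (ζ : E × E) : E × E :=
  (ζ.2, -(A ζ.1).inverse (christoffelForm A H ζ.1 ζ.2))

/-- The acceleration is quadratic in the velocity; this is what makes geodesics reversible. -/
theorem spray_neg (A : E → E →L[ℝ] E →L[ℝ] ℝ) (H : Set E) (z v : E) :
    spray A H (z, -v) = (-v, (spray A H (z, v)).2) := by
  simp only [spray, Prod.mk.injEq, true_and]
  congr 2
  ext b
  simp [christoffelForm_apply, formDeriv]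

/-- Nondegeneracy allows the geodesic equation, tested against every vector, to be solved for the
acceleration. -/
theorem eq_spray_snd_iff {A : E → E →L[ℝ] E →L[ℝ] ℝ} {H : Set E} {z v a : E}
    (hA : (A z).IsInvertible) :
    a = (spray A H (z, v)).2 ↔ ∀ b, A z a b + christoffelForm A H z v b = 0 := by
  have h1 : a = (spray A H (z, v)).2 ↔ (A z).inverse (christoffelForm A H z v) = -a := by
    simp only [spray]
    exact ⟨fun h => by rw [h, neg_neg], fun h => by rw [h, neg_neg]⟩
  rw [h1, hA.inverse_apply_eq]
  constructor
  · intro h b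
    rw [h, map_neg]; simp
  · intro h
    ext b
    have := h b
    rw [map_neg]
    simp only [neg_apply]
    linarith

/-- Inversion of operators is smooth, and the Christoffel form costs one derivative of `A`. Class
`C¹` is enough for local Lipschitz bounds and for the linearised equation. -/
theorem contDiffOn_spray [CompleteSpace E] {A : E → E →L[ℝ] E →L[ℝ] ℝ} {H t : Set E} (htH : t ⊆ H)
    (hH : UniqueDiffOn ℝ H) (hA : ∀ z ∈ t, ContDiffWithinAt ℝ ∞ A H z)
    (hinv : ∀ z ∈ t, (A z).IsInvertible) : ContDiffOn ℝ 1 (spray A H) (t ×ˢ univ) := by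
  have hA1 : ContDiffOn ℝ 1 A t := fun z hz =>
    ((hA z hz).of_le (by exact_mod_cast le_top)).mono htH
  have hD : ContDiffOn ℝ 1 (fderivWithin ℝ A H) t := fun z hz =>
    ((hA z hz).fderivWithin_right (m := 1) hH (by norm_cast) (htH hz)).mono htH
  have hfst : ContDiffOn ℝ 1 (fun ζ : E × E => ζ.1) (t ×ˢ univ) := contDiffOn_fst
  have hsnd : ContDiffOn ℝ 1 (fun ζ : E × E => ζ.2) (t ×ˢ univ) := contDiffOn_snd
  have hm : MapsTo (fun ζ : E × E => ζ.1) (t ×ˢ univ) t := fun ζ hζ => hζ.1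
  have hD' : ContDiffOn ℝ 1 (fun ζ : E × E => fderivWithin ℝ A H ζ.1) (t ×ˢ univ) := hD.comp hfst hm
  have hinv' : ContDiffOn ℝ 1 (fun ζ : E × E => (A ζ.1).inverse) (t ×ˢ univ) := by
    have : ContDiffOn ℝ 1 (fun z => (A z).inverse) t := by
      intro z hz
      obtain ⟨e, he⟩ := hinv z hz
      have h1 := contDiffAt_map_inverse (n := 1) e
      rw [he] at h1
      exact h1.comp_contDiffWithinAt z (hA1 z hz)
    exact this.comp hfst hm
  have hflip : ContDiffOn ℝ 1 (fun ζ : E × E => (fderivWithin ℝ A H ζ.1).flip) (t ×ˢ univ) :=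
    (ContinuousLinearMap.flipₗᵢ ℝ E E (E →L[ℝ] ℝ)).toContinuousLinearEquiv.contDiff.comp_contDiffOn
      hD'
  have hflip2 : ContDiffOn ℝ 1 (fun ζ : E × E => ((fderivWithin ℝ A H ζ.1).flip ζ.2).flip)
      (t ×ˢ univ) :=
    (ContinuousLinearMap.flipₗᵢ ℝ E E ℝ).toContinuousLinearEquiv.contDiff.comp_contDiffOn
      (hflip.clm_apply hsnd)
  refine hsnd.prodMk (ContDiffOn.neg (hinv'.clm_apply ?_))
  exact ((hD'.clm_apply hsnd).clm_apply hsnd).sub ((hflip2.clm_apply hsnd).const_smul (1 / 2 : ℝ))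

variable {A₁ A₂ : E → E →L[ℝ] E →L[ℝ] ℝ} {H : Set E} {ψ : E → E} {z : E}

/-- How the derivative of a bilinear form transforms under a change of coordinates. -/
theorem formDeriv_change (hH : UniqueDiffOn ℝ H) (hz : z ∈ H)
    (hψ : ContDiffWithinAt ℝ ∞ ψ H z) (hψH : ∀ᶠ z' in 𝓝[H] z, ψ z' ∈ H)
    (hA₁ : DifferentiableWithinAt ℝ A₁ H z) (hA₂ : DifferentiableWithinAt ℝ A₂ H (ψ z))
    (hA : ∀ᶠ z' in 𝓝[H] z, ∀ a b,
      A₁ z' a b = A₂ (ψ z') (fderivWithin ℝ ψ H z' a) (fderivWithin ℝ ψ H z' b)) (c a b : E) :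
    formDeriv A₁ H z c a b =
      formDeriv A₂ H (ψ z) (fderivWithin ℝ ψ H z c) (fderivWithin ℝ ψ H z a)
        (fderivWithin ℝ ψ H z b) +
      A₂ (ψ z) (fderivWithin ℝ (fderivWithin ℝ ψ H) H z c a) (fderivWithin ℝ ψ H z b) +
      A₂ (ψ z) (fderivWithin ℝ ψ H z a) (fderivWithin ℝ (fderivWithin ℝ ψ H) H z c b) := by
  have hψd : HasFDerivWithinAt ψ (fderivWithin ℝ ψ H z) H z :=
    (hψ.differentiableWithinAt (by simp)).hasFDerivWithinAt
  have hP : HasFDerivWithinAt (fderivWithin ℝ ψ H) (fderivWithin ℝ (fderivWithin ℝ ψ H) H z) H z :=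
    ((hψ.fderivWithin_right (m := 1) hH (by norm_cast) hz).differentiableWithinAt
      (by simp)).hasFDerivWithinAt
  have h1 : HasFDerivWithinAt (fun z' => A₁ z' a b) _ H z :=
    (hA₁.hasFDerivWithinAt.clm_apply (hasFDerivWithinAt_const a z H)).clm_apply
      (hasFDerivWithinAt_const b z H)
  have hcomp : HasFDerivWithinAt (fun z' => A₂ (ψ z')) _ H z :=
    HasFDerivWithinAt.comp_of_tendsto (t := H) z hA₂.hasFDerivWithinAt hψd
      (tendsto_nhdsWithin_iff.2 ⟨hψd.continuousWithinAt, hψH⟩)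
  have h2 : HasFDerivWithinAt
      (fun z' => A₂ (ψ z') (fderivWithin ℝ ψ H z' a) (fderivWithin ℝ ψ H z' b)) _ H z :=
    (hcomp.clm_apply (hP.clm_apply (hasFDerivWithinAt_const a z H))).clm_apply
      (hP.clm_apply (hasFDerivWithinAt_const b z H))
  have h3 := h2.congr_of_eventuallyEq (hA.mono fun z' h => h a b) (hA.self_of_nhdsWithin hz a b)
  have h4 := congrArg (fun L => L c) ((hH z hz).eq h1 h3)
  simp [formDeriv] at h4 ⊢
  linarith

/-- Of the second derivative terms in `formDeriv_change`, those that involve `b` cancel because the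
second derivative of `ψ` is symmetric. At boundary points of `H` this symmetry uses that they are
limits of interior points. -/
theorem christoffelForm_change (hH : UniqueDiffOn ℝ H) (hz : z ∈ H)
    (hzi : z ∈ closure (interior H))
    (hψ : ContDiffWithinAt ℝ ∞ ψ H z) (hψH : ∀ᶠ z' in 𝓝[H] z, ψ z' ∈ H)
    (hA₁ : DifferentiableWithinAt ℝ A₁ H z) (hA₂ : DifferentiableWithinAt ℝ A₂ H (ψ z))
    (hsymm : ∀ a b, A₂ (ψ z) a b = A₂ (ψ z) b a)
    (hA : ∀ᶠ z' in 𝓝[H] z, ∀ a b,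
      A₁ z' a b = A₂ (ψ z') (fderivWithin ℝ ψ H z' a) (fderivWithin ℝ ψ H z' b)) (v b : E) :
    christoffelForm A₁ H z v b =
      christoffelForm A₂ H (ψ z) (fderivWithin ℝ ψ H z v) (fderivWithin ℝ ψ H z b) +
      A₂ (ψ z) (fderivWithin ℝ (fderivWithin ℝ ψ H) H z v v) (fderivWithin ℝ ψ H z b) := by
  have hQ : fderivWithin ℝ (fderivWithin ℝ ψ H) H z b v =
      fderivWithin ℝ (fderivWithin ℝ ψ H) H z v b :=
    (hψ.isSymmSndFDerivWithinAt (by simp; norm_cast) hH hzi hz).eq b v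
  rw [christoffelForm_apply, christoffelForm_apply,
    formDeriv_change hH hz hψ hψH hA₁ hA₂ hA, formDeriv_change hH hz hψ hψH hA₁ hA₂ hA, hQ,
    hsymm (fderivWithin ℝ (fderivWithin ℝ ψ H) H z v b)]
  ring

/-- Integral curves of the spray transform into integral curves under changes of coordinates. -/
theorem hasDerivWithinAt_spray_change (hH : UniqueDiffOn ℝ H) {x v : ℝ → E} {s : Set ℝ} {t : ℝ}
    (hz : x t ∈ H) (hzi : x t ∈ closure (interior H))
    (hψ : ContDiffWithinAt ℝ ∞ ψ H (x t)) (hψH : ∀ᶠ z' in 𝓝[H] (x t), ψ z' ∈ H)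
    (hA₁ : DifferentiableWithinAt ℝ A₁ H (x t)) (hA₂ : DifferentiableWithinAt ℝ A₂ H (ψ (x t)))
    (hinv₁ : (A₁ (x t)).IsInvertible) (hinv₂ : (A₂ (ψ (x t))).IsInvertible)
    (hsymm : ∀ a b, A₂ (ψ (x t)) a b = A₂ (ψ (x t)) b a)
    (hA : ∀ᶠ z' in 𝓝[H] (x t), ∀ a b,
      A₁ z' a b = A₂ (ψ z') (fderivWithin ℝ ψ H z' a) (fderivWithin ℝ ψ H z' b))
    (hsurj : Function.Surjective (fderivWithin ℝ ψ H (x t)))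
    (hxH : ∀ᶠ r in 𝓝[s] t, x r ∈ H)
    (h : HasDerivWithinAt (fun r => (x r, v r)) (spray A₁ H (x t, v t)) s t) :
    HasDerivWithinAt (fun r => (ψ (x r), fderivWithin ℝ ψ H (x r) (v r)))
      (spray A₂ H (ψ (x t), fderivWithin ℝ ψ H (x t) (v t))) s t := by
  have hx : HasDerivWithinAt x (v t) s t := h.fst
  have hv : HasDerivWithinAt v (spray A₁ H (x t, v t)).2 s t := h.snd
  have hψd : HasFDerivWithinAt ψ (fderivWithin ℝ ψ H (x t)) H (x t) :=
    (hψ.differentiableWithinAt (by simp)).hasFDerivWithinAt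
  have hP : HasFDerivWithinAt (fderivWithin ℝ ψ H)
      (fderivWithin ℝ (fderivWithin ℝ ψ H) H (x t)) H (x t) :=
    ((hψ.fderivWithin_right (m := 1) hH (by norm_cast) hz).differentiableWithinAt
      (by simp)).hasFDerivWithinAt
  have h1 : HasDerivWithinAt (fun r => ψ (x r)) (fderivWithin ℝ ψ H (x t) (v t)) s t :=
    hasDerivWithinAt_comp_of_eventually_mem hψd hx hxH
  have h2 : HasDerivWithinAt (fun r => fderivWithin ℝ ψ H (x r))
      (fderivWithin ℝ (fderivWithin ℝ ψ H) H (x t) (v t)) s t :=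
    hasDerivWithinAt_comp_of_eventually_mem hP hx hxH
  have h3 := h2.clm_apply hv
  have h4 := h1.prodMk h3
  convert h4 using 1
  refine Prod.ext rfl ?_
  -- The inhomogeneous term of the transformed Christoffel form is exactly what differentiating `Dψ`
  -- along the curve contributes. Surjectivity of `Dψ` lets every test vector be pulled back.
  refine Eq.symm ((eq_spray_snd_iff hinv₂).2 fun b' => ?_)
  obtain ⟨b, rfl⟩ := hsurj b'
  have h5 := (eq_spray_snd_iff (A := A₁) (H := H) (v := v t) hinv₁).1 rfl b
  rw [christoffelForm_change hH hz hzi hψ hψH hA₁ hA₂ hsymm hA,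
    hA.self_of_nhdsWithin hz] at h5
  rw [map_add, add_apply]
  linarith

end Spray

variable {n : ℕ} [NeZero n]
variable {M : Type*} [TopologicalSpace M] [ChartedSpace (EuclideanHalfSpace n) M]

/-! ### The half space -/

theorem mem_range_iff {z : Vec n} : z ∈ range (𝓡∂ n) ↔ 0 ≤ z 0 := by
  rw [range_modelWithCornersEuclideanHalfSpace]; rfl

theorem mem_interior_range_iff {z : Vec n} : z ∈ interior (range (𝓡∂ n)) ↔ 0 < z 0 := by
  rw [interior_range_modelWithCornersEuclideanHalfSpace]; rfl

theorem isManifold_one [IsManifold (𝓡∂ n) ∞ M] : IsManifold (𝓡∂ n) 1 M :=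
  IsManifold.of_le (m := 1) (n := ∞) (by exact_mod_cast le_top)

theorem extChartAt_apply_zero_nonneg (p q : M) : 0 ≤ extChartAt (𝓡∂ n) p q 0 := by
  rw [← mem_range_iff]
  exact mem_range_self _

theorem zero_nonneg_of_mem_target {p : M} {z : Vec n} (hz : z ∈ (extChartAt (𝓡∂ n) p).target) :
    0 ≤ z 0 :=
  mem_range_iff.1 (extChartAt_target_subset_range p hz)

theorem target_mem_nhdsWithin {p : M} {z : Vec n} (hz : z ∈ (extChartAt (𝓡∂ n) p).target) :
    (extChartAt (𝓡∂ n) p).target ∈ 𝓝[range (𝓡∂ n)] z :=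
  extChartAt_target_mem_nhdsWithin_of_mem hz

variable [IsManifold (𝓡∂ n) ∞ M]

/-- Any chart around the point decides, not only its preferred one; this lets one fixed chart follow
a geodesic for a while. -/
theorem mem_interior_iff_chart {p q : M} (hq : q ∈ (extChartAt (𝓡∂ n) p).source) :
    q ∈ (𝓡∂ n).interior M ↔ 0 < extChartAt (𝓡∂ n) p q 0 := by
  have := isManifold_one (n := n) (M := M)
  rw [extChartAt_source] at hq
  have h1 := (𝓡∂ n).isInteriorPoint_iff_of_mem_atlas (n := 1) one_ne_zero
    (chart_mem_atlas (EuclideanHalfSpace n) p) hq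
  have h2 : q ∈ (𝓡∂ n).interior M ↔ (𝓡∂ n).IsInteriorPoint q := Iff.rfl
  rw [h2, h1]
  constructor
  · intro h
    exact mem_interior_range_iff.1 (interior_mono (extChartAt_target_subset_range p) h)
  · intro h
    have hmem : extChartAt (𝓡∂ n) p q ∈ (extChartAt (𝓡∂ n) p).target :=
      (extChartAt (𝓡∂ n) p).map_source (by rwa [extChartAt_source])
    have hn : range (𝓡∂ n) ∈ 𝓝 (extChartAt (𝓡∂ n) p q) :=
      mem_interior_iff_mem_nhds.1 (mem_interior_range_iff.2 h)
    have h3 := target_mem_nhdsWithin hmem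
    rw [nhdsWithin_eq_nhds.2 hn] at h3
    exact mem_interior_iff_mem_nhds.2 h3

theorem mem_boundary_iff_chart {p q : M} (hq : q ∈ (extChartAt (𝓡∂ n) p).source) :
    q ∈ (𝓡∂ n).boundary M ↔ extChartAt (𝓡∂ n) p q 0 = 0 := by
  rw [← (𝓡∂ n).compl_interior, mem_compl_iff, mem_interior_iff_chart hq, not_lt]
  exact ⟨fun h => le_antisymm h (extChartAt_apply_zero_nonneg p q), fun h => h.le⟩

/-! ### Charts of the tangent bundle -/

/-- The chart of the tangent bundle over the preferred chart at `p`. -/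
def tchart (p : M) : PartialEquiv (TangentBundle (𝓡∂ n) M) (Vec n × Vec n) :=
  extChartAt (𝓡∂ n).tangent (⟨p, 0⟩ : TangentBundle (𝓡∂ n) M)

theorem tchart_apply (p : M) (ξ : TangentBundle (𝓡∂ n) M) :
    tchart p ξ = (extChartAt (𝓡∂ n) p ξ.proj,
      tangentCoordChange (𝓡∂ n) ξ.proj p ξ.proj ξ.2) := rfl

theorem mem_tchart_source {p : M} {ξ : TangentBundle (𝓡∂ n) M} :
    ξ ∈ (tchart p).source ↔ ξ.proj ∈ (extChartAt (𝓡∂ n) p).source := by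
  simp [tchart]

theorem mem_tchart_target {p : M} {ζ : Vec n × Vec n} :
    ζ ∈ (tchart p).target ↔ ζ.1 ∈ (extChartAt (𝓡∂ n) p).target := by
  constructor
  · intro h
    have h1 := mem_tchart_source.1 ((tchart p).map_target h)
    have h2 := (extChartAt (𝓡∂ n) p).map_source h1
    have h3 : extChartAt (𝓡∂ n) p ((tchart p).symm ζ).proj = ζ.1 :=
      congrArg Prod.fst ((tchart p).right_inv h)
    rwa [h3] at h2
  · intro h
    have hs := (extChartAt (𝓡∂ n) p).map_target h
    have h1 : (tchart p).symm ζ ∈ (tchart p).source := mem_tchart_source.2 hs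
    have h2 := (tchart p).map_source h1
    have h3 : tchart p ((tchart p).symm ζ) = ζ := by
      rw [tchart_apply]
      refine Prod.ext ((extChartAt (𝓡∂ n) p).right_inv h) ?_
      have := tangentCoordChange_comp (I := 𝓡∂ n) (w := p)
        (x := (extChartAt (𝓡∂ n) p).symm ζ.1) (y := p) (z := (extChartAt (𝓡∂ n) p).symm ζ.1)
        (v := ζ.2) ⟨⟨hs, mem_extChartAt_source _⟩, hs⟩
      exact this.trans (tangentCoordChange_self hs)
    rwa [h3] at h2

theorem continuousOn_tchart (p : M) : ContinuousOn (tchart (n := n) p) (tchart p).source :=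
  continuousOn_extChartAt _

theorem isOpen_tchart_source (p : M) : IsOpen (tchart (n := n) p).source :=
  isOpen_extChartAt_source _

theorem tchart_self (ξ : TangentBundle (𝓡∂ n) M) :
    tchart ξ.proj ξ = (extChartAt (𝓡∂ n) ξ.proj ξ.proj, ξ.2) := by
  rw [tchart_apply]
  exact Prod.ext rfl (tangentCoordChange_self (mem_extChartAt_source _))

theorem tchart_mk_self (p : M) (v : Vec n) :
    tchart p (⟨p, v⟩ : TangentBundle (𝓡∂ n) M) = (extChartAt (𝓡∂ n) p p, v) :=
  tchart_self (⟨p, v⟩ : TangentBundle (𝓡∂ n) M)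

/-! ### The metric in charts -/

/-- The metric in the preferred chart at `p`, as a continuous bilinear form. -/
def metricForm (g : LorentzMetric n M) (p : M) (z : Vec n) : Vec n →L[ℝ] Vec n →L[ℝ] ℝ :=
  let q : M := (extChartAt (𝓡∂ n) p).symm z
  ContinuousLinearMap.bilinearComp
    (show Vec n →L[ℝ] Vec n →L[ℝ] ℝ from g.inner q) (tangentCoordChange (𝓡∂ n) p q q)
    (tangentCoordChange (𝓡∂ n) p q q)

theorem metricForm_symm (g : LorentzMetric n M) (p : M) (z a b : Vec n) :
    metricForm g p z a b = metricForm g p z b a :=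
  g.symm _ _ _

/-- The metric computed in a chart. -/
theorem inner_eq_metricForm (g : LorentzMetric n M) {p q : M}
    (hq : q ∈ (extChartAt (𝓡∂ n) p).source) (v w : TangentSpace (𝓡∂ n) q) :
    g.inner q v w = metricForm g p (extChartAt (𝓡∂ n) p q)
      (tangentCoordChange (𝓡∂ n) q p q v) (tangentCoordChange (𝓡∂ n) q p q w) := by
  -- The point recovered from the coordinates of `q` equals `q` only by a proof, and the tangent
  -- spaces depend on it. Hence the statement for all `r = q`.
  have key : ∀ r : M, r = q → ∀ a b : Vec n,
      g.inner r (tangentCoordChange (𝓡∂ n) p r r (tangentCoordChange (𝓡∂ n) q p q a))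
        (tangentCoordChange (𝓡∂ n) p r r (tangentCoordChange (𝓡∂ n) q p q b)) =
      g.inner q (show TangentSpace (𝓡∂ n) q from a) (show TangentSpace (𝓡∂ n) q from b) := by
    rintro r rfl a b
    have h : ∀ c : Vec n, tangentCoordChange (𝓡∂ n) p r r (tangentCoordChange (𝓡∂ n) r p r c) = c :=
      fun c => (tangentCoordChange_comp ⟨⟨mem_extChartAt_source _, hq⟩,
        mem_extChartAt_source _⟩).trans (tangentCoordChange_self (mem_extChartAt_source _))
    rw [h a, h b]
  exact (key _ ((extChartAt (𝓡∂ n) p).left_inv hq) v w).symm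

theorem inner_eq_metricForm_self (g : LorentzMetric n M) (q : M) (v w : TangentSpace (𝓡∂ n) q) :
    g.inner q v w = metricForm g q (extChartAt (𝓡∂ n) q q) v w := by
  rw [inner_eq_metricForm g (mem_extChartAt_source q)]
  have h : ∀ c : Vec n, tangentCoordChange (𝓡∂ n) q q q c = c :=
    fun c => tangentCoordChange_self (mem_extChartAt_source _)
  exact congrArg₂ (fun a b => metricForm g q (extChartAt (𝓡∂ n) q q) a b) (h v) (h w)

theorem sq_eq_metricForm (g : LorentzMetric n M) {p : M} {ξ : TangentBundle (𝓡∂ n) M}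
    (hξ : ξ ∈ (tchart p).source) :
    g.sq ξ = metricForm g p (tchart p ξ).1 (tchart p ξ).2 (tchart p ξ).2 :=
  inner_eq_metricForm g (mem_tchart_source.1 hξ) _ _

/-- Vectors with constant coordinates form smooth sections over the chart, and the smooth metric
pairs smooth sections to smooth functions. -/
theorem contDiffOn_coordMetric (g : LorentzMetric n M) (p : M) (a b : Vec n) :
    ContDiffOn ℝ ∞ (fun z => metricForm g p z a b) (extChartAt (𝓡∂ n) p).target := by
  have hsec : ∀ a : Vec n, ContMDiffOn 𝓘(ℝ, Vec n) (𝓡∂ n).tangent ∞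
      (fun z => (tchart p).symm (z, a)) (extChartAt (𝓡∂ n) p).target := by
    intro a
    have h1 : ContMDiffOn 𝓘(ℝ, Vec n × Vec n) (𝓡∂ n).tangent ∞ (tchart p).symm
        (tchart p).target := contMDiffOn_extChartAt_symm _
    have h2 : ContMDiffOn 𝓘(ℝ, Vec n) 𝓘(ℝ, Vec n × Vec n) ∞ (fun z : Vec n => (z, a))
        (extChartAt (𝓡∂ n) p).target :=
      contMDiffOn_iff_contDiffOn.2 (contDiffOn_id.prodMk contDiffOn_const)
    exact h1.comp h2 fun z hz => mem_tchart_target.2 hz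
  have hb : ContMDiffOn 𝓘(ℝ, Vec n) (𝓡∂ n) ∞ (extChartAt (𝓡∂ n) p).symm
      (extChartAt (𝓡∂ n) p).target := contMDiffOn_extChartAt_symm _
  have : ContMDiffOn 𝓘(ℝ, Vec n) ((𝓡∂ n).prod 𝓘(ℝ, ℝ)) ∞
      (fun z ↦ TotalSpace.mk' ℝ (E := Bundle.Trivial M ℝ) ((extChartAt (𝓡∂ n) p).symm z)
        (g.inner ((extChartAt (𝓡∂ n) p).symm z) ((tchart p).symm (z, a)).2
          ((tchart p).symm (z, b)).2)) (extChartAt (𝓡∂ n) p).target := by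
    apply ContMDiffOn.clm_bundle_apply₂ (F₁ := Vec n) (F₂ := Vec n)
      (E₁ := fun x : M => TangentSpace (𝓡∂ n) x) (E₂ := fun x : M => TangentSpace (𝓡∂ n) x)
      (E₃ := Bundle.Trivial M ℝ)
    · exact g.contMDiff.comp_contMDiffOn hb
    · exact hsec a
    · exact hsec b
  rw [← contMDiffOn_iff_contDiffOn]
  intro z hz
  have h := this z hz
  simp only [contMDiffWithinAt_totalSpace] at h
  exact h.2

theorem contDiffOn_metricForm (g : LorentzMetric n M) (p : M) :
    ContDiffOn ℝ ∞ (metricForm g p) (extChartAt (𝓡∂ n) p).target :=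
  contDiffOn_clm_apply.2 fun a => contDiffOn_clm_apply.2 fun b => contDiffOn_coordMetric g p a b

theorem contDiffWithinAt_metricForm (g : LorentzMetric n M) {p : M} {z : Vec n}
    (hz : z ∈ (extChartAt (𝓡∂ n) p).target) :
    ContDiffWithinAt ℝ ∞ (metricForm g p) (range (𝓡∂ n)) z :=
  (contDiffOn_metricForm g p z hz).mono_of_mem_nhdsWithin (target_mem_nhdsWithin hz)

theorem differentiableWithinAt_metricForm (g : LorentzMetric n M) {p : M} {z : Vec n}
    (hz : z ∈ (extChartAt (𝓡∂ n) p).target) :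
    DifferentiableWithinAt ℝ (metricForm g p) (range (𝓡∂ n)) z :=
  (contDiffWithinAt_metricForm g hz).differentiableWithinAt (by simp)

theorem coordMetricDeriv_eq (g : LorentzMetric n M) {p : M} {z : Vec n}
    (hz : z ∈ (extChartAt (𝓡∂ n) p).target) (c a b : Vec n) :
    coordMetricDeriv g p z c a b = formDeriv (metricForm g p) (range (𝓡∂ n)) z c a b :=
  fderivWithin_form_apply ((𝓡∂ n).uniqueDiffOn z (extChartAt_target_subset_range p hz))
    (differentiableWithinAt_metricForm g hz) c a b

theorem formDeriv_metricForm_symm (g : LorentzMetric n M) {p : M} {z : Vec n}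
    (hz : z ∈ (extChartAt (𝓡∂ n) p).target) (c a b : Vec n) :
    formDeriv (metricForm g p) (range (𝓡∂ n)) z c a b =
      formDeriv (metricForm g p) (range (𝓡∂ n)) z c b a := by
  rw [← coordMetricDeriv_eq g hz, ← coordMetricDeriv_eq g hz]
  have : (fun z' => coordMetric g p z' a b) = fun z' => coordMetric g p z' b a :=
    funext fun z' => metricForm_symm g p z' a b
  unfold coordMetricDeriv
  rw [this]

theorem christoffel_eq (g : LorentzMetric n M) {p : M} {z : Vec n}
    (hz : z ∈ (extChartAt (𝓡∂ n) p).target) (v b : Vec n) :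
    christoffel g p z v v b = christoffelForm (metricForm g p) (range (𝓡∂ n)) z v b := by
  rw [christoffelForm_apply, christoffel, coordMetricDeriv_eq g hz, coordMetricDeriv_eq g hz]
  ring

/-- Lorentzian forms are non-degenerate. -/
theorem IsLorentzForm.eq_zero {V : Type*} [AddCommGroup V] {W : V → Prop} {B : V → V → ℝ}
    (h : IsLorentzForm W B) {v : V} (hv : W v) (h0 : ∀ w, W w → B v w = 0)
    (hsymm : ∀ v w, B v w = B w v) : v = 0 := by
  obtain ⟨u, hu, _, hpos⟩ := h
  by_contra hne
  have := hpos v hv hne (by rw [hsymm, h0 u hu])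
  rw [h0 v hv] at this
  exact lt_irrefl _ this

/-- Nondegeneracy makes the map into the dual space injective, and the dimensions agree. -/
theorem metricForm_isInvertible (g : LorentzMetric n M) {p : M} {z : Vec n}
    (hz : z ∈ (extChartAt (𝓡∂ n) p).target) : (metricForm g p z).IsInvertible := by
  set q := (extChartAt (𝓡∂ n) p).symm z
  have hq : q ∈ (extChartAt (𝓡∂ n) p).source := (extChartAt (𝓡∂ n) p).map_target hz
  have hqz : extChartAt (𝓡∂ n) p q = z := (extChartAt (𝓡∂ n) p).right_inv hz
  have hinj : Function.Injective (metricForm g p z) := by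
    rw [injective_iff_map_eq_zero]
    intro a ha
    have h1 : ∀ w : TangentSpace (𝓡∂ n) q, g.inner q
        (tangentCoordChange (𝓡∂ n) p q q a : Vec n) w = 0 := by
      intro w
      have hcomp : ∀ c : Vec n, tangentCoordChange (𝓡∂ n) q p q
          (tangentCoordChange (𝓡∂ n) p q q c) = c := fun c =>
        (tangentCoordChange_comp ⟨⟨hq, mem_extChartAt_source _⟩, hq⟩).trans
          (tangentCoordChange_self hq)
      refine (inner_eq_metricForm g hq _ w).trans ?_
      rw [hqz]
      refine (congrArg (fun c => metricForm g p z c (tangentCoordChange (𝓡∂ n) q p q w))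
        (hcomp a)).trans ?_
      simp only [ha]
      rfl
    have h2 := (g.lorentzian q).eq_zero trivial (fun w _ => h1 w) (g.symm q)
    have h3 : tangentCoordChange (𝓡∂ n) q p q (tangentCoordChange (𝓡∂ n) p q q a) = a :=
      (tangentCoordChange_comp ⟨⟨hq, mem_extChartAt_source _⟩, hq⟩).trans
          (tangentCoordChange_self hq)
    have h4 : (tangentCoordChange (𝓡∂ n) p q q a : Vec n) = 0 := h2
    rw [← h3, h4, map_zero]
  have hdim : Module.finrank ℝ (Vec n) = Module.finrank ℝ (Vec n →L[ℝ] ℝ) :=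
    ((InnerProductSpace.toDual ℝ (Vec n)).toLinearEquiv.finrank_eq)
  let e := LinearEquiv.ofInjectiveOfFinrankEq (metricForm g p z).toLinearMap hinj hdim
  exact ⟨e.toContinuousLinearEquiv, by ext; rfl⟩

/-! ### Geodesics in charts -/

/-- The geodesic vector field in the preferred chart at `p`. -/
def geodesicField (g : LorentzMetric n M) (p : M) : Vec n × Vec n → Vec n × Vec n :=
  spray (metricForm g p) (range (𝓡∂ n))

theorem contDiffOn_geodesicField (g : LorentzMetric n M) (p : M) :
    ContDiffOn ℝ 1 (geodesicField g p) ((extChartAt (𝓡∂ n) p).target ×ˢ univ) :=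
  contDiffOn_spray (extChartAt_target_subset_range p) (𝓡∂ n).uniqueDiffOn
    (fun _ hz => contDiffWithinAt_metricForm g hz) fun _ hz => metricForm_isInvertible g hz

theorem eq_geodesicField_snd_iff (g : LorentzMetric n M) {p : M} {z v a : Vec n}
    (hz : z ∈ (extChartAt (𝓡∂ n) p).target) :
    a = (geodesicField g p (z, v)).2 ↔
      ∀ b, coordMetric g p z a b + christoffel g p z v v b = 0 := by
  simp only [christoffel_eq g hz]
  exact eq_spray_snd_iff (metricForm_isInvertible g hz)

theorem fderivWithin_chart_change (p q r : M) :
    fderivWithin ℝ (extChartAt (𝓡∂ n) q ∘ (extChartAt (𝓡∂ n) p).symm) (range (𝓡∂ n))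
      (extChartAt (𝓡∂ n) p r) = tangentCoordChange (𝓡∂ n) p q r := rfl

theorem tchart_change {p q : M} {ξ : TangentBundle (𝓡∂ n) M} (hp : ξ ∈ (tchart p).source)
    (hq : ξ ∈ (tchart q).source) :
    tchart q ξ = ((extChartAt (𝓡∂ n) q ∘ (extChartAt (𝓡∂ n) p).symm) (tchart p ξ).1,
      fderivWithin ℝ (extChartAt (𝓡∂ n) q ∘ (extChartAt (𝓡∂ n) p).symm) (range (𝓡∂ n))
        (tchart p ξ).1 (tchart p ξ).2) := by
  rw [mem_tchart_source] at hp hq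
  refine Prod.ext ?_ ?_
  · change extChartAt (𝓡∂ n) q ξ.proj = extChartAt (𝓡∂ n) q
      ((extChartAt (𝓡∂ n) p).symm (extChartAt (𝓡∂ n) p ξ.proj))
    rw [(extChartAt (𝓡∂ n) p).left_inv hp]
  · exact (tangentCoordChange_comp ⟨⟨mem_extChartAt_source _, hp⟩, hq⟩).symm

theorem metricForm_change (g : LorentzMetric n M) {p q r : M}
    (hp : r ∈ (extChartAt (𝓡∂ n) p).source) (hq : r ∈ (extChartAt (𝓡∂ n) q).source) (a b : Vec n) :
    metricForm g p (extChartAt (𝓡∂ n) p r) a b = metricForm g q (extChartAt (𝓡∂ n) q r)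
      (tangentCoordChange (𝓡∂ n) p q r a) (tangentCoordChange (𝓡∂ n) p q r b) := by
  have h : ∀ (p : M) (hp : r ∈ (extChartAt (𝓡∂ n) p).source) (a b : Vec n),
      metricForm g p (extChartAt (𝓡∂ n) p r) a b = g.inner r
        (show TangentSpace (𝓡∂ n) r from tangentCoordChange (𝓡∂ n) p r r a)
        (show TangentSpace (𝓡∂ n) r from tangentCoordChange (𝓡∂ n) p r r b) := by
    intro p hp a b
    rw [inner_eq_metricForm g hp]
    have hc : ∀ c : Vec n, tangentCoordChange (𝓡∂ n) r p r
        (tangentCoordChange (𝓡∂ n) p r r c) = c := fun c =>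
      (tangentCoordChange_comp ⟨⟨hp, mem_extChartAt_source _⟩, hp⟩).trans
        (tangentCoordChange_self hp)
    exact (congrArg₂ (fun a b => metricForm g p (extChartAt (𝓡∂ n) p r) a b) (hc a) (hc b)).symm
  have hc : ∀ c : Vec n, tangentCoordChange (𝓡∂ n) q r r (tangentCoordChange (𝓡∂ n) p q r c) =
      tangentCoordChange (𝓡∂ n) p r r c := fun c =>
    tangentCoordChange_comp ⟨⟨hp, hq⟩, mem_extChartAt_source _⟩
  rw [h p hp, h q hq, hc a, hc b]

theorem mem_closure_interior_range {z : Vec n} (hz : z ∈ range (𝓡∂ n)) :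
    z ∈ closure (interior (range (𝓡∂ n))) :=
  (𝓡∂ n).range_subset_closure_interior hz

/-- The geodesic equation does not depend on the chart. -/
theorem hasDerivWithinAt_tchart_change (g : LorentzMetric n M) {p q : M}
    {β : ℝ → TangentBundle (𝓡∂ n) M} {s : Set ℝ} {t : ℝ}
    (hc : ContinuousWithinAt (fun r => (β r).proj) s t)
    (hp : β t ∈ (tchart p).source) (hq : β t ∈ (tchart q).source)
    (h : HasDerivWithinAt (fun r => tchart p (β r)) (geodesicField g p (tchart p (β t))) s t) :
    HasDerivWithinAt (fun r => tchart q (β r)) (geodesicField g q (tchart q (β t))) s t := by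
  have := isManifold_one (n := n) (M := M)
  rw [mem_tchart_source] at hp hq
  have hpq : ∀ᶠ r in 𝓝[s] t, β r ∈ (tchart p).source ∧ β r ∈ (tchart q).source := by
    simp only [mem_tchart_source]
    exact hc.eventually (Filter.inter_mem ((isOpen_extChartAt_source p).mem_nhds hp)
      ((isOpen_extChartAt_source q).mem_nhds hq))
  have hz : extChartAt (𝓡∂ n) p (β t).proj ∈ (extChartAt (𝓡∂ n) p).target :=
    (extChartAt (𝓡∂ n) p).map_source hp
  have hψz : (extChartAt (𝓡∂ n) q ∘ (extChartAt (𝓡∂ n) p).symm)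
      (extChartAt (𝓡∂ n) p (β t).proj) = extChartAt (𝓡∂ n) q (β t).proj := by
    rw [Function.comp_apply, (extChartAt (𝓡∂ n) p).left_inv hp]
  have hz' : extChartAt (𝓡∂ n) q (β t).proj ∈ (extChartAt (𝓡∂ n) q).target :=
    (extChartAt (𝓡∂ n) q).map_source hq
  have hnear : ∀ᶠ z in 𝓝[range (𝓡∂ n)] (extChartAt (𝓡∂ n) p (β t).proj),
      z ∈ (extChartAt (𝓡∂ n) p).target ∧
        (extChartAt (𝓡∂ n) p).symm z ∈ (extChartAt (𝓡∂ n) q).source := by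
    refine Filter.Eventually.and (target_mem_nhdsWithin hz) ?_
    have hcs : ContinuousAt (extChartAt (𝓡∂ n) p).symm (extChartAt (𝓡∂ n) p (β t).proj) :=
      continuousAt_extChartAt_symm' hp
    refine mem_nhdsWithin_of_mem_nhds (hcs ?_)
    rw [(extChartAt (𝓡∂ n) p).left_inv hp]
    exact (isOpen_extChartAt_source q).mem_nhds hq
  have hsmooth : ContDiffWithinAt ℝ ∞ (extChartAt (𝓡∂ n) q ∘ (extChartAt (𝓡∂ n) p).symm)
      (range (𝓡∂ n)) (extChartAt (𝓡∂ n) p (β t).proj) := by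
    apply contDiffWithinAt_ext_coord_change
    rw [PartialEquiv.trans_source'', PartialEquiv.symm_symm, PartialEquiv.symm_target]
    exact mem_image_of_mem _ ⟨hp, hq⟩
  have key := hasDerivWithinAt_spray_change (A₁ := metricForm g p) (A₂ := metricForm g q)
    (ψ := extChartAt (𝓡∂ n) q ∘ (extChartAt (𝓡∂ n) p).symm) (𝓡∂ n).uniqueDiffOn
    (x := fun r => (tchart p (β r)).1) (v := fun r => (tchart p (β r)).2) (s := s) (t := t)
    (mem_range_self _) (mem_closure_interior_range (mem_range_self _)) hsmooth
    (Filter.Eventually.of_forall fun z => mem_range_self _)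
    (differentiableWithinAt_metricForm g hz)
    (by
      have := differentiableWithinAt_metricForm g hz'
      rwa [← hψz] at this)
    (metricForm_isInvertible g hz)
    (by
      have := metricForm_isInvertible g hz'
      rwa [← hψz] at this)
    (fun a b => metricForm_symm g q _ a b)
    (by
      filter_upwards [hnear] with z hz a b
      have hr := (extChartAt (𝓡∂ n) p).map_target hz.1
      have h1 := metricForm_change g hr hz.2 a b
      have h2 := fderivWithin_chart_change (n := n) p q ((extChartAt (𝓡∂ n) p).symm z)
      rw [(extChartAt (𝓡∂ n) p).right_inv hz.1] at h1 h2
      rw [h2]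
      exact h1)
    (by
      intro a
      refine ⟨tangentCoordChange (𝓡∂ n) q p (β t).proj a, ?_⟩
      exact (tangentCoordChange_comp ⟨⟨hq, hp⟩, hq⟩).trans (tangentCoordChange_self hq))
    (Filter.Eventually.of_forall fun r => mem_range_self _) h
  have h2 := tchart_change (mem_tchart_source.2 hp) (mem_tchart_source.2 hq)
  have h3 := key.congr_of_eventuallyEq (f₁ := fun r => tchart q (β r))
    (hpq.mono fun r hr => tchart_change hr.1 hr.2) h2
  rw [← h2] at h3
  exact h3

/-- Geodesics are the integral curves of the geodesic vector field in arbitrary charts. -/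
theorem isGeodesicOn_iff (g : LorentzMetric n M) {β : ℝ → TangentBundle (𝓡∂ n) M} {s : Set ℝ} :
    IsGeodesicOn g β s ↔ ContinuousOn (fun t => (β t).proj) s ∧ ∀ t ∈ s, ∃ p,
      β t ∈ (tchart p).source ∧
      HasDerivWithinAt (fun r => tchart p (β r)) (geodesicField g p (tchart p (β t))) s t := by
  have hself : ∀ t, β t ∈ (tchart (β t).proj).source := fun t =>
    mem_tchart_source.2 (mem_extChartAt_source _)
  constructor
  · intro h
    refine ⟨h.continuousOn, fun t ht => ⟨(β t).proj, hself t, ?_⟩⟩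
    have hz := mem_extChartAt_target (I := 𝓡∂ n) (β t).proj
    obtain ⟨a, ha, hab⟩ := h.acceleration t ht
    have hF : geodesicField g (β t).proj (tchart (β t).proj (β t)) = ((β t).2, a) := by
      rw [tchart_self]
      exact Prod.ext rfl ((eq_geodesicField_snd_iff g hz).2 hab).symm
    rw [hF]
    exact (h.velocity t ht).prodMk ha
  · rintro ⟨hc, hd⟩
    have hd' : ∀ t ∈ s, HasDerivWithinAt (fun r => tchart (β t).proj (β r))
        (geodesicField g (β t).proj (tchart (β t).proj (β t))) s t := by
      intro t ht
      obtain ⟨p, hp, h⟩ := hd t ht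
      exact hasDerivWithinAt_tchart_change g (hc t ht) hp (hself t) h
    refine ⟨hc, fun t ht => ?_, fun t ht => ?_⟩
    · have := (hd' t ht).fst
      rw [tchart_self] at this
      exact this
    · refine ⟨_, (hd' t ht).snd, fun b => ?_⟩
      have hz := mem_extChartAt_target (I := 𝓡∂ n) (β t).proj
      rw [tchart_self]
      exact (eq_geodesicField_snd_iff g hz).1 rfl b

theorem IsGeodesicOn.hasDerivWithinAt {g : LorentzMetric n M} {β : ℝ → TangentBundle (𝓡∂ n) M}
    {s : Set ℝ} (h : IsGeodesicOn g β s) {t : ℝ} (ht : t ∈ s) {p : M}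
    (hp : β t ∈ (tchart p).source) :
    HasDerivWithinAt (fun r => tchart p (β r)) (geodesicField g p (tchart p (β t))) s t := by
  obtain ⟨hc, hd⟩ := (isGeodesicOn_iff g).1 h
  obtain ⟨q, hq, hderiv⟩ := hd t ht
  exact hasDerivWithinAt_tchart_change g (hc t ht) hq hp hderiv

/-! ### Extending the geodesic vector field across the boundary -/

/-- The retraction of `ℝⁿ` onto the half space. -/
def halfRetract (z : Vec n) : Vec n := z + max (-z 0) 0 • EuclideanSpace.single 0 1

theorem halfRetract_zero (z : Vec n) : halfRetract z 0 = max (z 0) 0 := by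
  simp only [halfRetract, PiLp.add_apply, PiLp.smul_apply, PiLp.single_apply, if_true,
    smul_eq_mul, mul_one]
  rcases le_total (z 0) 0 with h | h
  · rw [max_eq_left (by linarith), max_eq_right h]; ring
  · rw [max_eq_right (by linarith), max_eq_left h]; ring

theorem halfRetract_of_nonneg {z : Vec n} (hz : 0 ≤ z 0) : halfRetract z = z := by
  rw [halfRetract, max_eq_right (by linarith), zero_smul, add_zero]

theorem halfRetract_mem_range (z : Vec n) : halfRetract z ∈ range (𝓡∂ n) := by
  rw [mem_range_iff, halfRetract_zero]
  exact le_max_right _ _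

theorem abs_apply_zero_le_norm (z : Vec n) : |z 0| ≤ ‖z‖ :=
  PiLp.norm_apply_le z 0

theorem lipschitzWith_halfRetract : LipschitzWith 2 (halfRetract (n := n)) := by
  refine LipschitzWith.of_dist_le_mul fun z w => ?_
  rw [dist_eq_norm, dist_eq_norm]
  have h1 : halfRetract z - halfRetract w =
      (z - w) + (max (-z 0) 0 - max (-w 0) 0) • EuclideanSpace.single 0 (1 : ℝ) := by
    simp only [halfRetract, sub_smul]; abel
  have h2 : |max (-z 0) 0 - max (-w 0) 0| ≤ ‖z - w‖ := by
    refine (abs_max_sub_max_le_abs _ _ _).trans ?_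
    have := abs_apply_zero_le_norm (z - w)
    rw [PiLp.sub_apply] at this
    rwa [neg_sub_neg, abs_sub_comm]
  rw [h1]
  refine (norm_add_le _ _).trans ?_
  rw [norm_smul, PiLp.norm_single, norm_one, mul_one, Real.norm_eq_abs]
  push_cast
  linarith

/-- The vector `-v` at the foot point of `v`. -/
def tneg (ξ : TangentBundle (𝓡∂ n) M) : TangentBundle (𝓡∂ n) M := ⟨ξ.proj, -ξ.2⟩

theorem tneg_tneg (ξ : TangentBundle (𝓡∂ n) M) : tneg (tneg ξ) = ξ := by
  obtain ⟨x, v⟩ := ξ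
  exact congrArg (TotalSpace.mk x) (neg_neg v)

/-- The geodesic vector field in the chart at `p`, extended across the boundary as a locally
Lipschitz vector field. -/
def extField (g : LorentzMetric n M) (p : M) (ζ : Vec n × Vec n) : Vec n × Vec n :=
  geodesicField g p (halfRetract ζ.1, ζ.2)

theorem extField_of_nonneg (g : LorentzMetric n M) (p : M) {ζ : Vec n × Vec n} (h : 0 ≤ ζ.1 0) :
    extField g p ζ = geodesicField g p ζ := by
  rw [extField, halfRetract_of_nonneg h]

theorem target_prod_mem_nhdsWithin {p : M} {ζ : Vec n × Vec n} (hζ : ζ ∈ (tchart p).target) :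
    (extChartAt (𝓡∂ n) p).target ×ˢ (univ : Set (Vec n)) ∈ 𝓝[range (𝓡∂ n) ×ˢ univ] ζ := by
  have := nhdsWithin_prod (target_mem_nhdsWithin (mem_tchart_target.1 hζ))
    (Filter.univ_mem (f := 𝓝[univ] ζ.2))
  exact this

theorem contDiffWithinAt_geodesicField (g : LorentzMetric n M) {p : M} {ζ : Vec n × Vec n}
    (hζ : ζ ∈ (tchart p).target) :
    ContDiffWithinAt ℝ 1 (geodesicField g p) (range (𝓡∂ n) ×ˢ univ) ζ :=
  (contDiffOn_geodesicField g p ζ ⟨mem_tchart_target.1 hζ, trivial⟩).mono_of_mem_nhdsWithin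
    (target_prod_mem_nhdsWithin hζ)

/-- The retraction is Lipschitz, fixes `ζ`, and maps into the half space, on which the `C¹` geodesic
field is Lipschitz near `ζ`. -/
theorem exists_lipschitzOnWith_extField (g : LorentzMetric n M) {p : M} {ζ : Vec n × Vec n}
    (hζ : ζ ∈ (tchart p).target) : ∃ K, ∃ t ∈ 𝓝 ζ, LipschitzOnWith K (extField g p) t := by
  obtain ⟨K, t, ht, hK⟩ := (contDiffWithinAt_geodesicField g hζ).exists_lipschitzOnWith
    ((𝓡∂ n).convex_range.prod convex_univ)
  have hl : LipschitzWith (max (2 * 1) 1)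
      (fun ζ : Vec n × Vec n => (halfRetract ζ.1, ζ.2)) :=
    (lipschitzWith_halfRetract.comp LipschitzWith.prod_fst).prodMk LipschitzWith.prod_snd
  have h0 : (fun ζ : Vec n × Vec n => (halfRetract ζ.1, ζ.2)) ζ = ζ := by
    have := zero_nonneg_of_mem_target (mem_tchart_target.1 hζ)
    simp only [halfRetract_of_nonneg this]
  have hc : Filter.Tendsto (fun ζ : Vec n × Vec n => (halfRetract ζ.1, ζ.2)) (𝓝 ζ)
      (𝓝[range (𝓡∂ n) ×ˢ univ] ζ) := by
    refine tendsto_nhdsWithin_iff.2 ⟨?_, Filter.Eventually.of_forall fun ζ =>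
      ⟨halfRetract_mem_range _, trivial⟩⟩
    have := hl.continuous.tendsto ζ
    have h0' : (halfRetract ζ.1, ζ.2) = ζ := h0
    rwa [h0'] at this
  exact ⟨_, _, hc ht, hK.comp hl.lipschitzOnWith fun ζ hζ => hζ⟩

/-! ### Basic operations on geodesics -/

theorem IsGeodesicOn.mono {g : LorentzMetric n M} {β : ℝ → TangentBundle (𝓡∂ n) M}
    {s s' : Set ℝ} (h : IsGeodesicOn g β s) (hs : s' ⊆ s) : IsGeodesicOn g β s' := by
  rw [isGeodesicOn_iff] at h ⊢
  refine ⟨h.1.mono hs, fun t ht => ?_⟩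
  obtain ⟨p, hp, hd⟩ := h.2 t (hs ht)
  exact ⟨p, hp, hd.mono hs⟩

theorem isGeodesicOn_congr {g : LorentzMetric n M} {β γ : ℝ → TangentBundle (𝓡∂ n) M}
    {s : Set ℝ} (h : IsGeodesicOn g β s) (hs : EqOn γ β s) : IsGeodesicOn g γ s := by
  rw [isGeodesicOn_iff] at h ⊢
  refine ⟨h.1.congr fun t ht => congrArg _ (hs ht), fun t ht => ?_⟩
  obtain ⟨p, hp, hd⟩ := h.2 t ht
  rw [hs ht]
  exact ⟨p, hp, hd.congr (fun r hr => congrArg _ (hs hr)) (congrArg _ (hs ht))⟩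

theorem self_mem_tchart_source (ξ : TangentBundle (𝓡∂ n) M) : ξ ∈ (tchart ξ.proj).source :=
  mem_tchart_source.2 (mem_extChartAt_source _)

theorem continuousAt_tchart_symm {p : M} {ξ : TangentBundle (𝓡∂ n) M}
    (hξ : ξ ∈ (tchart p).source) : ContinuousAt (tchart p).symm (tchart p ξ) :=
  continuousAt_extChartAt_symm'' ((tchart p).map_source hξ)

theorem IsGeodesicOn.eventually_mem_source {g : LorentzMetric n M}
    {β : ℝ → TangentBundle (𝓡∂ n) M} {s : Set ℝ} (h : IsGeodesicOn g β s) {t : ℝ} (ht : t ∈ s)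
    {p : M} (hp : β t ∈ (tchart p).source) : ∀ᶠ r in 𝓝[s] t, β r ∈ (tchart p).source := by
  simp only [mem_tchart_source] at hp ⊢
  exact (h.continuousOn t ht).eventually ((isOpen_extChartAt_source p).mem_nhds hp)

/-- Solutions in a chart are geodesics. -/
theorem isGeodesicOn_tchart_symm {g : LorentzMetric n M} {p : M} {φ : ℝ → Vec n × Vec n}
    {s : Set ℝ} (hφ : ∀ t ∈ s, HasDerivWithinAt φ (extField g p (φ t)) s t)
    (hT : ∀ t ∈ s, φ t ∈ (tchart p).target) :
    IsGeodesicOn g (fun t => (tchart p).symm (φ t)) s := by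
  rw [isGeodesicOn_iff]
  refine ⟨fun t ht => ?_, fun t ht => ⟨p, (tchart p).map_target (hT t ht), ?_⟩⟩
  · have h1 : ContinuousAt (extChartAt (𝓡∂ n) p).symm (φ t).1 :=
      continuousAt_extChartAt_symm'' (mem_tchart_target.1 (hT t ht))
    exact h1.tendsto.comp (hφ t ht).continuousWithinAt.fst.tendsto
  · have h1 := hφ t ht
    rw [extField_of_nonneg g p
      (zero_nonneg_of_mem_target (mem_tchart_target.1 (hT t ht)))] at h1
    rw [(tchart p).right_inv (hT t ht)]
    exact h1.congr (fun r hr => (tchart p).right_inv (hT r hr)) ((tchart p).right_inv (hT t ht))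

theorem IsGeodesicOn.hasDerivWithinAt_extField {g : LorentzMetric n M}
    {β : ℝ → TangentBundle (𝓡∂ n) M} {s : Set ℝ} (h : IsGeodesicOn g β s) {t : ℝ} (ht : t ∈ s)
    {p : M} (hp : β t ∈ (tchart p).source) :
    HasDerivWithinAt (fun r => tchart p (β r)) (extField g p (tchart p (β t))) s t := by
  rw [extField_of_nonneg g p (extChartAt_apply_zero_nonneg p (β t).proj)]
  exact h.hasDerivWithinAt ht hp

theorem tchart_tneg (p : M) (ξ : TangentBundle (𝓡∂ n) M) :
    tchart p (tneg ξ) = ((tchart p ξ).1, -(tchart p ξ).2) :=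
  Prod.ext rfl (map_neg (tangentCoordChange (𝓡∂ n) ξ.proj p ξ.proj) ξ.2)

theorem geodesicField_neg (g : LorentzMetric n M) (p : M) (z v : Vec n) :
    geodesicField g p (z, -v) = (-v, (geodesicField g p (z, v)).2) :=
  spray_neg _ _ _ _

/-- Geodesics run backwards are geodesics. -/
theorem IsGeodesicOn.reverse {g : LorentzMetric n M} {β : ℝ → TangentBundle (𝓡∂ n) M}
    {s : Set ℝ} (h : IsGeodesicOn g β s) (c : ℝ) :
    IsGeodesicOn g (fun t => tneg (β (c - t))) ((fun t => c - t) ⁻¹' s) := by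
  rw [isGeodesicOn_iff] at h ⊢
  have hcont : Continuous fun t : ℝ => c - t := by fun_prop
  refine ⟨h.1.comp hcont.continuousOn fun t ht => ht, fun t ht => ?_⟩
  obtain ⟨p, hp, hd⟩ := h.2 (c - t) ht
  refine ⟨p, mem_tchart_source.2 (mem_tchart_source.1 hp), ?_⟩
  have h1 : HasDerivWithinAt (fun t : ℝ => c - t) (-1) ((fun t => c - t) ⁻¹' s) t :=
    ((hasDerivAt_id t).const_sub c).hasDerivWithinAt
  have h2 := hd.scomp t h1 fun r hr => hr
  rw [neg_one_smul] at h2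
  have h5 : HasDerivWithinAt (fun r => (tchart p (β (c - r))).1)
      (-(geodesicField g p (tchart p (β (c - t)))).1) ((fun t => c - t) ⁻¹' s) t := h2.fst
  have h6 : HasDerivWithinAt (fun r => (tchart p (β (c - r))).2)
      (-(geodesicField g p (tchart p (β (c - t)))).2) ((fun t => c - t) ⁻¹' s) t := h2.snd
  have h3 := h5.prodMk h6.neg
  -- Reversing time changes the sign of the first derivative of the position and preserves the
  -- second.
  have h4 : geodesicField g p (tchart p (tneg (β (c - t)))) =
      (-(geodesicField g p (tchart p (β (c - t)))).1,
        - -(geodesicField g p (tchart p (β (c - t)))).2) := by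
    rw [tchart_tneg, geodesicField_neg, neg_neg]
    rfl
  simp only [h4]
  simp only [tchart_tneg]
  exact h3

/-- Translation of the time parameter. -/
theorem IsGeodesicOn.shift {g : LorentzMetric n M} {β : ℝ → TangentBundle (𝓡∂ n) M}
    {s : Set ℝ} (h : IsGeodesicOn g β s) (c : ℝ) :
    IsGeodesicOn g (fun t => β (t + c)) ((fun t => t + c) ⁻¹' s) := by
  rw [isGeodesicOn_iff] at h ⊢
  have hcont : Continuous fun t : ℝ => t + c := by fun_prop
  refine ⟨h.1.comp hcont.continuousOn fun t ht => ht, fun t ht => ?_⟩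
  obtain ⟨p, hp, hd⟩ := h.2 (t + c) ht
  refine ⟨p, hp, ?_⟩
  have h1 : HasDerivWithinAt (fun t : ℝ => t + c) 1 ((fun t => t + c) ⁻¹' s) t :=
    ((hasDerivAt_id t).add_const c).hasDerivWithinAt
  have h2 := hd.scomp t h1 fun r hr => hr
  rwa [one_smul] at h2

/-- Concatenation of geodesics. -/
theorem IsGeodesicOn.concat {g : LorentzMetric n M} {β γ : ℝ → TangentBundle (𝓡∂ n) M}
    {a b c : ℝ} (hab : a ≤ b) (hbc : b ≤ c) (hβ : IsGeodesicOn g β (Icc a b))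
    (hγ : IsGeodesicOn g γ (Icc b c)) (h : β b = γ b) :
    IsGeodesicOn g (fun t => if t ≤ b then β t else γ t) (Icc a c) := by
  set δ : ℝ → TangentBundle (𝓡∂ n) M := fun t => if t ≤ b then β t else γ t with hδ
  have h1 : EqOn δ β (Icc a b) := fun t ht => if_pos ht.2
  have h2 : EqOn δ γ (Icc b c) := fun t ht => by
    rcases ht.1.eq_or_lt with rfl | hlt
    · simp only [hδ, le_refl, if_true, h]
    · simp only [hδ, not_le.2 hlt, if_false]
  have hβ' := isGeodesicOn_congr hβ h1
  have hγ' := isGeodesicOn_congr hγ h2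
  rw [← Icc_union_Icc_eq_Icc hab hbc, isGeodesicOn_iff]
  refine ⟨hβ'.continuousOn.union_of_isClosed hγ'.continuousOn isClosed_Icc isClosed_Icc,
    fun t ht => ⟨(δ t).proj, self_mem_tchart_source _, ?_⟩⟩
  -- Away from the junction, one of the two derivatives is taken within a set that stays away from
  -- `t`, and is vacuous.
  refine HasDerivWithinAt.union ?_ ?_
  · by_cases htI : t ∈ Icc a b
    · exact hβ'.hasDerivWithinAt htI (self_mem_tchart_source _)
    · exact HasFDerivWithinAt.of_notMem_closure (by rwa [isClosed_Icc.closure_eq])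
  · by_cases htI : t ∈ Icc b c
    · exact hγ'.hasDerivWithinAt htI (self_mem_tchart_source _)
    · exact HasFDerivWithinAt.of_notMem_closure (by rwa [isClosed_Icc.closure_eq])

/-! ### Uniqueness -/

/-- A geodesic cannot leave the region covered by a chart where a solution of the extended
equation with the same initial value exists, and agrees with this solution. -/
theorem IsGeodesicOn.eq_of_extField [T2Space M] {g : LorentzMetric n M}
    {θ : ℝ → TangentBundle (𝓡∂ n) M} {a b : ℝ} (hθ : IsGeodesicOn g θ (Icc a b))
    {p : M} {φ : ℝ → Vec n × Vec n}
    (hφ : ∀ t ∈ Icc a b, HasDerivWithinAt φ (extField g p (φ t)) (Icc a b) t)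
    (hφT : ∀ t ∈ Icc a b, 0 ≤ (φ t).1 0 → φ t ∈ (tchart p).target)
    (ha : θ a ∈ (tchart p).source) (ha' : tchart p (θ a) = φ a) :
    ∀ t ∈ Icc a b, θ t ∈ (tchart p).source ∧ tchart p (θ t) = φ t := by
  have hφc : ContinuousOn φ (Icc a b) := HasDerivWithinAt.continuousOn hφ
  have key : ∀ c ∈ Icc a b, (θ a ∈ (tchart p).source ∧ tchart p (θ a) = φ a) →
      (θ c ∈ (tchart p).source ∧ tchart p (θ c) = φ c) := by
    intro c hc
    have hsub : Icc a c ⊆ Icc a b := Icc_subset_Icc_right hc.2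
    refine rel_of_locally_rel (P := fun r s => (θ r ∈ (tchart p).source ∧ tchart p (θ r) = φ r) →
      (θ s ∈ (tchart p).source ∧ tchart p (θ s) = φ s)) hc.1 (fun _ _ h => h)
      (fun _ _ _ _ _ _ _ _ h1 h2 h => h2 (h1 h)) fun t ht => ?_
    have ht' := hsub ht
    -- Agreement persists near a time where it holds, by uniqueness for Lipschitz fields. Near a
    -- time where it fails it fails throughout, because agreement passes to limits. In both cases
    -- the implication is local.
    by_cases hQ : θ t ∈ (tchart p).source ∧ tchart p (θ t) = φ t
    · obtain ⟨K, U, hU, hK⟩ := exists_lipschitzOnWith_extField g ((tchart p).map_source hQ.1)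
      have hd := hθ.hasDerivWithinAt ht' hQ.1
      have h1 : ∀ᶠ r in 𝓝[Icc a b] t, tchart p (θ r) ∈ U := hd.continuousWithinAt hU
      have h2 : ∀ᶠ r in 𝓝[Icc a b] t, φ r ∈ U := by
        rw [hQ.2] at hU
        exact hφc t ht' hU
      have h3 := hθ.eventually_mem_source ht' hQ.1
      obtain ⟨δ, hδ, hall⟩ := Metric.mem_nhdsWithin_iff.1 (h1.and (h2.and h3))
      refine ⟨δ, hδ, fun r hr s hs hrs hrt hst hQr => ?_⟩
      have hin : ∀ x ∈ Icc r s, x ∈ Icc a b ∧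
          (tchart p (θ x) ∈ U ∧ φ x ∈ U ∧ θ x ∈ (tchart p).source) := by
        intro x hx
        have hxI : x ∈ Icc a b := hsub ⟨hr.1.trans hx.1, hx.2.trans hs.2⟩
        refine ⟨hxI, hall ⟨?_, hxI⟩⟩
        rw [Metric.mem_ball, Real.dist_eq, abs_lt]
        rw [abs_lt] at hrt hst
        constructor <;> linarith [hx.1, hx.2]
      have hsub' : Icc r s ⊆ Icc a b := fun x hx => (hin x hx).1
      have heq := ODE_solution_unique_of_mem_Icc_right (v := fun _ => extField g p)
        (s := fun _ => U) (f := fun x => tchart p (θ x)) (g := φ) (a := r) (b := s)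
        (fun _ _ => hK)
        (fun x hx => ((hθ.hasDerivWithinAt (hsub' hx) (hin x hx).2.2.2).continuousWithinAt).mono
          hsub')
        (fun x hx => hasDerivWithinAt_Ici_of_Icc ((hθ.hasDerivWithinAt_extField
          (hsub' (Ico_subset_Icc_self hx)) (hin x (Ico_subset_Icc_self hx)).2.2.2).mono hsub') hx)
        (fun x hx => (hin x (Ico_subset_Icc_self hx)).2.1)
        (hφc.mono hsub')
        (fun x hx => hasDerivWithinAt_Ici_of_Icc
          ((hφ x (hsub' (Ico_subset_Icc_self hx))).mono hsub') hx)
        (fun x hx => (hin x (Ico_subset_Icc_self hx)).2.2.1) hQr.2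
      have hsI : s ∈ Icc r s := ⟨hrs, le_rfl⟩
      exact ⟨(hin s hsI).2.2.2, heq hsI⟩
    · have hev : ∀ᶠ r in 𝓝[Icc a b] t, ¬ (θ r ∈ (tchart p).source ∧ tchart p (θ r) = φ r) := by
        by_contra hcon
        have hfreq : ∃ᶠ r in 𝓝[Icc a b] t, θ r ∈ (tchart p).source ∧ tchart p (θ r) = φ r := hcon
        have hφt : Filter.Tendsto φ (𝓝[Icc a b] t) (𝓝 (φ t)) := hφc t ht'
        -- The times of agreement accumulate at `t`, and there `φ` lies in the closed half space;
        -- hence so does `φ t`, and `hφT` puts it into the chart target.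
        have hnonneg : 0 ≤ (φ t).1 0 := by
          by_contra hneg
          have hc0 : Continuous fun ζ : Vec n × Vec n => ζ.1 0 := by fun_prop
          have : ∀ᶠ r in 𝓝[Icc a b] t, (φ r).1 0 < 0 :=
            ((hc0.tendsto _).comp hφt).eventually_lt_const (not_le.1 hneg)
          obtain ⟨r, hr1, hr2⟩ := (hfreq.and_eventually this).exists
          rw [← hr1.2] at hr2
          exact absurd (extChartAt_apply_zero_nonneg p (θ r).proj) (not_le.2 hr2)
        have hT := hφT t ht' hnonneg
        -- Limits in the Hausdorff space `M` are unique, so `θ t` lies over a point of the chart and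
        -- cannot have escaped from it.
        have hproj : (θ t).proj = (extChartAt (𝓡∂ n) p).symm (φ t).1 := by
          have hc1 : Filter.Tendsto (fun r => (extChartAt (𝓡∂ n) p).symm (φ r).1) (𝓝[Icc a b] t)
              (𝓝 ((extChartAt (𝓡∂ n) p).symm (φ t).1)) :=
            (continuousAt_extChartAt_symm'' (mem_tchart_target.1 hT)).tendsto.comp
              ((continuous_fst.tendsto _).comp hφt)
          refine tendsto_nhds_unique_of_frequently_eq (hθ.continuousOn t ht') hc1
            (hfreq.mono fun r hr => ?_)
          rw [← hr.2]
          exact ((extChartAt (𝓡∂ n) p).left_inv (mem_tchart_source.1 hr.1)).symm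
        have hsrc : θ t ∈ (tchart p).source := by
          rw [mem_tchart_source, hproj]
          exact (extChartAt (𝓡∂ n) p).map_target (mem_tchart_target.1 hT)
        refine hQ ⟨hsrc, ?_⟩
        exact tendsto_nhds_unique_of_frequently_eq
          (hθ.hasDerivWithinAt ht' hsrc).continuousWithinAt hφt (hfreq.mono fun r hr => hr.2)
      obtain ⟨δ, hδ, hall⟩ := Metric.mem_nhdsWithin_iff.1 hev
      refine ⟨δ, hδ, fun r hr s _ _ hrt _ hQr => absurd hQr ?_⟩
      exact hall ⟨by rwa [Metric.mem_ball, Real.dist_eq], hsub hr⟩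
  exact fun c hc => key c hc ⟨ha, ha'⟩

open Metric

/-! ### Flow boxes -/

/-- The local flow of the extended geodesic vector field around `ζ₀`. -/
structure FlowBox (g : LorentzMetric n M) (p : M) (ζ₀ : Vec n × Vec n) where
  /-- The radius of the ball that contains the trajectories. -/
  a : ℝ
  /-- The radius of the ball of initial values. -/
  r : ℝ
  /-- The time for which the flow exists. -/
  ε : ℝ
  a_pos : 0 < a
  r_pos : 0 < r
  ε_pos : 0 < ε
  /-- The flow. -/
  flow : Vec n × Vec n → ℝ → Vec n × Vec n
  target : ∀ ζ ∈ closedBall ζ₀ a, 0 ≤ ζ.1 0 → ζ ∈ (tchart p).target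
  flow_zero : ∀ ζ ∈ closedBall ζ₀ r, flow ζ 0 = ζ
  hasDerivWithinAt : ∀ ζ ∈ closedBall ζ₀ r, ∀ t ∈ Icc (-ε) ε,
    HasDerivWithinAt (flow ζ) (extField g p (flow ζ t)) (Icc (-ε) ε) t
  mem : ∀ ζ ∈ closedBall ζ₀ r, ∀ t ∈ Icc (-ε) ε, flow ζ t ∈ closedBall ζ₀ a
  continuousOn : ContinuousOn (fun x : (Vec n × Vec n) × ℝ => flow x.1 x.2)
    (closedBall ζ₀ r ×ˢ Icc (-ε) ε)
  /-- The Lipschitz constant of the vector field. -/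
  K : NNReal
  lipschitz : LipschitzOnWith K (extField g p) (closedBall ζ₀ a)

/-- The ball is small enough for the extended field to be Lipschitz on it and for its half space
points to lie in the chart target. The set `N` admits further constraints, such as a sign of the
normal velocity. -/
theorem exists_flowBox (g : LorentzMetric n M) {p : M} {ζ₀ : Vec n × Vec n}
    (hζ : ζ₀ ∈ (tchart p).target) {N : Set (Vec n × Vec n)} (hN : N ∈ 𝓝 ζ₀) :
    ∃ B : FlowBox g p ζ₀, closedBall ζ₀ B.a ⊆ N := by
  obtain ⟨K, t, ht, hK⟩ := exists_lipschitzOnWith_extField g hζ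
  obtain ⟨V, hV, hVT⟩ := mem_nhdsWithin_iff_exists_mem_nhds_inter.1
    (target_prod_mem_nhdsWithin hζ)
  obtain ⟨a, ha, hsub⟩ := nhds_basis_closedBall.mem_iff.1
    (Filter.inter_mem hN (Filter.inter_mem ht hV))
  have hlip : LipschitzOnWith K (extField g p) (closedBall ζ₀ ((⟨a, ha.le⟩ : NNReal) : ℝ)) :=
    hK.mono fun ζ hζ => (hsub hζ).2.1
  obtain ⟨r, hr, ε, hε, α, hα, hαc, -⟩ := exists_localFlow (a := ⟨a, ha.le⟩)
    (NNReal.coe_pos.1 ha) hlip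
  refine ⟨⟨a, r, ε, ha, hr, hε, fun ζ t => α (ζ, t), fun ζ hζ h0 => ?_, fun ζ hζ => (hα ζ hζ).1,
    fun ζ hζ t ht => ((hα ζ hζ).2 t ht).1, fun ζ hζ t ht => ((hα ζ hζ).2 t ht).2, hαc, K, hlip⟩,
    fun ζ hζ => (hsub hζ).1⟩
  exact mem_tchart_target.2 (hVT ⟨(hsub hζ).2.2, mem_range_iff.2 h0, trivial⟩).1

namespace FlowBox

variable {g : LorentzMetric n M} {p : M} {ζ₀ : Vec n × Vec n} (B : FlowBox g p ζ₀)

theorem shift_hasDerivWithinAt {ζ : Vec n × Vec n} (hζ : ζ ∈ closedBall ζ₀ B.r) {a b c : ℝ}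
    (ha : c - B.ε ≤ a) (hb : b ≤ c + B.ε) {t : ℝ} (ht : t ∈ Icc a b) :
    HasDerivWithinAt (fun t => B.flow ζ (t - c)) (extField g p (B.flow ζ (t - c))) (Icc a b) t := by
  have h1 : HasDerivWithinAt (fun t : ℝ => t - c) 1 (Icc a b) t :=
    ((hasDerivAt_id t).sub_const c).hasDerivWithinAt
  have hm : MapsTo (fun t : ℝ => t - c) (Icc a b) (Icc (-B.ε) B.ε) := fun s hs => by
    constructor <;> linarith [hs.1, hs.2]
  have h2 := (B.hasDerivWithinAt ζ hζ (t - c) (hm ht)).scomp t h1 hm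
  rwa [one_smul] at h2

/-- A geodesic that starts in a flow box is given by the flow. -/
theorem eq_flow [T2Space M] {θ : ℝ → TangentBundle (𝓡∂ n) M} {a b : ℝ}
    (hθ : IsGeodesicOn g θ (Icc a b)) (hb : b ≤ a + B.ε) (ha : θ a ∈ (tchart p).source)
    (har : tchart p (θ a) ∈ closedBall ζ₀ B.r) :
    ∀ t ∈ Icc a b, θ t ∈ (tchart p).source ∧ tchart p (θ t) = B.flow (tchart p (θ a)) (t - a) := by
  have hε := B.ε_pos
  refine hθ.eq_of_extField (fun t ht => B.shift_hasDerivWithinAt har (by linarith) hb ht)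
    (fun t ht h0 => B.target _ (B.mem _ har _ ?_) h0) ha ?_
  · constructor <;> linarith [ht.1, ht.2]
  · rw [sub_self, B.flow_zero _ har]

/-- The part of the flow that stays in the half space is geodesic. -/
theorem isGeodesicOn_symm {ζ : Vec n × Vec n} (hζ : ζ ∈ closedBall ζ₀ B.r) {a b c : ℝ}
    (ha : c - B.ε ≤ a) (hb : b ≤ c + B.ε) (h0 : ∀ t ∈ Icc a b, 0 ≤ (B.flow ζ (t - c)).1 0) :
    IsGeodesicOn g (fun t => (tchart p).symm (B.flow ζ (t - c))) (Icc a b) :=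
  isGeodesicOn_tchart_symm (fun t ht => B.shift_hasDerivWithinAt hζ ha hb ht)
    fun t ht => B.target _ (B.mem _ hζ _ (by constructor <;> linarith [ht.1, ht.2])) (h0 t ht)

end FlowBox

theorem tchart_mem_target {p : M} {ξ : TangentBundle (𝓡∂ n) M} (hξ : ξ ∈ (tchart p).source) :
    tchart p ξ ∈ (tchart p).target :=
  (tchart p).map_source hξ

theorem tendsto_tchart {p : M} {ξ : TangentBundle (𝓡∂ n) M} (hξ : ξ ∈ (tchart p).source) :
    Filter.Tendsto (tchart p) (𝓝 ξ) (𝓝 (tchart p ξ)) :=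
  (continuousOn_tchart p).continuousAt ((isOpen_tchart_source p).mem_nhds hξ)

/-- A geodesic is determined by its initial vector. -/
theorem IsGeodesicOn.eqOn [T2Space M] {g : LorentzMetric n M}
    {θ₁ θ₂ : ℝ → TangentBundle (𝓡∂ n) M} {a b : ℝ} (h₁ : IsGeodesicOn g θ₁ (Icc a b))
    (h₂ : IsGeodesicOn g θ₂ (Icc a b)) (h : θ₁ a = θ₂ a) : EqOn θ₁ θ₂ (Icc a b) := by
  intro c hc
  have hsub : Icc a c ⊆ Icc a b := Icc_subset_Icc_right hc.2
  refine rel_of_locally_rel (P := fun r s => θ₁ r = θ₂ r → θ₁ s = θ₂ s) hc.1 (fun _ _ h => h)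
    (fun _ _ _ _ _ _ _ _ h1 h2 h => h2 (h1 h)) (fun t ht => ?_) h
  set p := (θ₁ t).proj
  have hs : θ₁ t ∈ (tchart p).source := self_mem_tchart_source _
  obtain ⟨B, -⟩ := exists_flowBox g (tchart_mem_target hs) Filter.univ_mem
  have h3 : ∀ᶠ r in 𝓝[Icc a b] t, θ₁ r ∈ (tchart p).source ∧
      tchart p (θ₁ r) ∈ closedBall (tchart p (θ₁ t)) B.r :=
    (h₁.eventually_mem_source (hsub ht) hs).and
      ((h₁.hasDerivWithinAt (hsub ht) hs).continuousWithinAt (closedBall_mem_nhds _ B.r_pos))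
  obtain ⟨δ, hδ, hall⟩ := Metric.mem_nhdsWithin_iff.1 h3
  -- Half the lifetime on either side of `t` keeps `s - r` below `B.ε`, so one run of the flow from
  -- `r` reaches `s`.
  refine ⟨min δ (B.ε / 2), lt_min hδ (half_pos B.ε_pos), fun r hr s hs hrs hrt hst heq => ?_⟩
  have hr' : r ∈ Icc a b := hsub hr
  obtain ⟨hr1, hr2⟩ := hall ⟨by
    rw [Metric.mem_ball, Real.dist_eq]; exact hrt.trans_le (min_le_left _ _), hr'⟩
  have hsr : s ≤ r + B.ε := by
    have e1 := (abs_lt.1 (hrt.trans_le (min_le_right _ _))).1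
    have e2 := (abs_lt.1 (hst.trans_le (min_le_right _ _))).2
    linarith
  have hsub' : Icc r s ⊆ Icc a b := Icc_subset_Icc hr'.1 (hsub hs).2
  have hsI : s ∈ Icc r s := ⟨hrs, le_rfl⟩
  have e1 := B.eq_flow (h₁.mono hsub') hsr hr1 hr2 s hsI
  have e2 := B.eq_flow (h₂.mono hsub') hsr (heq ▸ hr1) (heq ▸ hr2) s hsI
  rw [← heq] at e2
  exact (tchart p).injOn e1.1 e2.1 (e1.2.trans e2.2.symm)

/-- The scalar square of the velocity is constant along geodesics. -/
theorem IsGeodesicOn.sq_eq {g : LorentzMetric n M} {θ : ℝ → TangentBundle (𝓡∂ n) M} {a b : ℝ}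
    (h : IsGeodesicOn g θ (Icc a b)) {t : ℝ} (ht : t ∈ Icc a b) : g.sq (θ t) = g.sq (θ a) := by
  have hder : ∀ t ∈ Icc a b, HasDerivWithinAt (fun r => g.sq (θ r)) 0 (Icc a b) t := by
    intro t ht
    set p := (θ t).proj
    have hs : θ t ∈ (tchart p).source := self_mem_tchart_source _
    have hT := mem_tchart_target.1 (tchart_mem_target hs)
    have hd := h.hasDerivWithinAt ht hs
    have hz : HasDerivWithinAt (fun r => (tchart p (θ r)).1) (tchart p (θ t)).2 (Icc a b) t := hd.fst
    have hv : HasDerivWithinAt (fun r => (tchart p (θ r)).2)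
      (geodesicField g p (tchart p (θ t))).2 (Icc a b) t := hd.snd
    have h1 := hasDerivWithinAt_form_apply (differentiableWithinAt_metricForm g hT) hz hv hv
      (Filter.Eventually.of_forall fun r => mem_range_self _)
    -- The geodesic equation tested against the velocity itself: the derivative of the coefficients
    -- cancels the two equal acceleration terms.
    have h2 := (eq_spray_snd_iff (A := metricForm g p) (H := range (𝓡∂ n))
      (v := (tchart p (θ t)).2) (metricForm_isInvertible g hT)).1 rfl (tchart p (θ t)).2
    rw [christoffelForm_apply] at h2
    have h3 : formDeriv (metricForm g p) (range (𝓡∂ n)) (tchart p (θ t)).1 (tchart p (θ t)).2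
        (tchart p (θ t)).2 (tchart p (θ t)).2 +
        metricForm g p (tchart p (θ t)).1 (geodesicField g p (tchart p (θ t))).2
          (tchart p (θ t)).2 +
        metricForm g p (tchart p (θ t)).1 (tchart p (θ t)).2
          (geodesicField g p (tchart p (θ t))).2 = 0 := by
      rw [metricForm_symm g p _ (tchart p (θ t)).2 (geodesicField g p (tchart p (θ t))).2]
      have : (geodesicField g p (tchart p (θ t))).2 = (spray (metricForm g p) (range (𝓡∂ n))
        ((tchart p (θ t)).1, (tchart p (θ t)).2)).2 := rfl
      rw [this]
      linarith
    rw [h3] at h1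
    refine h1.congr_of_eventuallyEq ?_ (sq_eq_metricForm g hs)
    filter_upwards [h.eventually_mem_source ht hs] with r hr
    exact sq_eq_metricForm g hr
  exact constant_of_has_deriv_right_zero (HasDerivWithinAt.continuousOn hder)
    (fun x hx => hasDerivWithinAt_Ici_of_Icc (hder x (Ico_subset_Icc_self hx)) hx) t ht

/-! ### Linear algebra at the boundary -/

theorem normalCoord_add (x : M) (v w : TangentSpace (𝓡∂ n) x) :
    normalCoord x (v + w) = normalCoord x v + normalCoord x w := rfl

theorem normalCoord_smul (x : M) (c : ℝ) (v : TangentSpace (𝓡∂ n) x) :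
    normalCoord x (c • v) = c * normalCoord x v := rfl

theorem normalCoord_sub (x : M) (v w : TangentSpace (𝓡∂ n) x) :
    normalCoord x (v - w) = normalCoord x v - normalCoord x w := rfl

/-- The decomposition of a vector into a normal and a tangential part. -/
theorem IsOutwardUnitNormal.tangent_sub {g : LorentzMetric n M} {x : M}
    {ν : TangentSpace (𝓡∂ n) x} (hν : IsOutwardUnitNormal g x ν) (v : TangentSpace (𝓡∂ n) x) :
    TangentToBoundary x (v - (normalCoord x v / normalCoord x ν) • ν) := by
  rw [TangentToBoundary, normalCoord_sub, normalCoord_smul, div_mul_cancel₀ _ hν.outward.ne,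
    sub_self]

theorem IsOutwardUnitNormal.inner_eq {g : LorentzMetric n M} {x : M}
    {ν : TangentSpace (𝓡∂ n) x} (hν : IsOutwardUnitNormal g x ν) (v : TangentSpace (𝓡∂ n) x) :
    g.inner x v ν = normalCoord x v / normalCoord x ν := by
  have h1 := hν.normal _ (hν.tangent_sub v)
  rw [map_sub, map_smul, smul_eq_mul, hν.unit, mul_one, g.symm] at h1
  linarith

theorem normalCoord_pos_of_mem_inwardTM {g : LorentzMetric n M} {ξ : TangentBundle (𝓡∂ n) M}
    (hξ : ξ ∈ inwardTM g) : 0 < normalCoord ξ.proj ξ.2 := by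
  obtain ⟨_, ν, hν, hneg⟩ := hξ
  rw [hν.inner_eq] at hneg
  by_contra h
  exact absurd hneg (not_lt.2 (div_nonneg_of_nonpos (not_lt.1 h) hν.outward.le))

theorem mem_inwardTM_of_normalCoord_pos {g : LorentzMetric n M} {ξ : TangentBundle (𝓡∂ n) M}
    (hξ : ξ.proj ∈ (𝓡∂ n).boundary M) {ν : TangentSpace (𝓡∂ n) ξ.proj}
    (hν : IsOutwardUnitNormal g ξ.proj ν) (h : 0 < normalCoord ξ.proj ξ.2) : ξ ∈ inwardTM g :=
  ⟨hξ, ν, hν, by rw [hν.inner_eq]; exact div_neg_of_pos_of_neg h hν.outward⟩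

theorem mem_outwardTM_of_normalCoord_neg {g : LorentzMetric n M} {ξ : TangentBundle (𝓡∂ n) M}
    (hξ : ξ.proj ∈ (𝓡∂ n).boundary M) {ν : TangentSpace (𝓡∂ n) ξ.proj}
    (hν : IsOutwardUnitNormal g ξ.proj ν) (h : normalCoord ξ.proj ξ.2 < 0) : ξ ∈ outwardTM g :=
  ⟨hξ, ν, hν, by rw [hν.inner_eq]; exact div_pos_of_neg_of_neg h hν.outward⟩

/-- In a Lorentzian space, the vectors orthogonal to a timelike vector are spacelike. -/
theorem IsLorentzForm.pos_of_orthogonal {V : Type*} [AddCommGroup V] [Module ℝ V]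
    (B : V →ₗ[ℝ] V →ₗ[ℝ] ℝ) (hsymm : ∀ v w, B v w = B w v)
    (hB : IsLorentzForm (fun _ : V => True) (fun v w => B v w)) {u w : V} (hu : B u u < 0)
    (huw : B u w = 0) (hw : w ≠ 0) : 0 < B w w := by
  obtain ⟨u₁, -, hneg, hpos⟩ := hB
  by_contra hcon
  have hcon := not_lt.1 hcon
  -- The combination of `u` and `w` orthogonal to `u₁`. If `B w w ≤ 0` its square is nonpositive, so
  -- it vanishes; this forces `u` to be orthogonal to `u₁` as well, although `u` has negative
  -- square.
  set z := B u₁ w • u - B u₁ u • w with hz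
  have hz0 : B u₁ z = 0 := by simp [hz]; ring
  have hzz : B z z ≤ 0 := by
    have : B z z = (B u₁ w) ^ 2 * B u u + (B u₁ u) ^ 2 * B w w := by
      simp [hz, huw, hsymm w u]; ring
    rw [this]
    have h1 := mul_nonneg (sq_nonneg (B u₁ w)) (neg_nonneg.2 hu.le)
    have h2 := mul_nonneg (sq_nonneg (B u₁ u)) (neg_nonneg.2 hcon)
    linarith
  have hz' : z = 0 := by
    by_contra hne
    exact absurd (hpos z trivial hne hz0) (not_lt.2 hzz)
  have h1 : B u z = 0 := by rw [hz', map_zero]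
  have h2 : B u₁ w = 0 := by
    simp [hz, huw] at h1
    exact h1.resolve_right hu.ne
  have h3 : B u₁ u = 0 := by
    rw [hz, h2, zero_smul, zero_sub, neg_eq_zero, smul_eq_zero] at hz'
    exact hz'.resolve_right hw
  have hu0 : u ≠ 0 := by
    rintro rfl
    simp at hu
  exact absurd (hpos u trivial hu0 h3) (not_lt.2 hu.le)

/-! ### The outward unit normal in a chart -/

theorem normalCoord_eq_tchart (ξ : TangentBundle (𝓡∂ n) M) :
    normalCoord ξ.proj ξ.2 = (tchart ξ.proj ξ).2 0 := by
  rw [tchart_self]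
  rfl

theorem nonneg_of_hasDerivWithinAt_of_nonneg {f : ℝ → ℝ} {f' : ℝ}
    (h : HasDerivWithinAt f f' (Ici 0) 0) (h0 : f 0 = 0) (hf : ∀ᶠ t in 𝓝[>] 0, 0 ≤ f t) :
    0 ≤ f' := by
  have h1 := (hasDerivWithinAt_iff_tendsto_slope' self_notMem_Ioi).1 h.Ioi_of_Ici
  refine ge_of_tendsto h1 ?_
  filter_upwards [hf, self_mem_nhdsWithin] with t ht ht0
  rw [slope_def_field, h0, sub_zero, sub_zero]
  exact div_nonneg ht (le_of_lt ht0)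

theorem hasFDerivWithinAt_chart_change {p q r : M} (hp : r ∈ (extChartAt (𝓡∂ n) p).source)
    (hq : r ∈ (extChartAt (𝓡∂ n) q).source) :
    HasFDerivWithinAt (extChartAt (𝓡∂ n) q ∘ (extChartAt (𝓡∂ n) p).symm)
      (tangentCoordChange (𝓡∂ n) p q r) (range (𝓡∂ n)) (extChartAt (𝓡∂ n) p r) := by
  have := isManifold_one (n := n) (M := M)
  exact hasFDerivWithinAt_tangentCoordChange ⟨hp, hq⟩

/-- A straight ray from the boundary point in the direction of the vector stays in the half space.
Its image in the other chart has a nonnegative boundary coordinate that vanishes at the start, so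
the derivative there is nonnegative. -/
theorem tchart_snd_zero_nonneg {p q : M} {ξ : TangentBundle (𝓡∂ n) M}
    (hp : ξ ∈ (tchart p).source) (hq : ξ ∈ (tchart q).source) (hξ : ξ.proj ∈ (𝓡∂ n).boundary M)
    (h : 0 ≤ (tchart p ξ).2 0) : 0 ≤ (tchart q ξ).2 0 := by
  have hp' := mem_tchart_source.1 hp
  have hq' := mem_tchart_source.1 hq
  have hf := hasFDerivWithinAt_chart_change hp' hq'
  set z := extChartAt (𝓡∂ n) p ξ.proj
  set v := (tchart p ξ).2
  have hc : HasDerivWithinAt (fun t : ℝ => z + t • v) v (Ici 0) 0 := by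
    simpa using (((hasDerivAt_id (0 : ℝ)).smul_const v).const_add z).hasDerivWithinAt
  have hz0 : z 0 = 0 := (mem_boundary_iff_chart hp').1 hξ
  have h2 := hasDerivWithinAt_comp_of_eventually_mem (f := fun t : ℝ => z + t • v)
    (t := range (𝓡∂ n)) (x := 0) (by simpa using hf) hc (by
    filter_upwards [self_mem_nhdsWithin] with t ht
    refine mem_range_iff.2 ?_
    simp only [PiLp.add_apply, PiLp.smul_apply, smul_eq_mul, hz0, zero_add]
    exact mul_nonneg ht h)
  have h3 : HasDerivWithinAt (fun t : ℝ => ((extChartAt (𝓡∂ n) q ∘ (extChartAt (𝓡∂ n) p).symm)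
      (z + t • v)) 0) ((tangentCoordChange (𝓡∂ n) p q ξ.proj v) 0) (Ici 0) 0 :=
    (EuclideanSpace.proj (𝕜 := ℝ) (0 : Fin n)).hasFDerivAt.comp_hasDerivWithinAt _ h2
  have h4 := nonneg_of_hasDerivWithinAt_of_nonneg h3 (by
    simp only [zero_smul, add_zero, Function.comp_apply, z]
    rw [(extChartAt (𝓡∂ n) p).left_inv hp']
    exact (mem_boundary_iff_chart hq').1 hξ)
    (Filter.Eventually.of_forall fun t => extChartAt_apply_zero_nonneg _ _)
  rw [tchart_change hp hq]
  exact h4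

/-- The strict sign follows from the weak one, applied to the opposite vector with the charts
exchanged. -/
theorem tchart_snd_zero_pos_iff {p q : M} {ξ : TangentBundle (𝓡∂ n) M}
    (hp : ξ ∈ (tchart p).source) (hq : ξ ∈ (tchart q).source) (hξ : ξ.proj ∈ (𝓡∂ n).boundary M) :
    0 < (tchart p ξ).2 0 ↔ 0 < (tchart q ξ).2 0 := by
  have key : ∀ {p q : M}, ξ ∈ (tchart p).source → ξ ∈ (tchart q).source →
      0 < (tchart p ξ).2 0 → 0 < (tchart q ξ).2 0 := fun {p q} hp hq h => by
    by_contra hcon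
    have hp' : tneg ξ ∈ (tchart p).source := mem_tchart_source.2 (mem_tchart_source.1 hp)
    have hq' : tneg ξ ∈ (tchart q).source := mem_tchart_source.2 (mem_tchart_source.1 hq)
    have h1 := tchart_snd_zero_nonneg hq' hp' hξ (by
      rw [tchart_tneg]
      simpa using not_lt.1 hcon)
    rw [tchart_tneg] at h1
    simp only [PiLp.neg_apply] at h1
    linarith
  exact ⟨key hp hq, key hq hp⟩

theorem tchart_snd_zero_neg_iff {p q : M} {ξ : TangentBundle (𝓡∂ n) M}
    (hp : ξ ∈ (tchart p).source) (hq : ξ ∈ (tchart q).source) (hξ : ξ.proj ∈ (𝓡∂ n).boundary M) :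
    (tchart p ξ).2 0 < 0 ↔ (tchart q ξ).2 0 < 0 := by
  have hp' : tneg ξ ∈ (tchart p).source := mem_tchart_source.2 (mem_tchart_source.1 hp)
  have hq' : tneg ξ ∈ (tchart q).source := mem_tchart_source.2 (mem_tchart_source.1 hq)
  have h := tchart_snd_zero_pos_iff hp' hq' hξ
  rw [tchart_tneg, tchart_tneg] at h
  simpa using h

theorem tchart_snd_zero_eq_iff {p q : M} {ξ : TangentBundle (𝓡∂ n) M}
    (hp : ξ ∈ (tchart p).source) (hq : ξ ∈ (tchart q).source) (hξ : ξ.proj ∈ (𝓡∂ n).boundary M) :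
    (tchart p ξ).2 0 = 0 ↔ (tchart q ξ).2 0 = 0 := by
  have h1 := tchart_snd_zero_pos_iff hp hq hξ
  have h2 := tchart_snd_zero_neg_iff hp hq hξ
  constructor <;> intro h <;> by_contra hne <;> rcases lt_or_gt_of_ne hne with h' | h'
  · exact absurd (h2.2 h') (by rw [h]; exact lt_irrefl _)
  · exact absurd (h1.2 h') (by rw [h]; exact lt_irrefl _)
  · exact absurd (h2.1 h') (by rw [h]; exact lt_irrefl _)
  · exact absurd (h1.1 h') (by rw [h]; exact lt_irrefl _)

/-- The metric dual in a chart of the differential of the boundary defining coordinate. -/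
def conormal (g : LorentzMetric n M) (p : M) (z : Vec n) : Vec n :=
  (metricForm g p z).inverse (EuclideanSpace.proj (𝕜 := ℝ) (0 : Fin n))

theorem metricForm_conormal (g : LorentzMetric n M) {p : M} {z : Vec n}
    (hz : z ∈ (extChartAt (𝓡∂ n) p).target) (v : Vec n) :
    metricForm g p z (conormal g p z) v = v 0 := by
  obtain ⟨e, he⟩ := metricForm_isInvertible g hz
  rw [conormal, ← he, ContinuousLinearMap.inverse_equiv]
  have : (e : Vec n →L[ℝ] Vec n →L[ℝ] ℝ) (e.symm (EuclideanSpace.proj (𝕜 := ℝ) (0 : Fin n))) =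
    EuclideanSpace.proj (𝕜 := ℝ) (0 : Fin n) := e.apply_symm_apply _
  exact congrArg (fun f : Vec n →L[ℝ] ℝ => f v) this

theorem continuousWithinAt_conormal (g : LorentzMetric n M) {p : M} {z : Vec n}
    (hz : z ∈ (extChartAt (𝓡∂ n) p).target) :
    ContinuousWithinAt (conormal g p) (range (𝓡∂ n)) z := by
  have h1 := (contDiffWithinAt_metricForm g hz).continuousWithinAt
  obtain ⟨e, he⟩ := metricForm_isInvertible g hz
  have h2 : ContinuousAt (ContinuousLinearMap.inverse (R := ℝ) (M := Vec n)
      (M₂ := Vec n →L[ℝ] ℝ)) (metricForm g p z) := by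
    rw [← he]
    exact (contDiffAt_map_inverse (n := 1) e).continuousAt
  exact (h2.comp_continuousWithinAt h1).clm_apply continuousWithinAt_const

theorem conormal_ne_zero (g : LorentzMetric n M) {p : M} {z : Vec n}
    (hz : z ∈ (extChartAt (𝓡∂ n) p).target) : conormal g p z ≠ 0 := by
  intro h
  have h1 := metricForm_conormal g hz (EuclideanSpace.single 0 1)
  rw [h, map_zero] at h1
  simp at h1

/-- The conormal is orthogonal to `T∂M`, which contains a timelike vector, so it is spacelike; and
its square is its own component along the boundary coordinate. -/
theorem conormal_zero_pos {g : LorentzMetric n M} (hbd : HasTimelikeBoundary g) {x : M}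
    (hx : x ∈ (𝓡∂ n).boundary M) : 0 < conormal g x (extChartAt (𝓡∂ n) x x) 0 := by
  obtain ⟨u, hu, hneg, -⟩ := hbd x hx
  have hz := mem_extChartAt_target (I := 𝓡∂ n) x
  rw [← metricForm_conormal g hz (conormal g x (extChartAt (𝓡∂ n) x x))]
  refine lt_of_lt_of_eq ?_ (inner_eq_metricForm_self g x (conormal g x (extChartAt (𝓡∂ n) x x))
    (conormal g x (extChartAt (𝓡∂ n) x x)))
  have hl := g.lorentzian x
  refine IsLorentzForm.pos_of_orthogonal (V := TangentSpace (𝓡∂ n) x)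
    ((ContinuousLinearMap.coeLM ℝ).comp (g.inner x).toLinearMap) (g.symm x) hl hneg ?_
    (conormal_ne_zero g hz)
  exact ((g.symm x _ _).trans ((inner_eq_metricForm_self g x _ _).trans
    (metricForm_conormal g hz u))).trans hu

theorem exists_isOutwardUnitNormal {g : LorentzMetric n M} (hbd : HasTimelikeBoundary g) {x : M}
    (hx : x ∈ (𝓡∂ n).boundary M) : ∃ ν, IsOutwardUnitNormal g x ν := by
  have hz := mem_extChartAt_target (I := 𝓡∂ n) x
  have hpos := conormal_zero_pos hbd hx
  set a := conormal g x (extChartAt (𝓡∂ n) x x)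
  have ha : ∀ v : TangentSpace (𝓡∂ n) x,
      g.inner x (show TangentSpace (𝓡∂ n) x from a) v = normalCoord x v :=
    fun v => (inner_eq_metricForm_self g x _ _).trans (metricForm_conormal g hz v)
  have hs := Real.sqrt_pos.2 hpos
  have hss := Real.mul_self_sqrt hpos.le
  have haa : normalCoord x a = a 0 := rfl
  refine ⟨(-(Real.sqrt (a 0))⁻¹ : ℝ) • (show TangentSpace (𝓡∂ n) x from a), ?_, fun u hu => ?_, ?_⟩
  · rw [map_smul, map_smul, smul_apply, ha, smul_eq_mul, smul_eq_mul, haa]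
    field_simp
    rw [sq, hss]
  · rw [map_smul, smul_apply, ha, smul_eq_mul]
    rw [TangentToBoundary] at hu
    rw [hu, mul_zero]
  · rw [normalCoord_smul, haa]
    have := mul_pos (inv_pos.2 hs) hpos
    linarith

/-- The normal `N` no longer appears on the right. This yields continuity of the product with the
unit normal without a continuous choice of normals. -/
theorem form_normal_eq {A : Vec n →L[ℝ] Vec n →L[ℝ] ℝ} (hsymm : ∀ v w, A v w = A w v)
    {N a : Vec n} (hunit : A N N = 1) (hnorm : ∀ u : Vec n, u 0 = 0 → A N u = 0)
    (ha : ∀ v, A a v = v 0) (hN : N 0 < 0) (v : Vec n) : A v N = -v 0 / Real.sqrt (a 0) := by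
  have h1 : ∀ v : Vec n, A v N = v 0 / N 0 := fun v => by
    have h2 := hnorm (v - (v 0 / N 0) • N) (by
      simp only [PiLp.sub_apply, PiLp.smul_apply, smul_eq_mul]
      rw [div_mul_cancel₀ _ hN.ne, sub_self])
    rw [map_sub, map_smul, hunit, smul_eq_mul, mul_one, hsymm] at h2
    exact sub_eq_zero.1 h2
  have h3 : a 0 = (-N 0) ^ 2 := by
    have := (h1 a).symm.trans (ha N)
    rw [div_eq_iff hN.ne] at this
    rw [this]
    ring
  rw [h3, Real.sqrt_sq (by linarith), h1, neg_div_neg_eq]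

/-- The product with the unit normal, in a chart. -/
theorem IsOutwardUnitNormal.inner_eq_chart {g : LorentzMetric n M} {p q : M}
    (hq : q ∈ (extChartAt (𝓡∂ n) p).source) (hqb : q ∈ (𝓡∂ n).boundary M)
    {ν : TangentSpace (𝓡∂ n) q} (hν : IsOutwardUnitNormal g q ν) (v : TangentSpace (𝓡∂ n) q) :
    g.inner q v ν = -(tchart p (⟨q, v⟩ : TangentBundle (𝓡∂ n) M)).2 0 /
      Real.sqrt (conormal g p (extChartAt (𝓡∂ n) p q) 0) := by
  have hz := (extChartAt (𝓡∂ n) p).map_source hq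
  have hs : ∀ v : TangentSpace (𝓡∂ n) q, (⟨q, v⟩ : TangentBundle (𝓡∂ n) M) ∈ (tchart p).source :=
    fun v => mem_tchart_source.2 hq
  have hself : ∀ v : TangentSpace (𝓡∂ n) q, normalCoord q v =
    (tchart q (⟨q, v⟩ : TangentBundle (𝓡∂ n) M)).2 0 := fun v =>
      normalCoord_eq_tchart (⟨q, v⟩ : TangentBundle (𝓡∂ n) M)
  refine (inner_eq_metricForm g hq v ν).trans (form_normal_eq (metricForm_symm g p _)
    ((inner_eq_metricForm g hq ν ν).symm.trans hν.unit) (fun u hu => ?_)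
    (metricForm_conormal g hz) ?_ _)
  · have hu' : tangentCoordChange (𝓡∂ n) q p q (tangentCoordChange (𝓡∂ n) p q q u) = u := by
      have := isManifold_one (n := n) (M := M)
      rw [tangentCoordChange_comp ⟨⟨hq, mem_extChartAt_source q⟩, hq⟩, tangentCoordChange_self hq]
    have h1 := hν.normal (tangentCoordChange (𝓡∂ n) p q q u) (by
      refine (hself _).trans ?_
      refine (tchart_snd_zero_eq_iff (hs _) (self_mem_tchart_source _) hqb).1 ?_
      change (tangentCoordChange (𝓡∂ n) q p q (tangentCoordChange (𝓡∂ n) p q q u)) 0 = 0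
      rw [hu', hu])
    have h2 := (inner_eq_metricForm g hq ν (tangentCoordChange (𝓡∂ n) p q q u)).symm.trans h1
    rwa [hu'] at h2
  · have := hν.outward
    rw [hself] at this
    exact (tchart_snd_zero_neg_iff (self_mem_tchart_source _) (hs ν) hqb).1 this

/-- The product with the unit normal depends continuously on the vector. -/
theorem tendsto_inner_normal {g : LorentzMetric n M} (hbd : HasTimelikeBoundary g)
    {ι : Type*} {l : Filter ι} {ξ : ι → TangentBundle (𝓡∂ n) M} {ξ₀ : TangentBundle (𝓡∂ n) M}
    (hξ : Filter.Tendsto ξ l (𝓝 ξ₀)) (hξb : ∀ᶠ i in l, (ξ i).proj ∈ (𝓡∂ n).boundary M)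
    (hξ₀ : ξ₀.proj ∈ (𝓡∂ n).boundary M) {ν : ∀ i, TangentSpace (𝓡∂ n) (ξ i).proj}
    (hν : ∀ᶠ i in l, IsOutwardUnitNormal g (ξ i).proj (ν i)) {ν₀ : TangentSpace (𝓡∂ n) ξ₀.proj}
    (hν₀ : IsOutwardUnitNormal g ξ₀.proj ν₀) :
    Filter.Tendsto (fun i => g.inner (ξ i).proj (ξ i).2 (ν i)) l
      (𝓝 (g.inner ξ₀.proj ξ₀.2 ν₀)) := by
  have hs := self_mem_tchart_source ξ₀
  have hsrc := mem_tchart_source.1 hs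
  rw [hν₀.inner_eq_chart hsrc hξ₀]
  have hlim : Filter.Tendsto (fun i => tchart ξ₀.proj (ξ i)) l (𝓝 (tchart ξ₀.proj ξ₀)) :=
    (tendsto_tchart hs).comp hξ
  have h1 : Filter.Tendsto (fun i => (tchart ξ₀.proj (ξ i)).2 0) l
      (𝓝 ((tchart ξ₀.proj ξ₀).2 0)) :=
    ((EuclideanSpace.proj (𝕜 := ℝ) (0 : Fin n)).continuous.tendsto _).comp
      ((continuous_snd.tendsto _).comp hlim)
  have h2 : Filter.Tendsto (fun i => (tchart ξ₀.proj (ξ i)).1) l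
      (𝓝[range (𝓡∂ n)] (tchart ξ₀.proj ξ₀).1) :=
    tendsto_nhdsWithin_iff.2 ⟨(continuous_fst.tendsto _).comp hlim,
      Filter.Eventually.of_forall fun i => mem_range_self _⟩
  have h3 := (continuousWithinAt_conormal g
    (mem_tchart_target.1 (tchart_mem_target hs))).tendsto.comp h2
  have h4 : Filter.Tendsto (fun i => Real.sqrt (conormal g ξ₀.proj (tchart ξ₀.proj (ξ i)).1 0)) l
      (𝓝 (Real.sqrt (conormal g ξ₀.proj (tchart ξ₀.proj ξ₀).1 0))) :=
    (Real.continuous_sqrt.tendsto _).comp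
      (((EuclideanSpace.proj (𝕜 := ℝ) (0 : Fin n)).continuous.tendsto _).comp h3)
  refine (h1.neg.div h4 (Real.sqrt_pos.2 (conormal_zero_pos hbd hξ₀)).ne').congr' ?_
  filter_upwards [hξb, hν, hξ ((isOpen_tchart_source _).mem_nhds hs)] with i hi hνi hsi
  exact (hνi.inner_eq_chart (mem_tchart_source.1 hsi) hi _).symm

/-! ### The interior travel time -/

theorem mul_sub_le_of_le_hasDerivWithinAt {f f' : ℝ → ℝ} {a b m : ℝ}
    (hf : ∀ t ∈ Icc a b, HasDerivWithinAt f (f' t) (Icc a b) t) (hm : ∀ t ∈ Icc a b, m ≤ f' t)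
    {s t : ℝ} (hs : s ∈ Icc a b) (ht : t ∈ Icc a b) (hst : s ≤ t) : m * (t - s) ≤ f t - f s := by
  have hd : ∀ x ∈ interior (Icc a b), HasDerivAt f (f' x) x := fun x hx =>
    (hf x (interior_subset hx)).hasDerivAt (mem_interior_iff_mem_nhds.1 hx)
  refine (convex_Icc a b).mul_sub_le_image_sub_of_le_deriv (HasDerivWithinAt.continuousOn hf)
    (fun x hx => (hd x hx).differentiableAt.differentiableWithinAt)
    (fun x hx => ?_) s hs t ht hst
  rw [(hd x hx).deriv]
  exact hm x (interior_subset hx)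

theorem hasDerivWithinAt_apply_zero {c : ℝ → Vec n} {c' : Vec n} {s : Set ℝ} {t : ℝ}
    (h : HasDerivWithinAt c c' s t) : HasDerivWithinAt (fun r => c r 0) (c' 0) s t :=
  (EuclideanSpace.proj (𝕜 := ℝ) (0 : Fin n)).hasFDerivAt.comp_hasDerivWithinAt t h

theorem FlowBox.hasDerivWithinAt_fst {g : LorentzMetric n M} {p : M} {ζ₀ : Vec n × Vec n}
    (B : FlowBox g p ζ₀) {ζ : Vec n × Vec n} (hζ : ζ ∈ closedBall ζ₀ B.r) {t : ℝ}
    (ht : t ∈ Icc (-B.ε) B.ε) :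
    HasDerivWithinAt (fun t => (B.flow ζ t).1 0) ((B.flow ζ t).2 0) (Icc (-B.ε) B.ε) t := by
  have h1 : HasDerivWithinAt (fun t => (B.flow ζ t).1) (extField g p (B.flow ζ t)).1
    (Icc (-B.ε) B.ε) t := (B.hasDerivWithinAt ζ hζ t ht).fst
  exact hasDerivWithinAt_apply_zero h1

theorem FlowBox.hasDerivWithinAt_fst_Icc {g : LorentzMetric n M} {p : M} {ζ₀ : Vec n × Vec n}
    (B : FlowBox g p ζ₀) {ζ : Vec n × Vec n} (hζ : ζ ∈ closedBall ζ₀ B.r) {t : ℝ}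
    (ht : t ∈ Icc 0 B.ε) :
    HasDerivWithinAt (fun t => (B.flow ζ t).1 0) ((B.flow ζ t).2 0) (Icc 0 B.ε) t := by
  have hε := B.ε_pos
  have hsub : Icc 0 B.ε ⊆ Icc (-B.ε) B.ε := Icc_subset_Icc_left (by linarith)
  exact (B.hasDerivWithinAt_fst hζ (hsub ht)).mono hsub

theorem mem_interior_tchart_symm {p : M} {ζ : Vec n × Vec n} (hζ : ζ ∈ (tchart p).target)
    (h0 : 0 < ζ.1 0) : ((tchart p).symm ζ).proj ∈ (𝓡∂ n).interior M := by
  have hT := mem_tchart_target.1 hζ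
  refine (mem_interior_iff_chart ((extChartAt (𝓡∂ n) p).map_target hT)).2 ?_
  rw [(extChartAt (𝓡∂ n) p).right_inv hT]
  exact h0

theorem FlowBox.exists_geodesic {g : LorentzMetric n M} {ξ : TangentBundle (𝓡∂ n) M} {p : M}
    (hp : ξ ∈ (tchart p).source) (B : FlowBox g p (tchart p ξ))
    (h0 : ∀ t ∈ Ioc 0 B.ε, 0 < (B.flow (tchart p ξ) t).1 0) :
    ∃ β, IsGeodesicOn g β (Icc 0 B.ε) ∧ β 0 = ξ ∧
      ∀ t ∈ Ioc 0 B.ε, (β t).proj ∈ (𝓡∂ n).interior M := by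
  have hε := B.ε_pos
  have hc := mem_closedBall_self (x := tchart p ξ) B.r_pos.le
  have hi := B.flow_zero _ hc
  refine ⟨fun t => (tchart p).symm (B.flow (tchart p ξ) (t - 0)),
    B.isGeodesicOn_symm hc (by linarith) (by linarith) (fun t ht => ?_), ?_, fun t ht => ?_⟩
  · rw [sub_zero]
    rcases eq_or_lt_of_le ht.1 with h | h
    · rw [← h, hi]
      exact zero_nonneg_of_mem_target (mem_tchart_target.1 (tchart_mem_target hp))
    · exact (h0 t ⟨h, ht.2⟩).le
  · simp only [sub_zero]
    rw [hi, (tchart p).left_inv hp]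
  · simp only [sub_zero]
    exact mem_interior_tchart_symm (B.target _ (B.mem _ hc t ⟨by linarith [ht.1], ht.2⟩)
      (h0 t ht).le) (h0 t ht)

theorem exists_geodesic_of_interior (g : LorentzMetric n M) {ξ : TangentBundle (𝓡∂ n) M}
    (hξ : ξ.proj ∈ (𝓡∂ n).interior M) : ∃ ε > 0, ∃ β, IsGeodesicOn g β (Icc 0 ε) ∧ β 0 = ξ ∧
      ∀ t ∈ Ioc 0 ε, (β t).proj ∈ (𝓡∂ n).interior M := by
  have hs := self_mem_tchart_source ξ
  have h0 : 0 < (tchart ξ.proj ξ).1 0 := (mem_interior_iff_chart (mem_tchart_source.1 hs)).1 hξ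
  have hN : {ζ : Vec n × Vec n | 0 < ζ.1 0} ∈ 𝓝 (tchart ξ.proj ξ) :=
    (isOpen_lt continuous_const ((EuclideanSpace.proj (𝕜 := ℝ) (0 : Fin n)).continuous.comp
      continuous_fst)).mem_nhds h0
  obtain ⟨B, hB⟩ := exists_flowBox g (tchart_mem_target hs) hN
  refine ⟨B.ε, B.ε_pos, B.exists_geodesic hs fun t ht => hB (B.mem _
    (mem_closedBall_self B.r_pos.le) t ⟨?_, ht.2⟩)⟩
  linarith [ht.1, B.ε_pos]

theorem isOpen_snd_gt (m : ℝ) : IsOpen {ζ : Vec n × Vec n | m < ζ.2 0} :=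
  isOpen_lt continuous_const ((EuclideanSpace.proj (𝕜 := ℝ) (0 : Fin n)).continuous.comp
    continuous_snd)

theorem FlowBox.mul_le_flow_fst {g : LorentzMetric n M} {p : M} {ζ₀ : Vec n × Vec n}
    (B : FlowBox g p ζ₀) {m : ℝ} (hm : closedBall ζ₀ B.a ⊆ {ζ | m < ζ.2 0}) {ζ : Vec n × Vec n}
    (hζ : ζ ∈ closedBall ζ₀ B.r) {s t : ℝ} (hs : s ∈ Icc (-B.ε) B.ε) (ht : t ∈ Icc (-B.ε) B.ε)
    (hst : s ≤ t) : m * (t - s) ≤ (B.flow ζ t).1 0 - (B.flow ζ s).1 0 :=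
  mul_sub_le_of_le_hasDerivWithinAt (fun _ h => B.hasDerivWithinAt_fst hζ h)
    (fun t ht => (hm (B.mem ζ hζ t ht)).le) hs ht hst

theorem exists_geodesic_of_inward (g : LorentzMetric n M) {ξ : TangentBundle (𝓡∂ n) M}
    (hξ : 0 < normalCoord ξ.proj ξ.2) : ∃ ε > 0, ∃ β, IsGeodesicOn g β (Icc 0 ε) ∧ β 0 = ξ ∧
      ∀ t ∈ Ioc 0 ε, (β t).proj ∈ (𝓡∂ n).interior M := by
  have hs := self_mem_tchart_source ξ
  rw [normalCoord_eq_tchart] at hξ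
  -- In this box the normal velocity keeps at least half of its initial value, so the boundary
  -- coordinate grows at least linearly.
  obtain ⟨B, hB⟩ := exists_flowBox g (tchart_mem_target hs)
    ((isOpen_snd_gt ((tchart ξ.proj ξ).2 0 / 2)).mem_nhds (half_lt_self hξ))
  have hε := B.ε_pos
  have hc := mem_closedBall_self (x := tchart ξ.proj ξ) B.r_pos.le
  refine ⟨B.ε, B.ε_pos, B.exists_geodesic hs fun t ht => ?_⟩
  have h1 := B.mul_le_flow_fst hB hc (s := 0) (t := t) ⟨by linarith, hε.le⟩
    ⟨by linarith [ht.1], ht.2⟩ ht.1.le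
  rw [B.flow_zero _ hc] at h1
  have h2 : 0 ≤ (tchart ξ.proj ξ).1 0 :=
    zero_nonneg_of_mem_target (mem_tchart_target.1 (tchart_mem_target hs))
  have h3 := mul_pos (half_pos hξ) ht.1
  linarith

theorem notMem_boundary_of_interior {x : M} (h : x ∈ (𝓡∂ n).interior M) :
    x ∉ (𝓡∂ n).boundary M :=
  fun h' => ((𝓡∂ n).disjoint_interior_boundary (M := M)).le_bot ⟨h, h'⟩

theorem mem_interior_or_boundary (x : M) : x ∈ (𝓡∂ n).interior M ∨ x ∈ (𝓡∂ n).boundary M :=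
  (𝓡∂ n).isInteriorPoint_or_isBoundaryPoint x

/-- A geodesic of positive duration that starts at the boundary does not start outward. -/
theorem IsGeodesicOn.normalCoord_nonneg {g : LorentzMetric n M} {θ : ℝ → TangentBundle (𝓡∂ n) M}
    {T : ℝ} (h : IsGeodesicOn g θ (Icc 0 T)) (hT : 0 < T)
    (h0 : (θ 0).proj ∈ (𝓡∂ n).boundary M) : 0 ≤ normalCoord (θ 0).proj (θ 0).2 := by
  have hs := self_mem_tchart_source (θ 0)
  have hd : HasDerivWithinAt (fun r => (tchart (θ 0).proj (θ r)).1)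
    (tchart (θ 0).proj (θ 0)).2 (Icc 0 T) 0 := (h.hasDerivWithinAt ⟨le_rfl, hT.le⟩ hs).fst
  rw [normalCoord_eq_tchart]
  exact nonneg_of_hasDerivWithinAt_of_nonneg
    (hasDerivWithinAt_Ici_of_Icc (hasDerivWithinAt_apply_zero hd) ⟨le_rfl, hT⟩)
    ((mem_boundary_iff_chart (mem_tchart_source.1 hs)).1 h0)
    (Filter.Eventually.of_forall fun t => extChartAt_apply_zero_nonneg _ _)

/-- The first arrival time at the boundary is the interior travel time. -/
theorem interiorTravelTime_eq [T2Space M] {g : LorentzMetric n M}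
    {β : ℝ → TangentBundle (𝓡∂ n) M} {T : ℝ} (hT : 0 < T) (hβ : IsGeodesicOn g β (Icc 0 T))
    (hi : ∀ t ∈ Ioo 0 T, (β t).proj ∈ (𝓡∂ n).interior M)
    (hb : (β T).proj ∈ (𝓡∂ n).boundary M) : interiorTravelTime g (β 0) = T := by
  refine le_antisymm (sSup_le ?_) (le_sSup ⟨T, rfl, hT, β, hβ.mono Ico_subset_Icc_self, rfl, hi⟩)
  rintro _ ⟨t, rfl, ht, β', hβ', h0, hi'⟩
  rw [EReal.coe_le_coe_iff]
  by_contra hlt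
  have hlt := not_le.1 hlt
  have hsub : Icc 0 T ⊆ Ico 0 t := fun s hs => ⟨hs.1, hs.2.trans_lt hlt⟩
  -- A longer competitor would coincide with `β` at time `T` and be on the boundary there.
  have := (hβ'.mono hsub).eqOn hβ h0 ⟨hT.le, le_rfl⟩
  exact notMem_boundary_of_interior (this ▸ hi' T ⟨hT, hlt⟩) hb

/-- This is why a geodesic that cannot be continued must end on the boundary. -/
theorem IsGeodesicOn.exists_extension {g : LorentzMetric n M} {β : ℝ → TangentBundle (𝓡∂ n) M}
    {T : ℝ} (hT : 0 ≤ T) (hβ : IsGeodesicOn g β (Icc 0 T))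
    (hi : (β T).proj ∈ (𝓡∂ n).interior M) :
    ∃ T' > T, ∃ γ, IsGeodesicOn g γ (Icc 0 T') ∧ EqOn γ β (Icc 0 T) ∧
      ∀ t ∈ Ioc T T', (γ t).proj ∈ (𝓡∂ n).interior M := by
  obtain ⟨ε, hε, δ, hδ, hδ0, hδi⟩ := exists_geodesic_of_interior g hi
  have h1 := (hδ.shift (-T)).mono (s' := Icc T (T + ε)) fun t ht => by
    simp only [mem_preimage, mem_Icc] at ht ⊢
    constructor <;> linarith [ht.1, ht.2]
  refine ⟨T + ε, by linarith, _, hβ.concat hT (by linarith) h1 ?_, fun t ht => ?_, fun t ht => ?_⟩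
  · simp [hδ0]
  · simp [ht.2]
  · simp only [not_le.2 ht.1, if_false]
    exact hδi _ ⟨by linarith [ht.1], by linarith [ht.2]⟩

/-! ### Scattering geodesics -/

/-- The geodesic that realizes the interior scattering relation. -/
structure IsScatteringGeodesic (g : LorentzMetric n M) (β : ℝ → TangentBundle (𝓡∂ n) M) (T : ℝ) :
    Prop where
  pos : 0 < T
  geodesic : IsGeodesicOn g β (Icc 0 T)
  interior : ∀ t ∈ Ioo 0 T, (β t).proj ∈ (𝓡∂ n).interior M
  boundary : (β T).proj ∈ (𝓡∂ n).boundary M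

theorem IsScatteringGeodesic.interiorScattering [T2Space M] {g : LorentzMetric n M}
    {β : ℝ → TangentBundle (𝓡∂ n) M} {T : ℝ} (h : IsScatteringGeodesic g β T)
    (h0 : β 0 ∈ inwardTM g) : InteriorScattering g (β 0) (β T) :=
  ⟨h0, T, interiorTravelTime_eq h.pos h.geodesic h.interior h.boundary, β, h.geodesic, rfl, rfl⟩

/-- The supremum is attained. Before `T` the geodesic is interior, by comparison with the
competitors in the supremum; and if its point at `T` were interior, an extension would be a longer
competitor. -/
theorem InteriorScattering.exists_geodesic [T2Space M] {g : LorentzMetric n M}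
    {ξ η : TangentBundle (𝓡∂ n) M} (h : InteriorScattering g ξ η) :
    ∃ β T, IsScatteringGeodesic g β T ∧ β 0 = ξ ∧ β T = η ∧ interiorTravelTime g ξ = T := by
  obtain ⟨hin, T, hτ, β, hβ, hβ0, hβT⟩ := h
  obtain ⟨ε, hε, γ, hγ, hγ0, hγi⟩ :=
    exists_geodesic_of_inward g (normalCoord_pos_of_mem_inwardTM hin)
  have hle : ∀ t : ℝ, 0 < t → (∃ β : ℝ → TangentBundle (𝓡∂ n) M, IsGeodesicOn g β (Ico 0 t) ∧
      β 0 = ξ ∧ ∀ r ∈ Ioo 0 t, (β r).proj ∈ (𝓡∂ n).interior M) → t ≤ T := fun t ht h => by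
    rw [← EReal.coe_le_coe_iff, ← hτ]
    exact le_sSup ⟨t, rfl, ht, h⟩
  have hT : 0 < T := hε.trans_le (hle ε hε ⟨γ, hγ.mono Ico_subset_Icc_self, hγ0,
    fun r hr => hγi r ⟨hr.1, hr.2.le⟩⟩)
  have hintr : ∀ t ∈ Ioo 0 T, (β t).proj ∈ (𝓡∂ n).interior M := fun t ht => by
    have h1 : (t : EReal) < interiorTravelTime g ξ := by
      rw [hτ, EReal.coe_lt_coe_iff]
      exact ht.2
    obtain ⟨_, ⟨s, rfl, hs, β', hβ', h0, hi⟩, hts⟩ := lt_sSup_iff.1 h1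
    rw [EReal.coe_lt_coe_iff] at hts
    have := (hβ'.mono (s' := Icc 0 t) fun r hr => ⟨hr.1, hr.2.trans_lt hts⟩).eqOn
      (hβ.mono (Icc_subset_Icc_right ht.2.le)) (h0.trans hβ0.symm) ⟨ht.1.le, le_rfl⟩
    exact this ▸ hi t ⟨ht.1, hts⟩
  refine ⟨β, T, ⟨hT, hβ, hintr, ?_⟩, hβ0, hβT, hτ⟩
  refine (mem_interior_or_boundary _).resolve_left fun hi => ?_
  obtain ⟨T', hT', γ, hγ, heq, hγi⟩ := hβ.exists_extension hT.le hi
  refine absurd (hle T' (hT.trans hT') ⟨γ, hγ.mono Ico_subset_Icc_self,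
    (heq ⟨le_rfl, hT.le⟩).trans hβ0, fun r hr => ?_⟩) (not_le.2 hT')
  rcases le_or_gt r T with h | h
  · rw [heq ⟨hr.1.le, h⟩]
    rcases eq_or_lt_of_le h with rfl | h
    · exact hi
    · exact hintr r ⟨hr.1, h⟩
  · exact hγi r ⟨h, hr.2.le⟩

theorem InteriorScattering.unique [T2Space M] {g : LorentzMetric n M}
    {ξ η η' : TangentBundle (𝓡∂ n) M} (h : InteriorScattering g ξ η)
    (h' : InteriorScattering g ξ η') : η = η' := by
  obtain ⟨β, T, hβ, h0, hT, hτ⟩ := h.exists_geodesic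
  obtain ⟨β', T', hβ', h0', hT', hτ'⟩ := h'.exists_geodesic
  obtain rfl : T = T' := EReal.coe_injective (hτ.symm.trans hτ')
  rw [← hT, ← hT']
  exact hβ.geodesic.eqOn hβ'.geodesic (h0.trans h0'.symm) ⟨hβ.pos.le, le_rfl⟩

/-- The boundary is closed, so there is a first positive time at which the geodesic meets it, and
that time is the travel time. -/
theorem IsNonTrapping.exists_interiorScattering [T2Space M] {g : LorentzMetric n M}
    {ξ : TangentBundle (𝓡∂ n) M} (hξ : ξ ∈ inwardTM g) (h : IsNonTrapping g ξ) :
    ∃ η, InteriorScattering g ξ η := by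
  obtain ⟨T₀, hT₀, ⟨β, hβ, rfl⟩, hmax⟩ := h
  obtain ⟨ε, hε, γ, hγ, hγ0, hγi⟩ :=
    exists_geodesic_of_inward g (normalCoord_pos_of_mem_inwardTM hξ)
  have hεT : ε ≤ T₀ := le_of_not_gt fun h => hmax ε h ⟨γ, hγ, hγ0⟩
  have heq := (hβ.mono (Icc_subset_Icc_right hεT)).eqOn hγ hγ0.symm
  have hclosed : IsClosed ((𝓡∂ n).boundary M) :=
    ModelWithCorners.isClosed_boundary (n := ∞) (by simp)
  -- Starting at `ε` excludes the initial boundary point at time `0`; up to `ε` the geodesic is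
  -- known to be interior.
  have hcomp : IsCompact (Icc ε T₀ ∩ (fun t => (β t).proj) ⁻¹' (𝓡∂ n).boundary M) :=
    (isCompact_Icc).of_isClosed_subset
      ((hβ.continuousOn.mono (Icc_subset_Icc_left hε.le)).preimage_isClosed_of_isClosed
        isClosed_Icc hclosed) inter_subset_left
  -- At the maximal time the point is on the boundary, since otherwise the geodesic could be
  -- extended.
  have hne : (Icc ε T₀ ∩ (fun t => (β t).proj) ⁻¹' (𝓡∂ n).boundary M).Nonempty := by
    refine ⟨T₀, ⟨hεT, le_rfl⟩, (mem_interior_or_boundary _).resolve_left fun hi => ?_⟩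
    obtain ⟨T', hT', γ, hγ, heq, -⟩ := hβ.exists_extension hT₀ hi
    exact hmax T' hT' ⟨γ, hγ, heq ⟨le_rfl, hT₀⟩⟩
  obtain ⟨T, ⟨hTI, hTb⟩, hleast⟩ := hcomp.exists_isLeast hne
  refine ⟨β T, IsScatteringGeodesic.interiorScattering ⟨hε.trans_le hTI.1,
    hβ.mono (Icc_subset_Icc_right hTI.2), fun t ht => ?_, hTb⟩ hξ⟩
  rcases le_or_gt t ε with h | h
  · rw [heq ⟨ht.1.le, h⟩]
    exact hγi t ⟨ht.1, h⟩
  · refine (mem_interior_or_boundary _).resolve_right fun hb => ?_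
    exact absurd (hleast ⟨⟨h.le, ht.2.le.trans hTI.2⟩, hb⟩) (not_le.2 ht.2)

/-! ### Continuous dependence on the initial vector -/

/-- The window has at most a quarter of the lifetime of the box on each side, so the flow started
anywhere in it covers the rest with time to spare. -/
theorem IsGeodesicOn.exists_window {g : LorentzMetric n M} {θ₀ : ℝ → TangentBundle (𝓡∂ n) M}
    {a b t : ℝ} (h₀ : IsGeodesicOn g θ₀ (Icc a b)) (ht : t ∈ Icc a b) {p : M}
    (hp : θ₀ t ∈ (tchart p).source) {N : Set (Vec n × Vec n)} (hN : N ∈ 𝓝 (tchart p (θ₀ t))) :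
    ∃ B : FlowBox g p (tchart p (θ₀ t)), closedBall (tchart p (θ₀ t)) B.a ⊆ N ∧
      ∃ δ > 0, δ ≤ B.ε / 4 ∧ ∀ r ∈ Icc a b, |r - t| < δ → θ₀ r ∈ (tchart p).source ∧
        tchart p (θ₀ r) ∈ ball (tchart p (θ₀ t)) B.r := by
  obtain ⟨B, hB⟩ := exists_flowBox g (tchart_mem_target hp) hN
  have h3 : ∀ᶠ r in 𝓝[Icc a b] t, θ₀ r ∈ (tchart p).source ∧
      tchart p (θ₀ r) ∈ ball (tchart p (θ₀ t)) B.r :=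
    (h₀.eventually_mem_source ht hp).and
      ((h₀.hasDerivWithinAt ht hp).continuousWithinAt (ball_mem_nhds _ B.r_pos))
  obtain ⟨δ, hδ, hall⟩ := Metric.mem_nhdsWithin_iff.1 h3
  refine ⟨B, hB, min δ (B.ε / 4), lt_min hδ (by linarith [B.ε_pos]), min_le_right _ _,
    fun r hr hrt => hall ⟨?_, hr⟩⟩
  rw [Metric.mem_ball, Real.dist_eq]
  exact hrt.trans_le (min_le_left _ _)

/-- Inside one flow box all nearby geodesics are given by the jointly continuous flow. The final
times are allowed to vary because arrival times do. -/
theorem IsGeodesicOn.tendsto_of_window [T2Space M] {g : LorentzMetric n M}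
    {θ₀ : ℝ → TangentBundle (𝓡∂ n) M} {a b t : ℝ} (h₀ : IsGeodesicOn g θ₀ (Icc a b))
    (ht : t ∈ Icc a b) {ι : Type*} (F : Filter ι) (θ : ι → ℝ → TangentBundle (𝓡∂ n) M) :
    ∃ δ > 0, ∀ r ∈ Icc a b, |r - t| < δ → ∀ s ∈ Icc a b, r ≤ s → |s - t| < δ → ∀ σ : ι → ℝ,
      Filter.Tendsto σ F (𝓝 s) →
      (∀ᶠ i in F, r ≤ σ i ∧ IsGeodesicOn g (θ i) (Icc r (σ i))) →
      Filter.Tendsto (fun i => θ i r) F (𝓝 (θ₀ r)) →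
      Filter.Tendsto (fun i => θ i (σ i)) F (𝓝 (θ₀ s)) := by
  have hp := self_mem_tchart_source (θ₀ t)
  set p := (θ₀ t).proj
  obtain ⟨B, -, δ, hδ, hδε, hw⟩ := h₀.exists_window ht hp Filter.univ_mem
  have hε := B.ε_pos
  refine ⟨δ, hδ, fun r hr hrt s hs hrs hst σ hσ hθ hlim => ?_⟩
  have e1 := abs_lt.1 hrt
  have e2 := abs_lt.1 hst
  obtain ⟨hr1, hr2⟩ := hw r hr hrt
  have hsrc := mem_nhds_iff.2 ⟨_, Subset.rfl, isOpen_tchart_source (n := n) p, hr1⟩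
  have hlimz := (tendsto_tchart hr1).comp hlim
  have h0s := B.eq_flow (h₀.mono (Icc_subset_Icc hr.1 hs.2)) (by linarith) hr1
    (ball_subset_closedBall hr2) s ⟨hrs, le_rfl⟩
  have hcont : ContinuousWithinAt (fun x : (Vec n × Vec n) × ℝ => B.flow x.1 x.2)
      (closedBall (tchart p (θ₀ t)) B.r ×ˢ Icc (-B.ε) B.ε) (tchart p (θ₀ r), s - r) :=
    B.continuousOn _ ⟨ball_subset_closedBall hr2, by constructor <;> linarith⟩
  have hσ' : ∀ᶠ i in F, σ i < r + B.ε :=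
    hσ (Iio_mem_nhds (by linarith))
  have hball := hlimz (isOpen_ball.mem_nhds hr2)
  have htend : Filter.Tendsto (fun i => (tchart p (θ i r), σ i - r)) F
      (𝓝[closedBall (tchart p (θ₀ t)) B.r ×ˢ Icc (-B.ε) B.ε] (tchart p (θ₀ r), s - r)) := by
    refine tendsto_nhdsWithin_iff.2 ⟨hlimz.prodMk_nhds (hσ.sub_const r), ?_⟩
    filter_upwards [hball, hσ', hθ] with i h1 h2 h3
    exact ⟨ball_subset_closedBall h1, by constructor <;> linarith [h3.1]⟩
  have hflow := hcont.tendsto.comp htend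
  rw [← h0s.2] at hflow
  have hsymm := (continuousAt_tchart_symm h0s.1).tendsto.comp hflow
  rw [(tchart p).left_inv h0s.1] at hsymm
  refine hsymm.congr' ?_
  filter_upwards [hball, hσ', hθ, hlim hsrc] with i h1 h2 h3 h4
  have := B.eq_flow h3.2 h2.le h4 (ball_subset_closedBall h1) (σ i) ⟨h3.1, le_rfl⟩
  simp only [Function.comp_apply]
  rw [← this.2, (tchart p).left_inv this.1]

/-- Geodesics depend continuously on their initial vectors. -/
theorem IsGeodesicOn.tendsto_of_tendsto [T2Space M] {g : LorentzMetric n M}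
    {θ₀ : ℝ → TangentBundle (𝓡∂ n) M} {a b s : ℝ} (h₀ : IsGeodesicOn g θ₀ (Icc a b))
    (hs : s ∈ Icc a b) {ι : Type*} {F : Filter ι} {θ : ι → ℝ → TangentBundle (𝓡∂ n) M}
    {σ : ι → ℝ} (hσ : Filter.Tendsto σ F (𝓝 s))
    (hθ : ∀ᶠ i in F, a ≤ σ i ∧ IsGeodesicOn g (θ i) (Icc a (σ i)))
    (hlim : Filter.Tendsto (fun i => θ i a) F (𝓝 (θ₀ a))) :
    Filter.Tendsto (fun i => θ i (σ i)) F (𝓝 (θ₀ s)) := by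
  obtain ⟨δ, hδ, hw⟩ := h₀.tendsto_of_window hs F θ
  -- The varying final time is confined to the last window; up to `r` the convergence is propagated
  -- at fixed times.
  set r := max a (s - δ / 2)
  have hra : a ≤ r := le_max_left _ _
  have hrs : r ≤ s := max_le hs.1 (by linarith)
  have hrI : r ∈ Icc a b := ⟨hra, hrs.trans hs.2⟩
  have hrσ : ∀ᶠ i in F, r ≤ σ i := by
    rcases eq_or_lt_of_le hs.1 with h | h
    · filter_upwards [hθ] with i hi
      exact (max_le le_rfl (by linarith)).trans hi.1
    · have hlt : r < s := max_lt h (by linarith)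
      filter_upwards [hσ (Ioi_mem_nhds hlt)] with i hi using le_of_lt hi
  refine hw r hrI (abs_lt.2 ⟨by linarith [le_max_right a (s - δ / 2)], by linarith⟩) s hs hrs
    (by simpa using hδ) σ hσ ?_ ?_
  · filter_upwards [hθ, hrσ] with i h1 h2
    exact ⟨h2, h1.2.mono (Icc_subset_Icc_left hra)⟩
  · refine rel_of_locally_rel (P := fun u v => Filter.Tendsto (fun i => θ i u) F (𝓝 (θ₀ u)) →
      Filter.Tendsto (fun i => θ i v) F (𝓝 (θ₀ v))) hra (fun _ _ h => h)
      (fun _ _ _ _ _ _ _ _ h1 h2 h => h2 (h1 h)) (fun t ht => ?_) hlim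
    have hsub : Icc a r ⊆ Icc a b := Icc_subset_Icc_right hrI.2
    obtain ⟨δ', hδ', hw'⟩ := h₀.tendsto_of_window (hsub ht) F θ
    refine ⟨δ', hδ', fun u hu v hv huv hut hvt => ?_⟩
    refine hw' u (hsub hu) hut v (hsub hv) huv hvt (fun _ => v) tendsto_const_nhds ?_
    filter_upwards [hθ, hrσ] with i h1 h2
    exact ⟨huv, h1.2.mono (Icc_subset_Icc hu.1 (hv.2.trans h2))⟩

/-- The curves of a convergent family stay near the limit close to the final time. -/
theorem IsGeodesicOn.eventually_near_end [T2Space M] {g : LorentzMetric n M}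
    {θ₀ : ℝ → TangentBundle (𝓡∂ n) M} {b : ℝ} (hb : 0 < b) (h₀ : IsGeodesicOn g θ₀ (Icc 0 b))
    {ι : Type*} {F : Filter ι} {θ : ι → ℝ → TangentBundle (𝓡∂ n) M} {σ : ι → ℝ}
    (hσ : Filter.Tendsto σ F (𝓝 b)) (hθ : ∀ᶠ i in F, IsGeodesicOn g (θ i) (Icc 0 (σ i)))
    (hlim : Filter.Tendsto (fun i => θ i 0) F (𝓝 (θ₀ 0))) {p : M}
    (hp : θ₀ b ∈ (tchart p).source) {N : Set (Vec n × Vec n)} (hN : N ∈ 𝓝 (tchart p (θ₀ b))) :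
    ∃ r ∈ Ico 0 b, ∀ᶠ i in F, ∀ t ∈ Icc r (σ i), θ i t ∈ (tchart p).source ∧
      tchart p (θ i t) ∈ N := by
  obtain ⟨B, hBN, δ, hδ, hδε, hw⟩ := h₀.exists_window ⟨hb.le, le_rfl⟩ hp hN
  have hε := B.ε_pos
  set r := max 0 (b - δ / 2)
  have hr0 : 0 ≤ r := le_max_left _ _
  have hrb : r < b := max_lt hb (by linarith)
  have hrb' : b - δ / 2 ≤ r := le_max_right _ _
  obtain ⟨hr1, hr2⟩ := hw r ⟨hr0, hrb.le⟩ (abs_lt.2 ⟨by linarith, by linarith⟩)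
  refine ⟨r, ⟨hr0, hrb⟩, ?_⟩
  have hrσ : ∀ᶠ i in F, r < σ i := hσ (Ioi_mem_nhds hrb)
  have hlimr : Filter.Tendsto (fun i => θ i r) F (𝓝 (θ₀ r)) := by
    refine h₀.tendsto_of_tendsto (σ := fun _ => r) ⟨hr0, hrb.le⟩ tendsto_const_nhds ?_ hlim
    filter_upwards [hθ, hrσ] with i h1 h2
    exact ⟨hr0, h1.mono (Icc_subset_Icc_right h2.le)⟩
  filter_upwards [hθ, hrσ, hlimr ((isOpen_tchart_source p).mem_nhds hr1),
    (tendsto_tchart hr1).comp hlimr (isOpen_ball.mem_nhds hr2),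
    hσ (Iio_mem_nhds (show b < b + δ by linarith))] with i h1 h2 h3 h4 h5 t ht
  have h5 : σ i < b + δ := h5
  have hball : tchart p (θ i r) ∈ closedBall (tchart p (θ₀ b)) B.r := ball_subset_closedBall h4
  have := B.eq_flow (h1.mono (Icc_subset_Icc_left hr0)) (by linarith) h3 hball t ht
  refine ⟨this.1, hBN ?_⟩
  rw [this.2]
  exact B.mem _ hball _ (by constructor <;> linarith [ht.1, ht.2])

/-! ### Differentiable dependence on the initial vector -/

theorem contDiffWithinAt_chart_change {p q r : M} (hp : r ∈ (extChartAt (𝓡∂ n) p).source)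
    (hq : r ∈ (extChartAt (𝓡∂ n) q).source) :
    ContDiffWithinAt ℝ ∞ (extChartAt (𝓡∂ n) q ∘ (extChartAt (𝓡∂ n) p).symm)
      (range (𝓡∂ n)) (extChartAt (𝓡∂ n) p r) := by
  apply contDiffWithinAt_ext_coord_change
  rw [PartialEquiv.trans_source'', PartialEquiv.symm_symm, PartialEquiv.symm_target]
  exact mem_image_of_mem _ ⟨hp, hq⟩

/-- The first variation of a family of tangent vectors in different charts. -/
theorem exists_hasDerivWithinAt_tchart (g : LorentzMetric n M) {p q : M}
    {ξ : ℝ → TangentBundle (𝓡∂ n) M} {s : Set ℝ} {t : ℝ}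
    (hp : ξ t ∈ (tchart p).source) (hq : ξ t ∈ (tchart q).source)
    (hev : ∀ᶠ l in 𝓝[s] t, ξ l ∈ (tchart p).source) {J : Vec n × Vec n}
    (h : HasDerivWithinAt (fun l => tchart p (ξ l)) J s t) :
    (∀ᶠ l in 𝓝[s] t, ξ l ∈ (tchart q).source) ∧
    ∃ J' : Vec n × Vec n, HasDerivWithinAt (fun l => tchart q (ξ l)) J' s t ∧
      metricForm g q (tchart q (ξ t)).1 J'.1 (tchart q (ξ t)).2 =
        metricForm g p (tchart p (ξ t)).1 J.1 (tchart p (ξ t)).2 := by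
  have hp' := mem_tchart_source.1 hp
  have hq' := mem_tchart_source.1 hq
  have hcont : ContinuousWithinAt (fun l => (tchart p).symm (tchart p (ξ l))) s t :=
    (continuousAt_tchart_symm hp).tendsto.comp h.continuousWithinAt
  have hev' : ∀ᶠ l in 𝓝[s] t, ξ l ∈ (tchart q).source := by
    have h1 : ∀ᶠ l in 𝓝[s] t, (tchart p).symm (tchart p (ξ l)) ∈ (tchart q).source :=
      hcont ((isOpen_tchart_source q).mem_nhds (by
        simp only [(tchart p).left_inv hp]
        exact hq))
    filter_upwards [h1, hev] with l h1 h2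
    rwa [(tchart p).left_inv h2] at h1
  refine ⟨hev', ?_⟩
  set ψ := extChartAt (𝓡∂ n) q ∘ (extChartAt (𝓡∂ n) p).symm
  set H := range (𝓡∂ n)
  have hψ : ContDiffWithinAt ℝ ∞ ψ H (tchart p (ξ t)).1 := contDiffWithinAt_chart_change hp' hq'
  have hψd : HasFDerivWithinAt ψ (fderivWithin ℝ ψ H (tchart p (ξ t)).1) H (tchart p (ξ t)).1 :=
    (hψ.differentiableWithinAt (by simp)).hasFDerivWithinAt
  have hP : HasFDerivWithinAt (fderivWithin ℝ ψ H)
      (fderivWithin ℝ (fderivWithin ℝ ψ H) H (tchart p (ξ t)).1) H (tchart p (ξ t)).1 :=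
    ((hψ.fderivWithin_right (m := 1) (𝓡∂ n).uniqueDiffOn (by norm_cast)
      (mem_range_self _)).differentiableWithinAt (by simp)).hasFDerivWithinAt
  have hmem : ∀ᶠ l in 𝓝[s] t, (tchart p (ξ l)).1 ∈ H :=
    Filter.Eventually.of_forall fun l => mem_range_self _
  have hz : HasDerivWithinAt (fun l => (tchart p (ξ l)).1) J.1 s t := h.fst
  have hv : HasDerivWithinAt (fun l => (tchart p (ξ l)).2) J.2 s t := h.snd
  have h1 := hasDerivWithinAt_comp_of_eventually_mem hψd hz hmem
  have h2 := (hasDerivWithinAt_comp_of_eventually_mem hP hz hmem).clm_apply hv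
  refine ⟨_, (h1.prodMk h2).congr_of_eventuallyEq (f₁ := fun l => tchart q (ξ l)) ?_
    (tchart_change hp hq), ?_⟩
  · filter_upwards [hev, hev'] with l h1 h2
    exact tchart_change h1 h2
  · have h3 := metricForm_change g hp' hq' J.1 (tchart p (ξ t)).2
    have h4 : (tchart q (ξ t)).2 = tangentCoordChange (𝓡∂ n) p q (ξ t).proj (tchart p (ξ t)).2 := by
      rw [tchart_change hp hq]
      rfl
    rw [h4]
    exact h3.symm

/-- Geodesics of `M` stay in the half space, so first order estimates can be made on this compact
convex set. There the geodesic field itself is available, instead of an extension that is only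
locally Lipschitz. -/
theorem isCompact_closedBall_inter_half (ζ₀ : Vec n × Vec n) (a : ℝ) :
    IsCompact (closedBall ζ₀ a ∩ {ζ : Vec n × Vec n | 0 ≤ ζ.1 0}) :=
  (isCompact_closedBall ζ₀ a).inter_right (isClosed_le continuous_const
    ((EuclideanSpace.proj (𝕜 := ℝ) (0 : Fin n)).continuous.comp continuous_fst))

theorem convex_closedBall_inter_half (ζ₀ : Vec n × Vec n) (a : ℝ) :
    Convex ℝ (closedBall ζ₀ a ∩ {ζ : Vec n × Vec n | 0 ≤ ζ.1 0}) :=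
  (convex_closedBall ζ₀ a).inter (convex_halfSpace_ge
    (((EuclideanSpace.proj (𝕜 := ℝ) (0 : Fin n)).toLinearMap.comp
      (LinearMap.fst ℝ (Vec n) (Vec n))).isLinear) 0)

/-- The linearised equation thus makes the second component of a variation field the derivative of
the first. -/
theorem fderivWithin_geodesicField_fst (g : LorentzMetric n M) {p : M} {ζ : Vec n × Vec n}
    (hζ : ζ ∈ (extChartAt (𝓡∂ n) p).target ×ˢ (univ : Set (Vec n))) (x : Vec n × Vec n) :
    (fderivWithin ℝ (geodesicField g p) ((extChartAt (𝓡∂ n) p).target ×ˢ univ) ζ x).1 = x.2 := by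
  have hu : UniqueDiffWithinAt ℝ ((extChartAt (𝓡∂ n) p).target ×ˢ (univ : Set (Vec n))) ζ :=
    (uniqueDiffOn_extChartAt_target (I := 𝓡∂ n) p).prod uniqueDiffOn_univ ζ hζ
  have h1 := ((contDiffOn_geodesicField g p).differentiableOn (by simp) ζ hζ).hasFDerivWithinAt
  have h2 : HasFDerivWithinAt (fun ζ => (geodesicField g p ζ).1) _
    ((extChartAt (𝓡∂ n) p).target ×ˢ (univ : Set (Vec n))) ζ := h1.fst
  have h3 : HasFDerivWithinAt (fun ζ => (geodesicField g p ζ).1)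
      (ContinuousLinearMap.snd ℝ (Vec n) (Vec n))
      ((extChartAt (𝓡∂ n) p).target ×ˢ (univ : Set (Vec n))) ζ := hasFDerivWithinAt_snd
  exact congrArg (fun L : Vec n × Vec n →L[ℝ] Vec n => L x) (hu.eq h2 h3)

/-- Propagation of the first variation of a family of geodesics through a short time interval. -/
theorem IsGeodesicOn.exists_firstVariation [T2Space M] {g : LorentzMetric n M}
    {θ : ℝ → ℝ → TangentBundle (𝓡∂ n) M} {a b t : ℝ} (h₀ : IsGeodesicOn g (θ 0) (Icc a b))
    (ht : t ∈ Icc a b) {p : M} (hp : θ 0 t ∈ (tchart p).source) :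
    ∃ δ > 0, (∀ r ∈ Icc a b, |r - t| < δ → θ 0 r ∈ (tchart p).source) ∧
      ∀ r ∈ Icc a b, |r - t| < δ → ∀ s ∈ Icc a b, r ≤ s → |s - t| < δ → ∀ σ : ℝ → ℝ,
      (∀ᶠ l in 𝓝[>] 0, σ l ≤ s ∧ IsGeodesicOn g (θ l) (Icc r (σ l))) →
      ∀ J₀ : Vec n × Vec n, (∀ᶠ l in 𝓝[>] 0, θ l r ∈ (tchart p).source) →
      HasDerivWithinAt (fun l => tchart p (θ l r)) J₀ (Ioi 0) 0 →
      ∃ J : ℝ → Vec n × Vec n, J r = J₀ ∧ ContinuousOn J (Icc r s) ∧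
        (∀ τ ∈ Icc r s, HasDerivWithinAt (fun τ => (J τ).1) (J τ).2 (Icc r s) τ) ∧
        ∀ η > 0, ∀ᶠ l in 𝓝[>] 0, ∀ τ ∈ Icc r (σ l), θ l τ ∈ (tchart p).source ∧
          ‖tchart p (θ l τ) - tchart p (θ 0 τ) - l • J τ‖ ≤ η * |l| := by
  have hwin := h₀.exists_window ht hp Filter.univ_mem
  set ζ₀ := tchart p (θ 0 t)
  obtain ⟨B, -, δ, hδ, hδε, hw⟩ := hwin
  have hε := B.ε_pos
  set S := closedBall ζ₀ B.a ∩ {ζ : Vec n × Vec n | 0 ≤ ζ.1 0} with hS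
  set D := (extChartAt (𝓡∂ n) p).target ×ˢ (univ : Set (Vec n)) with hD
  have hSD : S ⊆ D := fun ζ hζ => ⟨mem_tchart_target.1 (B.target ζ hζ.1 hζ.2), trivial⟩
  have hcS : IsCompact S := isCompact_closedBall_inter_half _ _
  have hf : ∀ ζ ∈ S, HasFDerivWithinAt (geodesicField g p)
      (fderivWithin ℝ (geodesicField g p) D ζ) S ζ := fun ζ hζ =>
    (((contDiffOn_geodesicField g p).differentiableOn (by simp) ζ
      (hSD hζ)).hasFDerivWithinAt).mono hSD
  have hf' : ContinuousOn (fderivWithin ℝ (geodesicField g p) D) S :=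
    ((contDiffOn_geodesicField g p).continuousOn_fderivWithin
      ((uniqueDiffOn_extChartAt_target (I := 𝓡∂ n) p).prod uniqueDiffOn_univ) (by simp)).mono hSD
  obtain ⟨C, hC⟩ := hcS.exists_bound_of_continuousOn hf'
  set L : NNReal := ⟨max C 0, le_max_right _ _⟩
  have hL : ∀ ζ ∈ S, ‖fderivWithin ℝ (geodesicField g p) D ζ‖ ≤ L := fun ζ hζ =>
    (hC ζ hζ).trans (le_max_left _ _)
  have hL1 : (0 : ℝ) < 4 * (L + 1) := by positivity
  -- The second bound makes the window so short that the linearised equation is solvable across it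
  -- by `exists_linearODE`.
  refine ⟨min δ (1 / (4 * (L + 1))), lt_min hδ (by positivity),
    fun r hr hrt => (hw r hr (hrt.trans_le (min_le_left _ _))).1,
    fun r hr hrt s hs hrs hst σ hσ J₀ hsrc hJ₀ => ?_⟩
  have e1 := abs_lt.1 (hrt.trans_le (min_le_left _ _))
  have e2 := abs_lt.1 (hst.trans_le (min_le_left _ _))
  have e3 := abs_lt.1 (hrt.trans_le (min_le_right _ _))
  have e4 := abs_lt.1 (hst.trans_le (min_le_right _ _))
  have hsub : Icc r s ⊆ Icc a b := Icc_subset_Icc hr.1 hs.2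
  obtain ⟨hr1, hr2⟩ := hw r hr (hrt.trans_le (min_le_left _ _))
  have hmem : ∀ {θ' : ℝ → TangentBundle (𝓡∂ n) M} {s' : ℝ}, s' ≤ s →
      IsGeodesicOn g θ' (Icc r s') → θ' r ∈ (tchart p).source →
      tchart p (θ' r) ∈ ball ζ₀ B.r → ∀ τ ∈ Icc r s', θ' τ ∈ (tchart p).source ∧
        tchart p (θ' τ) ∈ S := fun {θ' s'} hs' h h1 h2 τ hτ => by
    have h3 := B.eq_flow h (by linarith) h1 (ball_subset_closedBall h2) τ hτ
    refine ⟨h3.1, ?_, extChartAt_apply_zero_nonneg _ _⟩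
    rw [h3.2]
    exact B.mem _ (ball_subset_closedBall h2) _ (by constructor <;> linarith [hτ.1, hτ.2])
  have h0mem := hmem le_rfl (h₀.mono hsub) hr1 hr2
  have hz₀ : ∀ τ ∈ Icc r s, HasDerivWithinAt (fun τ => tchart p (θ 0 τ))
      (geodesicField g p (tchart p (θ 0 τ))) (Icc r s) τ := fun τ hτ =>
    (h₀.mono hsub).hasDerivWithinAt hτ (h0mem τ hτ).1
  obtain ⟨J, hJr, hJ⟩ := exists_linearODE
    (A := fun τ => fderivWithin ℝ (geodesicField g p) D (tchart p (θ 0 τ))) hrs (L := L)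
    (hf'.comp (HasDerivWithinAt.continuousOn hz₀) fun τ hτ => (h0mem τ hτ).2)
    (fun τ hτ => hL _ (h0mem τ hτ).2) (by
      have h1 : s - r ≤ 2 * (1 / (4 * (L + 1))) := by linarith
      have h2 : (L : ℝ) * (2 * (1 / (4 * (L + 1)))) ≤ 1 / 2 := by
        rw [mul_one_div, ← mul_div_assoc, div_le_iff₀ hL1]
        linarith
      exact (mul_le_mul_of_nonneg_left h1 L.2).trans h2) J₀
  have hcz : ContinuousWithinAt (fun l => tchart p (θ l r)) (Ioi 0) 0 := hJ₀.continuousWithinAt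
  have hballev : ∀ᶠ l in 𝓝[>] 0, tchart p (θ l r) ∈ ball ζ₀ B.r :=
    hcz (isOpen_ball.mem_nhds hr2)
  have hall : ∀ᶠ l in 𝓝[>] 0, ∀ τ ∈ Icc r (σ l), θ l τ ∈ (tchart p).source ∧
      tchart p (θ l τ) ∈ S := by
    filter_upwards [hσ, hsrc, hballev] with l h1 h2 h3
    exact hmem h1.1 h1.2 h2 h3
  refine ⟨J, hJr, HasDerivWithinAt.continuousOn hJ, fun τ hτ => ?_, fun η hη => ?_⟩
  · have h1 : HasDerivWithinAt (fun τ => (J τ).1) _ (Icc r s) τ := (hJ τ hτ).fst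
    rwa [fderivWithin_geodesicField_fst g (hSD (h0mem τ hτ).2)] at h1
  · have hinit : ∀ η > 0, ∀ᶠ l in 𝓝[>] 0,
        ‖tchart p (θ l r) - tchart p (θ 0 r) - l • J r‖ ≤ η * |l| := fun η hη => by
      have h1 := (hasDerivWithinAt_iff_isLittleO.1 hJ₀).def hη
      filter_upwards [h1] with l hl
      rw [hJr]
      simpa using hl
    have hcomb := flow_first_order (c := fun l : ℝ => l) (bi := σ)
      (z := fun l τ => tchart p (θ l τ)) hcS (convex_closedBall_inter_half _ _) hf hf' hz₀
      (fun τ hτ => (h0mem τ hτ).2) hJ (Filter.tendsto_id.mono_left nhdsWithin_le_nhds)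
      (hσ.mono fun l hl => hl.1)
      (by
        filter_upwards [hσ, hall] with l h1 h2 τ hτ
        exact h1.2.hasDerivWithinAt hτ (h2 τ hτ).1)
      (hall.mono fun l hl τ hτ => (hl τ hτ).2) hinit hη
    filter_upwards [hcomb, hall] with l h1 h2 τ hτ
    exact ⟨(h2 τ hτ).1, h1 τ hτ⟩

/-- The product of the first variation with the velocity is affine in time. -/
theorem firstVariation_inner {g : LorentzMetric n M} {θ : ℝ → ℝ → TangentBundle (𝓡∂ n) M}
    {r s e : ℝ} (h₀ : IsGeodesicOn g (θ 0) (Icc r s)) {p : M}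
    (hsrc : ∀ τ ∈ Icc r s, θ 0 τ ∈ (tchart p).source) {J : ℝ → Vec n × Vec n}
    (hJ : ∀ τ ∈ Icc r s, HasDerivWithinAt (fun τ => (J τ).1) (J τ).2 (Icc r s) τ)
    (hvar : ∀ τ ∈ Ico r s, HasDerivWithinAt (fun l => tchart p (θ l τ)) (J τ) (Ioi 0) 0)
    (hsq : ∀ τ ∈ Ico r s, ∀ᶠ l in 𝓝[>] 0, θ l τ ∈ (tchart p).source ∧
      g.sq (θ l τ) = g.sq (θ l r))
    (he : HasDerivWithinAt (fun l => g.sq (θ l r)) e (Ioi 0) 0) {τ : ℝ} (hτ : τ ∈ Icc r s) :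
    metricForm g p (tchart p (θ 0 τ)).1 (J τ).1 (tchart p (θ 0 τ)).2 =
      metricForm g p (tchart p (θ 0 r)).1 (J r).1 (tchart p (θ 0 r)).2 + e / 2 * (τ - r) := by
  -- The geodesic equation tested against `J` removes the acceleration and all coefficient
  -- derivatives except the one along `J`. In invariant terms this is `g(∇J, γ')`.
  have hder : ∀ τ ∈ Icc r s, HasDerivWithinAt
      (fun τ => metricForm g p (tchart p (θ 0 τ)).1 (J τ).1 (tchart p (θ 0 τ)).2)
      (1 / 2 * formDeriv (metricForm g p) (range (𝓡∂ n)) (tchart p (θ 0 τ)).1 (J τ).1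
        (tchart p (θ 0 τ)).2 (tchart p (θ 0 τ)).2 +
        metricForm g p (tchart p (θ 0 τ)).1 (J τ).2 (tchart p (θ 0 τ)).2) (Icc r s) τ := by
    intro τ hτ
    have hT := mem_tchart_target.1 (tchart_mem_target (hsrc τ hτ))
    have hd := h₀.hasDerivWithinAt hτ (hsrc τ hτ)
    have hz : HasDerivWithinAt (fun r => (tchart p (θ 0 r)).1) (tchart p (θ 0 τ)).2 (Icc r s) τ :=
      hd.fst
    have hv : HasDerivWithinAt (fun r => (tchart p (θ 0 r)).2)
      (geodesicField g p (tchart p (θ 0 τ))).2 (Icc r s) τ := hd.snd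
    have h1 := hasDerivWithinAt_form_apply (differentiableWithinAt_metricForm g hT) hz (hJ τ hτ) hv
      (Filter.Eventually.of_forall fun r => mem_range_self _)
    have h2 := (eq_spray_snd_iff (A := metricForm g p) (H := range (𝓡∂ n))
      (v := (tchart p (θ 0 τ)).2) (metricForm_isInvertible g hT)).1 rfl (J τ).1
    rw [christoffelForm_apply] at h2
    convert h1 using 1
    rw [metricForm_symm g p _ (J τ).1 (geodesicField g p (tchart p (θ 0 τ))).2,
      formDeriv_metricForm_symm g hT (tchart p (θ 0 τ)).2 (J τ).1]
    have : (geodesicField g p (tchart p (θ 0 τ))).2 = (spray (metricForm g p) (range (𝓡∂ n))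
      ((tchart p (θ 0 τ)).1, (tchart p (θ 0 τ)).2)).2 := rfl
    rw [this]
    linarith
  -- The same expression is half the `l`-derivative of the scalar square at time `τ`, which by
  -- conservation equals its value `e / 2` at time `r`.
  have hval : ∀ τ ∈ Ico r s, 1 / 2 * formDeriv (metricForm g p) (range (𝓡∂ n))
        (tchart p (θ 0 τ)).1 (J τ).1 (tchart p (θ 0 τ)).2 (tchart p (θ 0 τ)).2 +
        metricForm g p (tchart p (θ 0 τ)).1 (J τ).2 (tchart p (θ 0 τ)).2 = e / 2 := by
    intro τ hτ
    have hτ' := Ico_subset_Icc_self hτ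
    have hT := mem_tchart_target.1 (tchart_mem_target (hsrc τ hτ'))
    have hz : HasDerivWithinAt (fun l => (tchart p (θ l τ)).1) (J τ).1 (Ioi 0) 0 :=
      (hvar τ hτ).fst
    have hv : HasDerivWithinAt (fun l => (tchart p (θ l τ)).2) (J τ).2 (Ioi 0) 0 :=
      (hvar τ hτ).snd
    have h1 := hasDerivWithinAt_form_apply (differentiableWithinAt_metricForm g hT) hz hv hv
      (Filter.Eventually.of_forall fun r => mem_range_self _)
    have h2 : HasDerivWithinAt (fun l => g.sq (θ l τ)) e (Ioi 0) 0 :=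
      he.congr_of_eventuallyEq ((hsq τ hτ).mono fun l hl => hl.2)
        (h₀.mono (Icc_subset_Icc_right hτ.2.le) |>.sq_eq ⟨hτ.1, le_rfl⟩)
    have h3 := h1.congr_of_eventuallyEq (f₁ := fun l => g.sq (θ l τ))
      ((hsq τ hτ).mono fun l hl => sq_eq_metricForm g hl.1) (sq_eq_metricForm g (hsrc τ hτ'))
    have h4 := (uniqueDiffWithinAt_Ioi (0 : ℝ)).eq_deriv _ h2 h3
    rw [metricForm_symm g p _ (tchart p (θ 0 τ)).2 (J τ).2] at h4
    linarith
  -- Right derivatives and continuity suffice. So the variation is needed only before `s`, since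
  -- perturbed geodesics may already have ended at time `s`.
  have hconst := constant_of_has_deriv_right_zero (f := fun τ =>
    metricForm g p (tchart p (θ 0 τ)).1 (J τ).1 (tchart p (θ 0 τ)).2 - e / 2 * (τ - r))
    (a := r) (b := s) ?_ (fun τ hτ => ?_) τ hτ
  · simp only [sub_self, mul_zero, sub_zero] at hconst
    linarith
  · exact (HasDerivWithinAt.continuousOn hder).sub (by fun_prop)
  · have h1 := hder τ (Ico_subset_Icc_self hτ)
    rw [hval τ hτ] at h1
    have h2 := h1.sub ((((hasDerivAt_id τ).sub_const r).const_mul (e / 2)).hasDerivWithinAt)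
    rw [mul_one, sub_self] at h2
    exact hasDerivWithinAt_Ici_of_Icc h2 hτ

/-- A family of tangent vectors is differentiable from the right at `0`, and the product of its
horizontal derivative with the vector at `0` is `κ`. -/
def HasVariation (g : LorentzMetric n M) (ξ : ℝ → TangentBundle (𝓡∂ n) M) (κ : ℝ) : Prop :=
  ∀ p, ξ 0 ∈ (tchart p).source → (∀ᶠ l in 𝓝[>] 0, ξ l ∈ (tchart p).source) ∧
    ∃ J : Vec n × Vec n, HasDerivWithinAt (fun l => tchart p (ξ l)) J (Ioi 0) 0 ∧
      metricForm g p (tchart p (ξ 0)).1 J.1 (tchart p (ξ 0)).2 = κ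

theorem hasVariation_of_chart {g : LorentzMetric n M} {ξ : ℝ → TangentBundle (𝓡∂ n) M} {κ : ℝ}
    {p : M} (hp : ξ 0 ∈ (tchart p).source) (hev : ∀ᶠ l in 𝓝[>] 0, ξ l ∈ (tchart p).source)
    {J : Vec n × Vec n} (hJ : HasDerivWithinAt (fun l => tchart p (ξ l)) J (Ioi 0) 0)
    (hκ : metricForm g p (tchart p (ξ 0)).1 J.1 (tchart p (ξ 0)).2 = κ) : HasVariation g ξ κ := by
  intro q hq
  obtain ⟨h1, J', hJ', h2⟩ := exists_hasDerivWithinAt_tchart g hp hq hev hJ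
  exact ⟨h1, J', hJ', h2.trans hκ⟩

theorem HasVariation.tendsto {g : LorentzMetric n M} {ξ : ℝ → TangentBundle (𝓡∂ n) M} {κ : ℝ}
    (h : HasVariation g ξ κ) : Filter.Tendsto ξ (𝓝[>] 0) (𝓝 (ξ 0)) := by
  have hs := self_mem_tchart_source (ξ 0)
  obtain ⟨h1, J, hJ, -⟩ := h _ hs
  have h2 := (continuousAt_tchart_symm hs).tendsto.comp hJ.continuousWithinAt
  rw [(tchart _).left_inv hs] at h2
  refine h2.congr' ?_
  filter_upwards [h1] with l hl using (tchart _).left_inv hl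

theorem hasDerivWithinAt_Ioi_of_forall_eventually {E : Type*} [NormedAddCommGroup E]
    [NormedSpace ℝ E] {f : ℝ → E} {f' : E}
    (h : ∀ η > 0, ∀ᶠ l in 𝓝[>] 0, ‖f l - f 0 - l • f'‖ ≤ η * |l|) :
    HasDerivWithinAt f f' (Ioi 0) 0 := by
  refine hasDerivWithinAt_iff_isLittleO.2 (Asymptotics.isLittleO_iff.2 fun η hη => ?_)
  filter_upwards [h η hη] with l hl
  simpa using hl

/-- The first variation of a family of geodesics at a later time. -/
theorem HasVariation.propagate [T2Space M] {g : LorentzMetric n M}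
    {θ : ℝ → ℝ → TangentBundle (𝓡∂ n) M} {b κ e : ℝ} (hb : 0 ≤ b)
    (h₀ : IsGeodesicOn g (θ 0) (Icc 0 b)) (hθ : ∀ᶠ l in 𝓝[>] 0, IsGeodesicOn g (θ l) (Icc 0 b))
    (he : HasDerivWithinAt (fun l => g.sq (θ l 0)) e (Ioi 0) 0)
    (h : HasVariation g (fun l => θ l 0) κ) :
    HasVariation g (fun l => θ l b) (κ + e / 2 * b) := by
  have key := rel_of_locally_rel (P := fun r s => ∀ κ, HasVariation g (fun l => θ l r) κ →
    HasVariation g (fun l => θ l s) (κ + e / 2 * (s - r))) hb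
    (fun _ _ κ h => by simpa using h)
    (fun r _ s _ t _ _ _ h1 h2 κ h => by
      have := h2 _ (h1 _ h)
      rwa [add_assoc, ← mul_add, show s - r + (t - s) = t - r by ring] at this) ?_ κ h
  · simpa using key
  intro t ht
  have hp := self_mem_tchart_source (θ 0 t)
  obtain ⟨δ, hδ, hsrc, hw⟩ := h₀.exists_firstVariation ht hp
  refine ⟨δ, hδ, fun r hr s hs hrs hrt hst κ hκ => ?_⟩
  rcases eq_or_lt_of_le hrs with rfl | hrs'
  · simpa using hκ
  obtain ⟨hev, J₀, hJ₀, hJκ⟩ := hκ _ (hsrc r hr hrt)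
  have hsub : Icc r s ⊆ Icc 0 b := Icc_subset_Icc hr.1 hs.2
  obtain ⟨J, hJr, -, hJd, hexp⟩ := hw r hr hrt s hs hrs hst (fun _ => s) (by
    filter_upwards [hθ] with l hl using ⟨le_rfl, hl.mono hsub⟩) J₀ hev hJ₀
  have hvar : ∀ τ ∈ Icc r s, HasDerivWithinAt (fun l => tchart (θ 0 t).proj (θ l τ)) (J τ)
      (Ioi 0) 0 := fun τ hτ =>
    hasDerivWithinAt_Ioi_of_forall_eventually fun η hη =>
      (hexp η hη).mono fun l hl => (hl τ hτ).2
  have hmem : ∀ τ ∈ Icc r s, ∀ᶠ l in 𝓝[>] 0, θ l τ ∈ (tchart (θ 0 t).proj).source := fun τ hτ =>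
    (hexp 1 one_pos).mono fun l hl => (hl τ hτ).1
  have hsrc' : ∀ τ ∈ Icc r s, θ 0 τ ∈ (tchart (θ 0 t).proj).source := fun τ hτ =>
    hsrc τ (hsub hτ) (abs_lt.2 ⟨by linarith [(abs_lt.1 hrt).1, hτ.1],
      by linarith [(abs_lt.1 hst).2, hτ.2]⟩)
  have her : HasDerivWithinAt (fun l => g.sq (θ l r)) e (Ioi 0) 0 :=
    he.congr_of_eventuallyEq (hθ.mono fun l hl => hl.sq_eq hr) (h₀.sq_eq hr)
  have hs' : s ∈ Icc r s := ⟨hrs, le_rfl⟩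
  refine hasVariation_of_chart (hsrc' s hs') (hmem s hs') (hvar s hs') ?_
  rw [← hJκ, ← hJr]
  refine firstVariation_inner (h₀.mono hsub) hsrc' hJd
    (fun τ hτ => hvar τ (Ico_subset_Icc_self hτ)) (fun τ hτ => ?_) her hs'
  filter_upwards [hθ, hmem τ (Ico_subset_Icc_self hτ)] with l h1 h2
  exact ⟨h2, (h1.mono hsub).sq_eq (Ico_subset_Icc_self hτ)⟩

/-! ### Arrival at the boundary -/

/-- The implicit function argument for the arrival time at a hyperplane. -/
theorem first_order_of_arrival {E : Type*} [NormedAddCommGroup E] [NormedSpace ℝ E]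
    {φ : E →L[ℝ] ℝ} {x : ℝ → E} {τ : ℝ → ℝ} {j V : E} (hφ : ∀ u, |φ u| ≤ ‖u‖) (hV : φ V ≠ 0)
    (hx : ∀ᶠ l in 𝓝[>] 0, φ (x l) = 0)
    (h : ∀ η > 0, ∀ᶠ l in 𝓝[>] (0 : ℝ), ‖x l - l • j - τ l • V‖ ≤ η * |l| + η * |τ l|) {η : ℝ}
    (hη : 0 < η) : ∀ᶠ l in 𝓝[>] (0 : ℝ), ‖x l - l • (j - (φ j / φ V) • V)‖ ≤ η * |l| := by
  set c := |φ V|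
  have hc : 0 < c := abs_pos.2 hV
  -- Applying `φ` to the expansion gives `τ l * φ V = -l * φ j` up to the error. With error constant
  -- at most `c / 2`, half of `|τ l| * c` is absorbed, which leaves `|τ l| ≤ C * |l|`.
  set C := (2 * |φ j| + c) / c
  have hC : 0 ≤ C := by positivity
  -- Collects the error of the expansion and the error made by replacing `τ l` with `-l * (φ j / φ
  -- V)`.
  set D := (1 + C) * (1 + ‖V‖ / c)
  have hD : 0 < D := by positivity
  have hη' : 0 < min (c / 2) (η / D) := lt_min (half_pos hc) (div_pos hη hD)
  filter_upwards [hx, h _ hη'] with l h1 h2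
  set η' := min (c / 2) (η / D)
  have h3 : |l * φ j + τ l * φ V| ≤ η' * |l| + η' * |τ l| := by
    refine le_trans (le_of_eq ?_) ((hφ _).trans h2)
    rw [map_sub, map_sub, map_smul, map_smul, h1, smul_eq_mul, smul_eq_mul, ← abs_neg]
    congr 1
    ring
  have h4 : |τ l| * c ≤ |l| * |φ j| + |l * φ j + τ l * φ V| := by
    rw [← abs_mul, ← abs_mul]
    have : τ l * φ V = (l * φ j + τ l * φ V) - l * φ j := by ring
    rw [this]
    refine (abs_sub _ _).trans ?_
    rw [add_comm]
    simp
  have h5 : η' ≤ c / 2 := min_le_left _ _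
  have h6 : |τ l| ≤ C * |l| := by
    have e1 : η' * |l| ≤ c / 2 * |l| := by gcongr
    have e2 : η' * |τ l| ≤ c / 2 * |τ l| := by gcongr
    have e3 : |τ l| * c ≤ (2 * |φ j| + c) * |l| := by linarith
    rw [show C * |l| = (2 * |φ j| + c) * |l| / c by simp only [C]; ring]
    rwa [le_div_iff₀ hc]
  have h7 : η' * |l| + η' * |τ l| ≤ η' * (1 + C) * |l| := by
    have := mul_le_mul_of_nonneg_left h6 hη'.le
    linarith
  have h8 : |τ l + l * (φ j / φ V)| ≤ η' * (1 + C) * |l| / c := by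
    rw [le_div_iff₀ hc, ← abs_mul]
    refine le_trans (le_of_eq ?_) (h3.trans h7)
    congr 1
    field_simp
    ring
  have h9 : x l - l • (j - (φ j / φ V) • V) =
      (x l - l • j - τ l • V) + (τ l + l * (φ j / φ V)) • V := by
    rw [smul_sub, add_smul, mul_smul]
    abel
  rw [h9]
  refine (norm_add_le _ _).trans ?_
  rw [norm_smul, Real.norm_eq_abs]
  calc ‖x l - l • j - τ l • V‖ + |τ l + l * (φ j / φ V)| * ‖V‖
      ≤ η' * (1 + C) * |l| + η' * (1 + C) * |l| / c * ‖V‖ :=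
        add_le_add (h2.trans h7) (mul_le_mul_of_nonneg_right h8 (norm_nonneg _))
    _ = η' * D * |l| := by simp only [D]; ring
    _ ≤ η * |l| := by
        gcongr
        exact (le_div_iff₀ hD).1 (min_le_right _ _)

theorem norm_sub_sub_smul_le {E : Type*} [NormedAddCommGroup E] [NormedSpace ℝ E] {z v : ℝ → E}
    {V : E} {a b η : ℝ} (hz : ∀ t ∈ Icc a b, HasDerivWithinAt z (v t) (Icc a b) t)
    (hv : ∀ t ∈ Icc a b, ‖v t - V‖ ≤ η) (hab : a ≤ b) :
    ‖z b - z a - (b - a) • V‖ ≤ η * (b - a) := by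
  have h := norm_image_sub_le_of_norm_deriv_le_segment' (f := fun t => z t - t • V)
    (f' := fun t => v t - V) (a := a) (b := b) (C := η) (fun t ht => by
      have := (hz t ht).sub ((hasDerivAt_id t).smul_const V).hasDerivWithinAt
      rwa [one_smul] at this) (fun t ht => hv t (Ico_subset_Icc_self ht)) b ⟨hab, le_rfl⟩
  refine le_trans (le_of_eq ?_) h
  congr 1
  rw [sub_smul]
  abel

/-- The first variation of the arrival points at the boundary of a family of geodesics. -/
theorem exists_arrival_derivative [T2Space M] {g : LorentzMetric n M}
    {θ : ℝ → ℝ → TangentBundle (𝓡∂ n) M} {T : ℝ → ℝ} {κ e : ℝ} (hT0 : 0 < T 0)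
    (hT : Filter.Tendsto T (𝓝[>] 0) (𝓝 (T 0)))
    (h₀ : IsGeodesicOn g (θ 0) (Icc 0 (T 0)))
    (hθ : ∀ᶠ l in 𝓝[>] 0, IsGeodesicOn g (θ l) (Icc 0 (T l)))
    (he : HasDerivWithinAt (fun l => g.sq (θ l 0)) e (Ioi 0) 0)
    (hvar : HasVariation g (fun l => θ l 0) κ)
    (hb : ∀ᶠ l in 𝓝[>] 0, (θ l (T l)).proj ∈ (𝓡∂ n).boundary M) {p : M}
    (hp : θ 0 (T 0) ∈ (tchart p).source) (hb0 : (θ 0 (T 0)).proj ∈ (𝓡∂ n).boundary M)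
    (hV : (tchart p (θ 0 (T 0))).2 0 < 0) (hlight : g.sq (θ 0 (T 0)) = 0) :
    ∃ X : Vec n, HasDerivWithinAt (fun l => (tchart p (θ l (T l))).1) X (Ioi 0) 0 ∧
      metricForm g p (tchart p (θ 0 (T 0))).1 X (tchart p (θ 0 (T 0))).2 = κ + e / 2 * T 0 := by
  have hT0I : T 0 ∈ Icc 0 (T 0) := ⟨hT0.le, le_rfl⟩
  obtain ⟨δ, hδ, hsrc, hw⟩ := h₀.exists_firstVariation hT0I hp
  set r := max 0 (T 0 - δ / 2)
  have hr0 : 0 ≤ r := le_max_left _ _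
  have hrT : r < T 0 := max_lt hT0 (by linarith)
  have hrT' : T 0 - δ / 2 ≤ r := le_max_right _ _
  have hrI : r ∈ Icc 0 (T 0) := ⟨hr0, hrT.le⟩
  have hrt : |r - T 0| < δ := abs_lt.2 ⟨by linarith, by linarith⟩
  have hTr : ∀ τ < T 0, ∀ᶠ l in 𝓝[>] 0, τ < T l := fun τ hτ => hT (Ioi_mem_nhds hτ)
  have hsub : Icc r (T 0) ⊆ Icc 0 (T 0) := Icc_subset_Icc_left hr0
  have hvr : HasVariation g (fun l => θ l r) (κ + e / 2 * r) := by
    refine hvar.propagate hr0 (h₀.mono (Icc_subset_Icc_right hrT.le)) ?_ he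
    filter_upwards [hθ, hTr r hrT] with l h1 h2
    exact h1.mono (Icc_subset_Icc_right h2.le)
  obtain ⟨hev, J₀, hJ₀, hJκ⟩ := hvr p (hsrc r hrI hrt)
  obtain ⟨J, hJr, hJc, hJd, hexp⟩ := hw r hrI hrt (T 0) hT0I hrT.le (by simpa using hδ)
    -- The perturbed and the unperturbed geodesic are compared only as long as both exist in `M`.
    (fun l => min (T l) (T 0)) (by
      filter_upwards [hθ] with l hl
      exact ⟨min_le_right _ _, hl.mono (Icc_subset_Icc hr0 (min_le_left _ _))⟩) J₀ hev hJ₀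
  have hsrc' : ∀ τ ∈ Icc r (T 0), θ 0 τ ∈ (tchart p).source := fun τ hτ =>
    hsrc τ (hsub hτ) (abs_lt.2 ⟨by linarith [hτ.1], by linarith [hτ.2]⟩)
  have hmin : ∀ τ ∈ Ico r (T 0), ∀ᶠ l in 𝓝[>] 0, τ ∈ Icc r (min (T l) (T 0)) := fun τ hτ => by
    filter_upwards [hTr τ hτ.2] with l hl using ⟨hτ.1, le_min hl.le hτ.2.le⟩
  have hinner := firstVariation_inner (e := e) (h₀.mono hsub) hsrc' hJd
    (fun τ hτ => hasDerivWithinAt_Ioi_of_forall_eventually fun η hη => by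
      filter_upwards [hexp η hη, hmin τ hτ] with l h1 h2 using (h1 τ h2).2)
    (fun τ hτ => by
      filter_upwards [hexp 1 one_pos, hmin τ hτ, hθ] with l h1 h2 h3
      exact ⟨(h1 τ h2).1, (h3.mono (Icc_subset_Icc hr0 (min_le_left _ _))).sq_eq h2⟩)
    (he.congr_of_eventuallyEq (by
      filter_upwards [hθ, hTr r hrT] with l h1 h2 using h1.sq_eq ⟨hr0, h2.le⟩) (h₀.sq_eq hrI))
    (τ := T 0) ⟨hrT.le, le_rfl⟩
  rw [hJr, hJκ] at hinner
  set ζ := tchart p (θ 0 (T 0)) with hζ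
  set j := (J (T 0)).1 with hj
  have hlim0 : Filter.Tendsto (fun l => θ l 0) (𝓝[>] 0) (𝓝 (θ 0 0)) := hvar.tendsto
  -- First order expansion in `l` and the time shift jointly, before anything is known about the
  -- size of `T l - T 0` beyond its convergence to zero.
  have hE : ∀ η > 0, ∀ᶠ l in 𝓝[>] 0, ‖((tchart p (θ l (T l))).1 - ζ.1) - l • j -
      (T l - T 0) • ζ.2‖ ≤ η * |l| + η * |T l - T 0| := by
    intro η hη
    obtain ⟨r₁, hr₁, hnear⟩ := h₀.eventually_near_end hT0 hT hθ hlim0 hp (closedBall_mem_nhds ζ hη)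
    obtain ⟨r₂, hr₂, hnear₀⟩ := h₀.eventually_near_end (θ := fun _ : ℝ => θ 0) (F := 𝓝[>] (0 : ℝ))
      hT0 tendsto_const_nhds (Filter.Eventually.of_forall fun _ => h₀) tendsto_const_nhds hp
      (closedBall_mem_nhds ζ hη)
    obtain ⟨_, hnear₀⟩ := hnear₀.exists
    have hJnear : ∀ᶠ l in 𝓝[>] 0, T l ≤ T 0 → ‖(J (T l)).1 - j‖ ≤ η / 2 := by
      have h1 : ContinuousWithinAt (fun τ => (J τ).1) (Icc r (T 0)) (T 0) :=
        (hJd (T 0) ⟨hrT.le, le_rfl⟩).continuousWithinAt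
      obtain ⟨d, hd, h2⟩ := Metric.mem_nhdsWithin_iff.1 (h1 (closedBall_mem_nhds _ (half_pos hη)))
      filter_upwards [hTr r hrT, hT (ball_mem_nhds _ hd)] with l h3 h4 h5
      have := h2 ⟨h4, h3.le, h5⟩
      rwa [mem_preimage, mem_closedBall, dist_eq_norm] at this
    filter_upwards [hexp (η / 2) (half_pos hη), hnear, hJnear, hTr r hrT, hTr _ hr₁.2,
      hTr _ hr₂.2, hθ] with l h1 h2 h3 h4 h5 h6 h7
    have hsplit : ∀ {a b : Vec n × Vec n} {k : ℝ}, ‖a - b - l • J k‖ ≤ η / 2 * |l| →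
        ‖a.1 - b.1 - l • (J k).1‖ ≤ η / 2 * |l| := fun {a b k} h =>
      (norm_fst_le (a - b - l • J k)).trans h
    have hl0 := abs_nonneg l
    -- If the perturbed geodesic arrives later, compare at `T 0` and follow it onward. If it arrives
    -- earlier, compare at `T l`, follow the unperturbed one from `T l` to `T 0`, and use continuity
    -- of `J`.
    rcases le_total (T 0) (T l) with hle | hle
    · have e1 := hsplit (h1 (T 0) ⟨hrT.le, le_min hle le_rfl⟩).2
      have hI : Icc (T 0) (T l) ⊆ Icc 0 (T l) := Icc_subset_Icc_left hT0.le
      have e2 := norm_sub_sub_smul_le (z := fun τ => (tchart p (θ l τ)).1)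
        (v := fun τ => (tchart p (θ l τ)).2) (V := ζ.2) (η := η) (a := T 0) (b := T l)
        (fun τ hτ => ((h7.mono hI).hasDerivWithinAt hτ (h2 τ ⟨hr₁.2.le.trans hτ.1, hτ.2⟩).1).fst)
        (fun τ hτ => by
          have := (h2 τ ⟨hr₁.2.le.trans hτ.1, hτ.2⟩).2
          rw [mem_closedBall, dist_eq_norm] at this
          exact (norm_snd_le (tchart p (θ l τ) - ζ)).trans this) hle
      rw [abs_of_nonneg (sub_nonneg.2 hle)]
      have e3 : ((tchart p (θ l (T l))).1 - ζ.1) - l • j - (T l - T 0) • ζ.2 =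
          ((tchart p (θ l (T l))).1 - (tchart p (θ l (T 0))).1 - (T l - T 0) • ζ.2) +
          ((tchart p (θ l (T 0))).1 - ζ.1 - l • j) := by abel
      rw [e3]
      refine (norm_add_le _ _).trans ?_
      have e4 : η / 2 * |l| ≤ η * |l| := by gcongr; linarith
      linarith
    · have e1 := hsplit (h1 (T l) ⟨h4.le, le_min le_rfl hle⟩).2
      have hI : Icc (T l) (T 0) ⊆ Icc 0 (T 0) := Icc_subset_Icc_left (hr0.trans h4.le)
      have e2 := norm_sub_sub_smul_le (z := fun τ => (tchart p (θ 0 τ)).1)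
        (v := fun τ => (tchart p (θ 0 τ)).2) (V := ζ.2) (η := η) (a := T l) (b := T 0)
        (fun τ hτ => ((h₀.mono hI).hasDerivWithinAt hτ
          (hnear₀ τ ⟨h6.le.trans hτ.1, hτ.2⟩).1).fst)
        (fun τ hτ => by
          have := (hnear₀ τ ⟨h6.le.trans hτ.1, hτ.2⟩).2
          rw [mem_closedBall, dist_eq_norm] at this
          exact (norm_snd_le (tchart p (θ 0 τ) - ζ)).trans this) hle
      rw [abs_of_nonpos (sub_nonpos.2 hle)]
      have e3 : ((tchart p (θ l (T l))).1 - ζ.1) - l • j - (T l - T 0) • ζ.2 =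
          ((tchart p (θ l (T l))).1 - (tchart p (θ 0 (T l))).1 - l • (J (T l)).1) +
          l • ((J (T l)).1 - j) -
          (ζ.1 - (tchart p (θ 0 (T l))).1 - (T 0 - T l) • ζ.2) := by
        rw [smul_sub, sub_smul, sub_smul]
        abel
      rw [e3]
      refine (norm_sub_le _ _).trans ((add_le_add (norm_add_le _ _) le_rfl).trans ?_)
      rw [norm_smul, Real.norm_eq_abs]
      have e4 : |l| * ‖(J (T l)).1 - j‖ ≤ |l| * (η / 2) := by gcongr; exact h3 hle
      linarith
  have hfin := fun {η : ℝ} (hη : 0 < η) => first_order_of_arrival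
    (φ := EuclideanSpace.proj (𝕜 := ℝ) (0 : Fin n)) (x := fun l => (tchart p (θ l (T l))).1 - ζ.1)
    (τ := fun l => T l - T 0) (j := j) (V := ζ.2) (fun u => abs_apply_zero_le_norm u) hV.ne (by
      filter_upwards [hb, hexp 1 one_pos, hTr r hrT, h₀.eventually_near_end hT0 hT hθ hlim0 hp
        Filter.univ_mem |>.choose_spec.2, hTr _ (h₀.eventually_near_end hT0 hT hθ hlim0 hp
        Filter.univ_mem |>.choose_spec.1.2)] with l h1 h2 h3 h4 h5
      have hs := (h4 (T l) ⟨h5.le, le_rfl⟩).1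
      have e1 : (tchart p (θ l (T l))).1 0 = 0 :=
        (mem_boundary_iff_chart (mem_tchart_source.1 hs)).1 h1
      have e2 : ζ.1 0 = 0 := (mem_boundary_iff_chart (mem_tchart_source.1 hp)).1 hb0
      simp [e1, e2]) hE hη
  refine ⟨_, hasDerivWithinAt_Ioi_of_forall_eventually fun η hη => hfin hη, ?_⟩
  -- The derivative of the arrival point differs from `j` by a multiple of the velocity `ζ.2`, which
  -- is null and drops out of the product.
  have hll := hlight
  rw [sq_eq_metricForm g hp] at hll
  rw [map_sub, map_smul, sub_apply, smul_apply, hll, smul_zero, sub_zero, hinner]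
  ring

/-- Near a transversal arrival, the boundary is reached soon. -/
theorem IsGeodesicOn.eventually_arrival_lt [T2Space M] {g : LorentzMetric n M}
    {θ₀ : ℝ → TangentBundle (𝓡∂ n) M} {b u : ℝ} (hb : 0 ≤ b) (h₀ : IsGeodesicOn g θ₀ (Icc 0 b))
    (hb0 : (θ₀ b).proj ∈ (𝓡∂ n).boundary M) (hV : normalCoord (θ₀ b).proj (θ₀ b).2 < 0)
    {ι : Type*} {F : Filter ι} {θ : ι → ℝ → TangentBundle (𝓡∂ n) M} {T : ι → ℝ}
    (hθ : ∀ᶠ i in F, IsGeodesicOn g (θ i) (Icc 0 (T i)))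
    (hlim : Filter.Tendsto (fun i => θ i 0) F (𝓝 (θ₀ 0))) (hu : b < u) :
    ∀ᶠ i in F, T i < u := by
  have hp := self_mem_tchart_source (θ₀ b)
  rw [normalCoord_eq_tchart] at hV
  set p := (θ₀ b).proj
  set m := -(tchart p (θ₀ b)).2 0 / 2
  have hm : 0 < m := by simp only [m]; linarith
  have hN : {ζ : Vec n × Vec n | ζ.2 0 < -m} ∈ 𝓝 (tchart p (θ₀ b)) :=
    (isOpen_lt ((EuclideanSpace.proj (𝕜 := ℝ) (0 : Fin n)).continuous.comp
      continuous_snd) continuous_const).mem_nhds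
      (show (tchart p (θ₀ b)).2 0 < -m by simp only [m]; linarith)
  obtain ⟨B, hBN⟩ := exists_flowBox g (tchart_mem_target hp) hN
  have hε := B.ε_pos
  set d := min (u - b) B.ε
  have hd : 0 < d := lt_min (by linarith) hε
  have hbd : b ≤ b + d := by linarith
  -- A geodesic that lives until `b + d` has normal velocity below `-m` for time `d` from a boundary
  -- coordinate below `m * d`, and would leave the half space.
  suffices h : ∀ᶠ i in F, b + d ≤ T i → False by
    filter_upwards [h] with i hi
    have := not_le.1 hi
    linarith [min_le_left (u - b) B.ε]
  refine (Filter.eventually_inf_principal (p := fun _ => False) (s := {i | b + d ≤ T i})).1 ?_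
  set F' := F ⊓ Filter.principal {i | b + d ≤ T i}
  have hF' : F' ≤ F := inf_le_left
  have hge : ∀ᶠ i in F', b + d ≤ T i := Filter.mem_inf_of_right (Filter.mem_principal_self _)
  have hlimb : Filter.Tendsto (fun i => θ i b) F' (𝓝 (θ₀ b)) := by
    refine h₀.tendsto_of_tendsto (σ := fun _ => b) ⟨hb, le_rfl⟩ tendsto_const_nhds ?_
      (hlim.mono_left hF')
    filter_upwards [hF' hθ, hge] with i h1 h2
    exact ⟨hb, h1.mono (Icc_subset_Icc_right (by linarith))⟩
  have hz0 : (tchart p (θ₀ b)).1 0 = 0 := (mem_boundary_iff_chart (mem_tchart_source.1 hp)).1 hb0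
  have hnear : {ζ : Vec n × Vec n | ζ.1 0 < m * d} ∈ 𝓝 (tchart p (θ₀ b)) :=
    (isOpen_lt ((EuclideanSpace.proj (𝕜 := ℝ) (0 : Fin n)).continuous.comp
      continuous_fst) continuous_const).mem_nhds
      (show (tchart p (θ₀ b)).1 0 < m * d by rw [hz0]; positivity)
  have hlimz := (tendsto_tchart hp).comp hlimb
  filter_upwards [hF' hθ, hge, hlimz hnear, hlimz (closedBall_mem_nhds _ B.r_pos),
    hlimb ((isOpen_tchart_source p).mem_nhds hp)] with i h1 h2 h3 h4 h5
  have h6 : IsGeodesicOn g (θ i) (Icc b (b + d)) := h1.mono (Icc_subset_Icc hb h2)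
  have h7 := B.eq_flow h6 (by linarith [min_le_right (u - b) B.ε]) h5 h4
  have h8 := mul_sub_le_of_le_hasDerivWithinAt (f := fun t => -(tchart p (θ i t)).1 0)
    (f' := fun t => -(tchart p (θ i t)).2 0) (m := m) (a := b) (b := b + d)
    (fun t ht => by
      have h9 : HasDerivWithinAt (fun t => (tchart p (θ i t)).1) (tchart p (θ i t)).2
        (Icc b (b + d)) t := (h6.hasDerivWithinAt ht (h7 t ht).1).fst
      exact (hasDerivWithinAt_apply_zero h9).neg)
    (fun t ht => by
      have h9 : tchart p (θ i t) ∈ {ζ : Vec n × Vec n | ζ.2 0 < -m} := by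
        rw [(h7 t ht).2]
        exact hBN (B.mem _ h4 _ ⟨by linarith [ht.1], by linarith [ht.2, min_le_right (u - b) B.ε]⟩)
      have h10 : (tchart p (θ i t)).2 0 < -m := h9
      linarith) (s := b) (t := b + d) ⟨le_rfl, hbd⟩ ⟨hbd, le_rfl⟩ hbd
  have h9 : 0 ≤ (tchart p (θ i (b + d))).1 0 := extChartAt_apply_zero_nonneg _ _
  have h10 : (tchart p (θ i b)).1 0 < m * d := h3
  simp only [add_sub_cancel_left] at h8
  linarith

/-- The arrival times at the boundary depend continuously on the geodesic, if the arrivals are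
uniformly transversal. -/
theorem tendsto_arrivalTime [T2Space M] {g : LorentzMetric n M} (hbd : HasTimelikeBoundary g)
    {θ₀ : ℝ → TangentBundle (𝓡∂ n) M} {b : ℝ} (hb : 0 < b) (h₀ : IsGeodesicOn g θ₀ (Icc 0 b))
    (hintr : ∀ t ∈ Ioo 0 b, (θ₀ t).proj ∈ (𝓡∂ n).interior M)
    (hb0 : (θ₀ b).proj ∈ (𝓡∂ n).boundary M) (hV : normalCoord (θ₀ b).proj (θ₀ b).2 < 0)
    {ι : Type*} {F : Filter ι} {θ : ι → ℝ → TangentBundle (𝓡∂ n) M} {T : ι → ℝ}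
    (hθ : ∀ᶠ i in F, 0 < T i ∧ IsGeodesicOn g (θ i) (Icc 0 (T i)))
    (hlim : Filter.Tendsto (fun i => θ i 0) F (𝓝 (θ₀ 0)))
    (hproj : Filter.Tendsto (fun i => (θ i (T i)).proj) F (𝓝 (θ₀ b).proj))
    (hθb : ∀ᶠ i in F, (θ i (T i)).proj ∈ (𝓡∂ n).boundary M) {c : ℝ} (hc : 0 < c)
    (hnorm : ∀ᶠ i in F, ∀ ν, IsOutwardUnitNormal g (θ i (T i)).proj ν →
      c ≤ g.inner (θ i (T i)).proj (θ i (T i)).2 ν) :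
    Filter.Tendsto T F (𝓝 b) := by
  refine tendsto_order.2 ⟨fun u hu => ?_, fun u hu =>
    h₀.eventually_arrival_lt hb.le hb0 hV (hθ.mono fun i hi => hi.2) hlim hu⟩
  by_contra hcon
  -- If arrivals were too early infinitely often, an ultrafilter would give them a limit `T' < b`.
  -- By continuous dependence the arrival vectors then converge to `θ₀ T'`.
  have hfr : ∃ᶠ i in F, T i ≤ u := (Filter.not_eventually.1 hcon).mono fun i hi => not_lt.1 hi
  have : (F ⊓ Filter.principal {i | T i ≤ u}).NeBot := Filter.inf_principal_neBot_iff.2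
    fun s hs => (hfr.and_eventually hs).exists.imp fun i hi => ⟨hi.2, hi.1⟩
  set G := Ultrafilter.of (F ⊓ Filter.principal {i | T i ≤ u})
  have hG : (G : Filter ι) ≤ F := (Ultrafilter.of_le _).trans inf_le_left
  have hGu : ∀ᶠ i in (G : Filter ι), T i ≤ u :=
    (Ultrafilter.of_le _) (Filter.mem_inf_of_right (Filter.mem_principal_self _))
  obtain ⟨T', hT', hGT⟩ := (isCompact_Icc (a := (0 : ℝ)) (b := u)).ultrafilter_le_nhds
    (G.map T) (by
      rw [Ultrafilter.coe_map, Filter.le_principal_iff, Filter.mem_map]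
      filter_upwards [hG hθ, hGu] with i h1 h2
      exact ⟨h1.1.le, h2⟩)
  have hTT' : Filter.Tendsto T G (𝓝 T') := hGT
  have hT'b : T' < b := hT'.2.trans_lt hu
  have hend : Filter.Tendsto (fun i => θ i (T i)) G (𝓝 (θ₀ T')) := by
    refine h₀.tendsto_of_tendsto ⟨hT'.1, hT'b.le⟩ hTT' ?_ (hlim.mono_left hG)
    filter_upwards [hG hθ] with i hi using ⟨hi.1.le, hi.2⟩
  have hproj' : Filter.Tendsto (fun i => (θ i (T i)).proj) G (𝓝 (θ₀ T').proj) :=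
    ((FiberBundle.continuous_proj (Vec n) (TangentSpace (𝓡∂ n) : M → Type _)).tendsto _).comp hend
  have heq : (θ₀ T').proj = (θ₀ b).proj := tendsto_nhds_unique hproj' (hproj.mono_left hG)
  have hbT' : (θ₀ T').proj ∈ (𝓡∂ n).boundary M := heq ▸ hb0
  -- The only time before `b` at which `θ₀` can be on the boundary is the start.
  have hT'0 : T' = 0 := by
    by_contra hne
    exact notMem_boundary_of_interior (hintr T' ⟨lt_of_le_of_ne hT'.1 (Ne.symm hne), hT'b⟩) hbT'
  subst hT'0
  have hx0 := h₀.normalCoord_nonneg hb hbT'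
  obtain ⟨ν₀, hν₀⟩ := exists_isOutwardUnitNormal hbd hbT'
  have hex : ∀ i, ∃ ν : TangentSpace (𝓡∂ n) (θ i (T i)).proj,
      (θ i (T i)).proj ∈ (𝓡∂ n).boundary M → IsOutwardUnitNormal g (θ i (T i)).proj ν := fun i => by
    by_cases h : (θ i (T i)).proj ∈ (𝓡∂ n).boundary M
    · obtain ⟨ν, hν⟩ := exists_isOutwardUnitNormal hbd h
      exact ⟨ν, fun _ => hν⟩
    · exact ⟨0, fun h' => absurd h' h⟩
  choose ν hν using hex
  have hlimν := tendsto_inner_normal hbd hend (hG hθb) hbT'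
    (ν := ν) (by filter_upwards [hG hθb] with i hi using hν i hi) hν₀
  -- The limit of uniformly outward vectors points outward, whereas a geodesic that starts at the
  -- boundary and lasts does not start outward. So early arrivals cannot collapse onto the starting
  -- point.
  have h1 : c ≤ g.inner (θ₀ 0).proj (θ₀ 0).2 ν₀ := by
    refine ge_of_tendsto hlimν ?_
    filter_upwards [hG hθb, hG hnorm] with i h1 h2 using h2 _ (hν i h1)
  rw [hν₀.inner_eq] at h1
  have h2 := div_nonpos_of_nonneg_of_nonpos hx0 hν₀.outward.le
  linarith

/-! ### The travel time formula -/

theorem LorentzMetric.inner_neg_left (g : LorentzMetric n M) (x : M)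
    (v w : TangentSpace (𝓡∂ n) x) : g.inner x (-v) w = -g.inner x v w := by
  rw [g.symm, map_neg, g.symm]

theorem sq_tneg (g : LorentzMetric n M) (ξ : TangentBundle (𝓡∂ n) M) : g.sq (tneg ξ) = g.sq ξ := by
  have : g.inner ξ.proj (-ξ.2) (-ξ.2) = g.inner ξ.proj ξ.2 ξ.2 := by
    rw [g.inner_neg_left, map_neg, neg_neg]
  exact this

theorem HasVariation.congr {g : LorentzMetric n M} {ξ ξ' : ℝ → TangentBundle (𝓡∂ n) M} {κ : ℝ}
    (h : HasVariation g ξ κ) (heq : ∀ᶠ l in 𝓝[>] 0, ξ' l = ξ l) (h0 : ξ' 0 = ξ 0) :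
    HasVariation g ξ' κ := by
  intro p hp
  rw [h0] at hp ⊢
  obtain ⟨h1, J, hJ, h2⟩ := h p hp
  refine ⟨?_, J, hJ.congr_of_eventuallyEq ?_ (by rw [h0]), h2⟩
  · filter_upwards [h1, heq] with l h3 h4
    rwa [h4]
  · filter_upwards [heq] with l h4
    rw [h4]

/-- The time reversal of a scattering geodesic. -/
theorem IsScatteringGeodesic.reverse {g : LorentzMetric n M} {β : ℝ → TangentBundle (𝓡∂ n) M}
    {T : ℝ} (h : IsScatteringGeodesic g β T) (h0 : (β 0).proj ∈ (𝓡∂ n).boundary M) :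
    IsScatteringGeodesic g (fun t => tneg (β (T - t))) T where
  pos := h.pos
  geodesic := (h.geodesic.reverse T).mono fun t ht => by
    simp only [mem_preimage, mem_Icc] at ht ⊢
    constructor <;> linarith [ht.1, ht.2]
  interior t ht := h.interior _ ⟨by linarith [ht.2], by linarith [ht.1]⟩
  boundary := by
    simp only [sub_self]
    exact h0

theorem hasVariation_of_fiber (g : LorentzMetric n M) {y : M} {u : ℝ → Vec n} {u' : Vec n}
    (hu : HasDerivWithinAt u u' (Ioi 0) 0) :
    HasVariation g (fun l => (⟨y, u l⟩ : TangentBundle (𝓡∂ n) M)) 0 := by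
  have hs : ∀ l, (⟨y, u l⟩ : TangentBundle (𝓡∂ n) M) ∈ (tchart y).source := fun l =>
    self_mem_tchart_source (⟨y, u l⟩ : TangentBundle (𝓡∂ n) M)
  have hd : HasDerivWithinAt (fun l => (extChartAt (𝓡∂ n) y y, u l)) ((0 : Vec n), u') (Ioi 0) 0 :=
    (hasDerivWithinAt_const (0 : ℝ) (Ioi 0) (extChartAt (𝓡∂ n) y y)).prodMk hu
  refine hasVariation_of_chart (hs 0) (Filter.Eventually.of_forall hs) (J := (0, u')) ?_ ?_
  · simp only [tchart_mk_self]
    exact hd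
  · simp

/-- The travel time formula for families of scattering geodesics with a common end point. -/
theorem travelTime_formula [T2Space M] {g : LorentzMetric n M} (hbd : HasTimelikeBoundary g)
    {y : M} {ε c : ℝ} {w : ℝ → Vec n} {w' : Vec n} {α : ℝ → TangentBundle (𝓡∂ n) M} (hε : 0 < ε)
    (hw : HasDerivWithinAt w w' (Ioi 0) 0)
    (hsq : HasDerivWithinAt (fun l => g.sq (⟨y, w l⟩ : TangentBundle (𝓡∂ n) M)) (-2) (Ico 0 ε) 0)
    (hlight : g.sq (α 0) = 0)
    (hproj : ContinuousWithinAt (fun l => (α l).proj) (Ico 0 ε) 0) (hc : 0 < c)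
    (hnorm : ∀ᶠ l in 𝓝[>] 0, ∀ ν, IsOutwardUnitNormal g (α l).proj ν →
      g.inner (α l).proj (α l).2 ν ≤ -c)
    (hscat : ∀ l ∈ Ico 0 ε, InteriorScattering g (α l) ⟨y, w l⟩) :
    ∃ x' : ℝ →L[ℝ] TangentSpace (𝓡∂ n) (α 0).proj,
      HasMFDerivWithinAt 𝓘(ℝ, ℝ) (𝓡∂ n) (fun l => (α l).proj) (Ico 0 ε) 0 x' ∧
      interiorTravelTime g (α 0) = (g.inner (α 0).proj (x' 1) (α 0).2 : ℝ) := by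
  have : Nonempty (TangentBundle (𝓡∂ n) M) := ⟨α 0⟩
  choose! β T hβ using fun l (hl : l ∈ Ico 0 ε) => (hscat l hl).exists_geodesic
  have h0ε : (0 : ℝ) ∈ Ico 0 ε := ⟨le_rfl, hε⟩
  have hIco : Ico 0 ε ∈ 𝓝[>] (0 : ℝ) := by
    filter_upwards [Ioo_mem_nhdsGT hε] with l hl using ⟨hl.1.le, hl.2⟩
  -- After reversal the common end point is a common starting point, and the transversal end is the
  -- arrival.
  set θ : ℝ → ℝ → TangentBundle (𝓡∂ n) M := fun l t => tneg (β l (T l - t)) with hθdef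
  have hαb : ∀ l ∈ Ico 0 ε, (α l).proj ∈ (𝓡∂ n).boundary M := fun l hl => (hscat l hl).1.1
  have hrev : ∀ l ∈ Ico 0 ε, IsScatteringGeodesic g (θ l) (T l) := fun l hl =>
    (hβ l hl).1.reverse (by rw [(hβ l hl).2.1]; exact hαb l hl)
  have hθT : ∀ l ∈ Ico 0 ε, θ l (T l) = tneg (α l) := fun l hl => by
    simp only [hθdef, sub_self, (hβ l hl).2.1]
  have hθ0 : ∀ l ∈ Ico 0 ε, θ l 0 = ⟨y, -w l⟩ := fun l hl => by
    simp only [hθdef, sub_zero, (hβ l hl).2.2.1]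
    rfl
  -- Only the velocity varies at the fixed point `y`, so the horizontal part of the variation is
  -- zero.
  have hvar : HasVariation g (fun l => θ l 0) 0 :=
    (hasVariation_of_fiber g (y := y) hw.neg).congr
      (by filter_upwards [hIco] with l hl using hθ0 l hl) (hθ0 0 h0ε)
  have hsq' : HasDerivWithinAt (fun l => g.sq (θ l 0)) (-2) (Ioi 0) 0 := by
    have h1 : HasDerivWithinAt (fun l => g.sq (⟨y, w l⟩ : TangentBundle (𝓡∂ n) M)) (-2) (Ioi 0) 0 :=
      hsq.mono_of_mem_nhdsWithin hIco
    refine h1.congr_of_eventuallyEq ?_ ?_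
    · filter_upwards [hIco] with l h5
      rw [hθ0 l h5]
      exact sq_tneg g (⟨y, w l⟩ : TangentBundle (𝓡∂ n) M)
    · rw [hθ0 0 h0ε]
      exact sq_tneg g (⟨y, w 0⟩ : TangentBundle (𝓡∂ n) M)
  have hprojT : Filter.Tendsto (fun l => (θ l (T l)).proj) (𝓝[>] 0) (𝓝 (θ 0 (T 0)).proj) := by
    rw [hθT 0 h0ε]
    refine Filter.Tendsto.congr' ?_ (hproj.tendsto.mono_left
      (nhdsWithin_le_iff.2 hIco))
    filter_upwards [hIco] with l hl
    rw [hθT l hl]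
    rfl
  have hV : normalCoord (θ 0 (T 0)).proj (θ 0 (T 0)).2 < 0 := by
    rw [hθT 0 h0ε]
    exact neg_neg_of_pos (normalCoord_pos_of_mem_inwardTM (hscat 0 h0ε).1)
  have hgeo : ∀ᶠ l in 𝓝[>] 0, IsGeodesicOn g (θ l) (Icc 0 (T l)) := by
    filter_upwards [hIco] with l hl using (hrev l hl).geodesic
  have hbT : ∀ᶠ l in 𝓝[>] 0, (θ l (T l)).proj ∈ (𝓡∂ n).boundary M := by
    filter_upwards [hIco] with l hl using (hrev l hl).boundary
  have hTlim : Filter.Tendsto T (𝓝[>] 0) (𝓝 (T 0)) := by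
    refine tendsto_arrivalTime hbd (hrev 0 h0ε).pos (hrev 0 h0ε).geodesic (hrev 0 h0ε).interior
      (hrev 0 h0ε).boundary hV (θ := θ) ?_ hvar.tendsto hprojT hbT hc ?_
    · filter_upwards [hIco] with l hl using ⟨(hrev l hl).pos, (hrev l hl).geodesic⟩
    · filter_upwards [hIco, hnorm] with l hl h1
      rw [hθT l hl]
      intro ν hν
      have h2 := h1 ν hν
      exact (le_neg_of_le_neg h2).trans_eq (g.inner_neg_left (α l).proj (α l).2 ν).symm
  have hp := self_mem_tchart_source (α 0)
  have hp' : θ 0 (T 0) ∈ (tchart (α 0).proj).source := by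
    rw [hθT 0 h0ε]
    exact mem_tchart_source.2 (mem_tchart_source.1 hp)
  obtain ⟨X, hX, hXin⟩ := exists_arrival_derivative (hrev 0 h0ε).pos hTlim (hrev 0 h0ε).geodesic
    hgeo hsq' hvar hbT hp' (hrev 0 h0ε).boundary (by
      rw [normalCoord_eq_tchart, hθT 0 h0ε] at hV
      rw [hθT 0 h0ε]
      exact hV) (by rw [hθT 0 h0ε, sq_tneg, hlight])
  rw [hθT 0 h0ε, tchart_tneg, tchart_self] at hXin
  refine ⟨ContinuousLinearMap.toSpanSingleton ℝ (show TangentSpace (𝓡∂ n) (α 0).proj from X),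
    ⟨hproj, ?_⟩, ?_⟩
  · have h1 : HasDerivWithinAt (fun l => extChartAt (𝓡∂ n) (α 0).proj (α l).proj) X (Ico 0 ε) 0 := by
      have h2 : HasDerivWithinAt (fun l => extChartAt (𝓡∂ n) (α 0).proj (α l).proj) X (Ioi 0) 0 := by
        refine hX.congr_of_eventuallyEq ?_ ?_
        · filter_upwards [hIco] with l hl
          rw [hθT l hl]
          rfl
        · rw [hθT 0 h0ε]
          rfl
      exact (hasDerivWithinAt_Ioi_iff_Ici.1 h2).mono Ico_subset_Ici_self
    exact h1.hasFDerivWithinAt.mono fun l hl => hl.1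
  · rw [(hβ 0 h0ε).2.2.2]
    -- Rate `-2 / 2` over time `T 0`, against the reversed velocity `-v`; the two signs cancel.
    have h2 : metricForm g (α 0).proj (extChartAt (𝓡∂ n) (α 0).proj (α 0).proj) X
      (-(show Vec n from (α 0).2)) = 0 + -2 / 2 * T 0 := hXin
    rw [map_neg] at h2
    have h1 : g.inner (α 0).proj (show TangentSpace (𝓡∂ n) (α 0).proj from X) (α 0).2 = T 0 :=
      (inner_eq_metricForm_self g _ _ _).trans (by linarith)
    have h3 : (ContinuousLinearMap.toSpanSingleton ℝ
        (show TangentSpace (𝓡∂ n) (α 0).proj from X)) 1 = X :=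
      one_smul ℝ _
    rw [h3, h1]

/-! ### Existence of nearby scattering geodesics -/

/-- Geodesics near a geodesic in the interior exist for the same time and stay in the interior. -/
theorem IsGeodesicOn.exists_nearby_interior [T2Space M] {g : LorentzMetric n M}
    {θ₀ : ℝ → TangentBundle (𝓡∂ n) M} {a b : ℝ} (hab : a ≤ b) (h₀ : IsGeodesicOn g θ₀ (Icc a b))
    (hintr : ∀ t ∈ Icc a b, (θ₀ t).proj ∈ (𝓡∂ n).interior M) {ι : Type*} {F : Filter ι}
    {ξ : ι → TangentBundle (𝓡∂ n) M} (hξ : Filter.Tendsto ξ F (𝓝 (θ₀ a))) :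
    ∃ γ : ι → ℝ → TangentBundle (𝓡∂ n) M, ∀ᶠ i in F, IsGeodesicOn g (γ i) (Icc a b) ∧
      γ i a = ξ i ∧ ∀ t ∈ Icc a b, (γ i t).proj ∈ (𝓡∂ n).interior M := by
  have hloc : ∀ t ∈ Icc a b, ∃ δ > 0, ∀ r ∈ Icc a b, ∀ s ∈ Icc a b, r ≤ s →
      |r - t| < δ → |s - t| < δ → ∀ ξ : ι → TangentBundle (𝓡∂ n) M,
      Filter.Tendsto ξ F (𝓝 (θ₀ r)) → ∃ γ : ι → ℝ → TangentBundle (𝓡∂ n) M, ∀ᶠ i in F,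
        IsGeodesicOn g (γ i) (Icc r s) ∧ γ i r = ξ i ∧
        ∀ t ∈ Icc r s, (γ i t).proj ∈ (𝓡∂ n).interior M := by
    intro t ht
    have hp := self_mem_tchart_source (θ₀ t)
    have h0 : 0 < (tchart (θ₀ t).proj (θ₀ t)).1 0 :=
      (mem_interior_iff_chart (mem_tchart_source.1 hp)).1 (hintr t ht)
    have hN : {ζ : Vec n × Vec n | 0 < ζ.1 0} ∈ 𝓝 (tchart (θ₀ t).proj (θ₀ t)) :=
      (isOpen_lt continuous_const ((EuclideanSpace.proj (𝕜 := ℝ) (0 : Fin n)).continuous.comp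
        continuous_fst)).mem_nhds h0
    set p := (θ₀ t).proj
    obtain ⟨B, hB, δ, hδ, hδε, hw⟩ := h₀.exists_window ht hp hN
    have hε := B.ε_pos
    refine ⟨δ, hδ, fun r hr s hs hrs hrt hst ξ hξ =>
      ⟨fun i τ => (tchart p).symm (B.flow (tchart p (ξ i)) (τ - r)), ?_⟩⟩
    have e1 := abs_lt.1 hrt
    have e2 := abs_lt.1 hst
    obtain ⟨hr1, hr2⟩ := hw r hr hrt
    filter_upwards [hξ ((isOpen_tchart_source p).mem_nhds hr1),
      ((tendsto_tchart hr1).comp hξ) (isOpen_ball.mem_nhds hr2)] with i h1 h2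
    have h3 : tchart p (ξ i) ∈ closedBall (tchart p (θ₀ t)) B.r := ball_subset_closedBall h2
    have hI : ∀ τ ∈ Icc r s, τ - r ∈ Icc (-B.ε) B.ε := fun τ hτ => by
      constructor <;> linarith [hτ.1, hτ.2]
    have hpos : ∀ τ ∈ Icc r s, 0 < (B.flow (tchart p (ξ i)) (τ - r)).1 0 := fun τ hτ =>
      hB (B.mem _ h3 _ (hI τ hτ))
    refine ⟨B.isGeodesicOn_symm h3 (by linarith) (by linarith) fun τ hτ => (hpos τ hτ).le, ?_,
      fun τ hτ => mem_interior_tchart_symm (B.target _ (B.mem _ h3 _ (hI τ hτ)) (hpos τ hτ).le)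
        (hpos τ hτ)⟩
    simp only [sub_self]
    rw [B.flow_zero _ h3, (tchart p).left_inv h1]
  refine rel_of_locally_rel (P := fun r s => ∀ ξ : ι → TangentBundle (𝓡∂ n) M,
      Filter.Tendsto ξ F (𝓝 (θ₀ r)) → ∃ γ : ι → ℝ → TangentBundle (𝓡∂ n) M, ∀ᶠ i in F,
        IsGeodesicOn g (γ i) (Icc r s) ∧ γ i r = ξ i ∧
        ∀ t ∈ Icc r s, (γ i t).proj ∈ (𝓡∂ n).interior M) hab (fun t ht => ?_)
    (fun r hr s hs t ht hrs hst h1 h2 ξ hξ => ?_) hloc ξ hξ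
  · obtain ⟨δ, hδ, h⟩ := hloc t ht
    exact h t ht t ht le_rfl (by simpa using hδ) (by simpa using hδ)
  · obtain ⟨γ₁, hγ₁⟩ := h1 ξ hξ
    have hlim : Filter.Tendsto (fun i => γ₁ i s) F (𝓝 (θ₀ s)) := by
      refine (h₀.mono (Icc_subset_Icc hr.1 hs.2)).tendsto_of_tendsto (σ := fun _ => s)
        ⟨hrs, le_rfl⟩ tendsto_const_nhds (hγ₁.mono fun i hi => ⟨hrs, hi.1⟩) (hξ.congr' ?_)
      filter_upwards [hγ₁] with i hi using hi.2.1.symm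
    obtain ⟨γ₂, hγ₂⟩ := h2 _ hlim
    refine ⟨fun i t => if t ≤ s then γ₁ i t else γ₂ i t, ?_⟩
    filter_upwards [hγ₁, hγ₂] with i hi1 hi2
    refine ⟨hi1.1.concat hrs hst hi2.1 hi2.2.1.symm, by simp [hrs, hi1.2.1], fun τ hτ => ?_⟩
    by_cases h : τ ≤ s
    · simp only [h, if_true]
      exact hi1.2.2 τ ⟨hτ.1, h⟩
    · simp only [h, if_false]
      exact hi2.2.2 τ ⟨(not_le.1 h).le, hτ.2⟩

/-- Turning the initial vector of a geodesic that starts at the boundary inward moves the geodesic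
into the interior. -/
theorem IsGeodesicOn.exists_nearby_of_inward [T2Space M] {g : LorentzMetric n M}
    {θ₀ : ℝ → TangentBundle (𝓡∂ n) M} {T : ℝ} (hT : 0 < T) (h₀ : IsGeodesicOn g θ₀ (Icc 0 T))
    {y : M} {v u : Vec n} (h0 : θ₀ 0 = ⟨y, v⟩) (hu : 0 < u 0) :
    ∃ δ ∈ Ioo 0 T, ∃ γ : ℝ → ℝ → TangentBundle (𝓡∂ n) M, ∀ᶠ l in 𝓝[>] 0,
      IsGeodesicOn g (γ l) (Icc 0 δ) ∧ γ l 0 = ⟨y, v + l • u⟩ ∧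
      ∀ t ∈ Ioc 0 δ, (γ l t).proj ∈ (𝓡∂ n).interior M := by
  have hs : ∀ v : Vec n, (⟨y, v⟩ : TangentBundle (𝓡∂ n) M) ∈ (tchart y).source := fun v =>
    self_mem_tchart_source (⟨y, v⟩ : TangentBundle (𝓡∂ n) M)
  set z := extChartAt (𝓡∂ n) y y
  have hz : ∀ v : Vec n, tchart y (⟨y, v⟩ : TangentBundle (𝓡∂ n) M) = (z, v) := tchart_mk_self y
  have hζ : (z, v) ∈ (tchart y).target := by
    rw [← hz v]
    exact tchart_mem_target (hs v)
  obtain ⟨B, -⟩ := exists_flowBox g hζ Filter.univ_mem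
  have hε := B.ε_pos
  -- For times at most `1`, Gronwall bounds the distance of the two trajectories by `l * (‖u‖ *
  -- Real.exp B.K)`, so their velocities drift apart at rate at most `l * C`. The choice of `δ`
  -- keeps this drift below half of the initial gain `l * u 0`.
  set C := (B.K : ℝ) * (‖u‖ * Real.exp B.K)
  have hC : 0 ≤ C := by positivity
  set δ := min (min (T / 2) B.ε) (min 1 (u 0 / (2 * (C + 1))))
  have hδ : 0 < δ := lt_min (lt_min (half_pos hT) hε) (lt_min one_pos (by positivity))
  have hδT : δ ≤ T / 2 := (min_le_left _ _).trans (min_le_left _ _)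
  have hδε : δ ≤ B.ε := (min_le_left _ _).trans (min_le_right _ _)
  have hδ1 : δ ≤ 1 := (min_le_right _ _).trans (min_le_left _ _)
  have hδC : C * δ ≤ u 0 / 2 := by
    have h1 : δ ≤ u 0 / (2 * (C + 1)) := (min_le_right _ _).trans (min_le_right _ _)
    rw [le_div_iff₀ (by positivity)] at h1
    nlinarith
  have hsub : Icc 0 δ ⊆ Icc (-B.ε) B.ε := Icc_subset_Icc (by linarith) hδε
  have hball₀ : (z, v) ∈ closedBall (z, v) B.r := mem_closedBall_self B.r_pos.le
  refine ⟨δ, ⟨hδ, by linarith⟩, fun l t => (tchart y).symm (B.flow (z, v + l • u) (t - 0)), ?_⟩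
  have hball : ∀ᶠ l in 𝓝[>] (0 : ℝ), (z, v + l • u) ∈ closedBall (z, v) B.r := by
    have hcont : Filter.Tendsto (fun l : ℝ => (z, v + l • u)) (𝓝[>] 0) (𝓝 (z, v + (0 : ℝ) • u)) :=
      ((by fun_prop : Continuous fun l : ℝ => (z, v + l • u)).tendsto 0).mono_left
        nhdsWithin_le_nhds
    rw [zero_smul, add_zero] at hcont
    exact hcont (closedBall_mem_nhds _ B.r_pos)
  have hflow0 : ∀ t ∈ Icc 0 δ, 0 ≤ (B.flow (z, v) t).1 0 := fun t ht => by
    have h1 := B.eq_flow (h₀.mono (Icc_subset_Icc_right (by linarith : δ ≤ T))) (by linarith)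
      (by rw [h0]; exact hs v) (by rw [h0, hz]; exact hball₀) t ht
    rw [h0, hz, sub_zero] at h1
    rw [← h1.2]
    exact extChartAt_apply_zero_nonneg _ _
  filter_upwards [hball, self_mem_nhdsWithin] with l hl hl0
  have hl0 : 0 < l := hl0
  have hd : ∀ {ζ : Vec n × Vec n}, ζ ∈ closedBall (z, v) B.r → ∀ t ∈ Icc 0 δ,
      HasDerivWithinAt (B.flow ζ) (extField g y (B.flow ζ t)) (Icc 0 δ) t := fun hζ t ht =>
    (B.hasDerivWithinAt _ hζ t (hsub ht)).mono hsub
  have hdist : ∀ t ∈ Icc 0 δ, ‖B.flow (z, v + l • u) t - B.flow (z, v) t‖ ≤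
      l * (‖u‖ * Real.exp B.K) := fun t ht => by
    have h1 := dist_le_of_trajectories_ODE_of_mem (v := fun _ => extField g y)
      (s := fun _ => closedBall (z, v) B.a) (δ := l * ‖u‖) (fun _ _ => B.lipschitz)
      (HasDerivWithinAt.continuousOn (hd hl))
      (fun t ht => hasDerivWithinAt_Ici_of_Icc (hd hl t (Ico_subset_Icc_self ht)) ht)
      (fun t ht => B.mem _ hl _ (hsub (Ico_subset_Icc_self ht)))
      (HasDerivWithinAt.continuousOn (hd hball₀))
      (fun t ht => hasDerivWithinAt_Ici_of_Icc (hd hball₀ t (Ico_subset_Icc_self ht)) ht)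
      (fun t ht => B.mem _ hball₀ _ (hsub (Ico_subset_Icc_self ht)))
      (by
        rw [B.flow_zero _ hl, B.flow_zero _ hball₀, dist_eq_norm]
        have : 0 ≤ l * ‖u‖ := by positivity
        simpa [Prod.norm_def, norm_smul, abs_of_pos hl0] using this) t ht
    rw [dist_eq_norm, sub_zero] at h1
    refine h1.trans ?_
    rw [mul_assoc]
    have : (B.K : ℝ) * t ≤ B.K := mul_le_of_le_one_right B.K.coe_nonneg (ht.2.trans hδ1)
    gcongr
  -- No transversality of `θ₀` is used, since it may start tangentially. The gain over the
  -- unperturbed geodesic, which stays in the half space, is enough to move the perturbed one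
  -- inside.
  have hvel : ∀ t ∈ Icc 0 δ, l * (u 0 / 2) ≤
      (B.flow (z, v + l • u) t).2 0 - (B.flow (z, v) t).2 0 := fun t ht => by
    have h1 := norm_image_sub_le_of_norm_deriv_le_segment'
      (f := fun t => (B.flow (z, v + l • u) t).2 - (B.flow (z, v) t).2)
      (f' := fun t => (extField g y (B.flow (z, v + l • u) t)).2 -
        (extField g y (B.flow (z, v) t)).2) (a := 0) (b := δ) (C := l * C)
      (fun t ht => by
        have e1 : HasDerivWithinAt (fun t => (B.flow (z, v + l • u) t).2)
          (extField g y (B.flow (z, v + l • u) t)).2 (Icc 0 δ) t := (hd hl t ht).snd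
        have e2 : HasDerivWithinAt (fun t => (B.flow (z, v) t).2)
          (extField g y (B.flow (z, v) t)).2 (Icc 0 δ) t := (hd hball₀ t ht).snd
        exact e1.sub e2)
      (fun t ht => by
        have ht' := Ico_subset_Icc_self ht
        have e1 := B.lipschitz.dist_le_mul _ (B.mem _ hl _ (hsub ht')) _
          (B.mem _ hball₀ _ (hsub ht'))
        rw [dist_eq_norm, dist_eq_norm] at e1
        refine (norm_snd_le (extField g y (B.flow (z, v + l • u) t) -
          extField g y (B.flow (z, v) t))).trans (e1.trans ?_)
        refine (mul_le_mul_of_nonneg_left (hdist t ht') B.K.coe_nonneg).trans (le_of_eq ?_)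
        simp only [C]
        ring) t ht
    rw [B.flow_zero _ hl, B.flow_zero _ hball₀] at h1
    simp only [add_sub_cancel_left, sub_zero] at h1
    have h2 := (abs_le.1 ((abs_apply_zero_le_norm _).trans h1)).1
    simp only [PiLp.sub_apply, PiLp.smul_apply, smul_eq_mul] at h2
    have h3 : l * C * t ≤ l * (u 0 / 2) := by
      rw [mul_assoc]
      exact mul_le_mul_of_nonneg_left
        ((mul_le_mul_of_nonneg_left ht.2 hC).trans hδC) hl0.le
    linarith
  have hpos : ∀ t ∈ Icc 0 δ, l * (u 0 / 2) * t ≤ (B.flow (z, v + l • u) t).1 0 := fun t ht => by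
    have h1 := mul_sub_le_of_le_hasDerivWithinAt
      (f := fun t => (B.flow (z, v + l • u) t).1 0 - (B.flow (z, v) t).1 0) (a := 0) (b := δ)
      (fun t ht => ((B.hasDerivWithinAt_fst hl (hsub ht)).mono hsub).sub
        ((B.hasDerivWithinAt_fst hball₀ (hsub ht)).mono hsub)) hvel
      (s := 0) (t := t) ⟨le_rfl, hδ.le⟩ ht ht.1
    rw [B.flow_zero _ hl, B.flow_zero _ hball₀] at h1
    simp only [sub_zero, sub_self] at h1
    linarith [hflow0 t ht]
  have hm : 0 < l * (u 0 / 2) := by positivity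
  refine ⟨B.isGeodesicOn_symm hl (by linarith) (by linarith) fun t ht => ?_, ?_, fun t ht => ?_⟩
  · rw [sub_zero]
    exact (mul_nonneg hm.le ht.1).trans (hpos t ht)
  · simp only [sub_zero]
    rw [B.flow_zero _ hl, ← hz, (tchart y).left_inv (hs _)]
  · simp only [sub_zero]
    have ht' := Ioc_subset_Icc_self ht
    have h1 := (mul_pos hm ht.1).trans_le (hpos t ht')
    exact mem_interior_tchart_symm (B.target _ (B.mem _ hl _ (hsub ht')) h1.le) h1

/-- Geodesics near a geodesic that reaches the boundary transversally reach the boundary at about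
the same time. -/
theorem IsGeodesicOn.exists_nearby_arrival [T2Space M] {g : LorentzMetric n M}
    {θ₀ : ℝ → TangentBundle (𝓡∂ n) M} {T r₀ : ℝ} (h₀ : IsGeodesicOn g θ₀ (Icc 0 T)) (hr₀ : 0 ≤ r₀)
    (hr₀T : r₀ < T) (hintr : ∀ t ∈ Ioo 0 T, (θ₀ t).proj ∈ (𝓡∂ n).interior M)
    (hb : (θ₀ T).proj ∈ (𝓡∂ n).boundary M) (hV : normalCoord (θ₀ T).proj (θ₀ T).2 < 0)
    {ι : Type*} (F : Filter ι) :
    ∃ r ∈ Ioo r₀ T, ∀ ξ : ι → TangentBundle (𝓡∂ n) M, Filter.Tendsto ξ F (𝓝 (θ₀ r)) →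
      ∃ (γ : ι → ℝ → TangentBundle (𝓡∂ n) M) (T' : ι → ℝ), Filter.Tendsto T' F (𝓝 T) ∧
      ∀ᶠ i in F, r < T' i ∧ IsGeodesicOn g (γ i) (Icc r (T' i)) ∧ γ i r = ξ i ∧
        (∀ t ∈ Ico r (T' i), (γ i t).proj ∈ (𝓡∂ n).interior M) ∧
        (γ i (T' i)).proj ∈ (𝓡∂ n).boundary M ∧
        normalCoord (γ i (T' i)).proj (γ i (T' i)).2 < 0 := by
  have hT0 : 0 < T := hr₀.trans_lt hr₀T
  have hp := self_mem_tchart_source (θ₀ T)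
  rw [normalCoord_eq_tchart] at hV
  set p := (θ₀ T).proj
  set m := -(tchart p (θ₀ T)).2 0 / 2
  have hm : 0 < m := by simp only [m]; linarith
  have hN : {ζ : Vec n × Vec n | ζ.2 0 < -m} ∈ 𝓝 (tchart p (θ₀ T)) :=
    (isOpen_lt ((EuclideanSpace.proj (𝕜 := ℝ) (0 : Fin n)).continuous.comp
      continuous_snd) continuous_const).mem_nhds
      (show (tchart p (θ₀ T)).2 0 < -m by simp only [m]; linarith)
  obtain ⟨B, hBN, δ, hδ, hδε, hw⟩ := h₀.exists_window ⟨hT0.le, le_rfl⟩ hp hN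
  have hε := B.ε_pos
  obtain ⟨r, hr1, hr2⟩ := exists_between (max_lt hr₀T (by linarith : T - δ < T))
  have hr₀r := (le_max_left _ _).trans_lt hr1
  have hrδ := (le_max_right _ _).trans_lt hr1
  have hr0 : 0 < r := hr₀.trans_lt hr₀r
  obtain ⟨hrs, hrball⟩ := hw r ⟨hr0.le, hr2.le⟩ (abs_lt.2 ⟨by linarith, by linarith⟩)
  refine ⟨r, ⟨hr₀r, hr2⟩, fun ξ hξ => ?_⟩
  have hdecr : ∀ {ζ : Vec n × Vec n}, ζ ∈ closedBall (tchart p (θ₀ T)) B.r →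
      ∀ s ∈ Icc 0 B.ε, ∀ t ∈ Icc 0 B.ε, s ≤ t →
      m * (t - s) ≤ (B.flow ζ s).1 0 - (B.flow ζ t).1 0 := fun {ζ} hζ s hs t ht hst => by
    have h1 := mul_sub_le_of_le_hasDerivWithinAt (f := fun t => -(B.flow ζ t).1 0) (m := m)
      (fun t ht => (B.hasDerivWithinAt_fst_Icc hζ ht).neg) (fun t ht => by
        have h2 : (B.flow ζ t).2 0 < -m :=
          hBN (B.mem ζ hζ t ⟨by linarith [ht.1], ht.2⟩)
        linarith) hs ht hst
    linarith
  have hflowT := B.eq_flow (h₀.mono (Icc_subset_Icc_left hr0.le)) (by linarith) hrs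
    (ball_subset_closedBall hrball) T ⟨hr2.le, le_rfl⟩
  have hzT : (B.flow (tchart p (θ₀ r)) (T - r)).1 0 = 0 := by
    rw [← hflowT.2]
    exact (mem_boundary_iff_chart (mem_tchart_source.1 hp)).1 hb
  have hTrI : T - r ∈ Icc 0 B.ε := ⟨by linarith, by linarith⟩
  have hεI : B.ε ∈ Icc 0 B.ε := ⟨hε.le, le_rfl⟩
  have h0I : (0 : ℝ) ∈ Icc 0 B.ε := ⟨le_rfl, hε.le⟩
  have hzε : (B.flow (tchart p (θ₀ r)) B.ε).1 0 < 0 := by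
    have := hdecr (ball_subset_closedBall hrball) (T - r) hTrI B.ε hεI hTrI.2
    rw [hzT] at this
    have h2 : 0 < m * (B.ε - (T - r)) := mul_pos hm (by linarith)
    linarith
  have hlimz := (tendsto_tchart hrs).comp hξ
  have hball := hlimz (isOpen_ball.mem_nhds hrball)
  have hflowlim : ∀ t ∈ Icc 0 B.ε, Filter.Tendsto (fun i => (B.flow (tchart p (ξ i)) t).1 0) F
      (𝓝 ((B.flow (tchart p (θ₀ r)) t).1 0)) := fun t ht => by
    have ht' : t ∈ Icc (-B.ε) B.ε := ⟨by linarith [ht.1], ht.2⟩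
    have h1 := (B.continuousOn (tchart p (θ₀ r), t)
      ⟨ball_subset_closedBall hrball, ht'⟩).tendsto.comp
      (tendsto_nhdsWithin_iff.2 ⟨hlimz.prodMk_nhds (tendsto_const_nhds (x := t)), by
        filter_upwards [hball] with i hi using ⟨ball_subset_closedBall hi, ht'⟩⟩)
    exact (((EuclideanSpace.proj (𝕜 := ℝ) (0 : Fin n)).continuous.comp
      continuous_fst).tendsto _).comp h1
  have hr0pos : 0 < (tchart p (θ₀ r)).1 0 :=
    (mem_interior_iff_chart (mem_tchart_source.1 hrs)).1 (hintr r ⟨hr0, hr2⟩)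
  -- The extended flow continues past the boundary: along it the boundary coordinate is positive at
  -- `r` and negative after time `B.ε`, so the intermediate value theorem yields an arrival time.
  have hroot : ∀ᶠ i in F, ∃ t ∈ Ioo 0 B.ε, (B.flow (tchart p (ξ i)) t).1 0 = 0 := by
    have h1 := hflowlim 0 h0I
    rw [B.flow_zero _ (ball_subset_closedBall hrball)] at h1
    filter_upwards [hball, h1 (Ioi_mem_nhds hr0pos), hflowlim _ hεI (Iio_mem_nhds hzε)]
      with i h2 h3 h4
    have hc : ContinuousOn (fun t => (B.flow (tchart p (ξ i)) t).1 0) (Icc 0 B.ε) :=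
      HasDerivWithinAt.continuousOn fun t ht =>
        B.hasDerivWithinAt_fst_Icc (ball_subset_closedBall h2) ht
    exact intermediate_value_Ioo' hε.le hc ⟨h4, h3⟩
  have : ∀ i, ∃ t, (∃ t ∈ Ioo 0 B.ε, (B.flow (tchart p (ξ i)) t).1 0 = 0) →
      t ∈ Ioo 0 B.ε ∧ (B.flow (tchart p (ξ i)) t).1 0 = 0 := fun i => by
    by_cases h : ∃ t ∈ Ioo 0 B.ε, (B.flow (tchart p (ξ i)) t).1 0 = 0
    · obtain ⟨t, ht⟩ := h
      exact ⟨t, fun _ => ht⟩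
    · exact ⟨0, fun h' => absurd h' h⟩
  choose τ hτ using this
  refine ⟨fun i t => (tchart p).symm (B.flow (tchart p (ξ i)) (t - r)), fun i => r + τ i, ?_, ?_⟩
  -- The coordinate decreases at rate at least `m`, so the arrival time differs from `T` by at most
  -- the residual coordinate at time `T` divided by `m`.
  · have hlim : Filter.Tendsto (fun i => |(B.flow (tchart p (ξ i)) (T - r)).1 0| / m) F (𝓝 0) := by
      have h1 := ((hflowlim _ hTrI).abs).div_const m
      rwa [hzT, abs_zero, zero_div] at h1
    rw [tendsto_iff_dist_tendsto_zero]
    refine squeeze_zero' (Filter.Eventually.of_forall fun _ => dist_nonneg) ?_ hlim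
    filter_upwards [hball, hroot] with i h1 h2
    have h1 : tchart p (ξ i) ∈ closedBall (tchart p (θ₀ T)) B.r := ball_subset_closedBall h1
    obtain ⟨h3, h4⟩ := hτ i h2
    rw [le_div_iff₀ hm, Real.dist_eq, mul_comm]
    have h5 := le_abs_self ((B.flow (tchart p (ξ i)) (T - r)).1 0)
    have h6 := neg_abs_le ((B.flow (tchart p (ξ i)) (T - r)).1 0)
    rcases le_total (τ i) (T - r) with h | h
    · have h7 := hdecr h1 _ (Ioo_subset_Icc_self h3) _ hTrI h
      rw [abs_of_nonpos (by linarith)]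
      rw [h4] at h7
      linarith
    · have h7 := hdecr h1 _ hTrI _ (Ioo_subset_Icc_self h3) h
      rw [abs_of_nonneg (by linarith)]
      rw [h4] at h7
      linarith
  · filter_upwards [hball, hroot, hξ ((isOpen_tchart_source p).mem_nhds hrs)] with i h1 h2 h8
    have h1 : tchart p (ξ i) ∈ closedBall (tchart p (θ₀ T)) B.r := ball_subset_closedBall h1
    obtain ⟨h3, h4⟩ := hτ i h2
    have hpos : ∀ t ∈ Ico 0 (τ i), 0 < (B.flow (tchart p (ξ i)) t).1 0 := fun t ht => by
      have h7 := hdecr h1 t ⟨ht.1, ht.2.le.trans h3.2.le⟩ _ (Ioo_subset_Icc_self h3) ht.2.le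
      rw [h4] at h7
      have := mul_pos hm (sub_pos.2 ht.2)
      linarith
    have hnonneg : ∀ t ∈ Icc 0 (τ i), 0 ≤ (B.flow (tchart p (ξ i)) t).1 0 := fun t ht => by
      rcases eq_or_lt_of_le ht.2 with h | h
      · rw [h, h4]
      · exact (hpos t ⟨ht.1, h⟩).le
    have htarget : ∀ t ∈ Icc 0 (τ i), B.flow (tchart p (ξ i)) t ∈ (tchart p).target := fun t ht =>
      B.target _ (B.mem _ h1 t ⟨by linarith [ht.1], ht.2.trans h3.2.le⟩) (hnonneg t ht)
    have hτI : τ i ∈ Icc 0 (τ i) := ⟨h3.1.le, le_rfl⟩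
    refine ⟨by linarith [h3.1], B.isGeodesicOn_symm h1 (by linarith) (by linarith [h3.2])
      fun t ht => hnonneg _ ⟨by linarith [ht.1], by linarith [ht.2]⟩, ?_, fun t ht => ?_, ?_⟩
    · simp only [sub_self]
      rw [B.flow_zero _ h1, (tchart p).left_inv h8]
    · have h9 : t - r ∈ Ico 0 (τ i) := ⟨by linarith [ht.1], by linarith [ht.2]⟩
      exact mem_interior_tchart_symm (htarget _ (Ico_subset_Icc_self h9)) (hpos _ h9)
    · suffices h : ∀ η : TangentBundle (𝓡∂ n) M,
          η = (tchart p).symm (B.flow (tchart p (ξ i)) (τ i)) →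
          η.proj ∈ (𝓡∂ n).boundary M ∧ normalCoord η.proj η.2 < 0 from
        h _ (by simp only [add_sub_cancel_left])
      rintro _ rfl
      have h10 := htarget _ hτI
      have h11 : (tchart p).symm (B.flow (tchart p (ξ i)) (τ i)) ∈ (tchart p).source :=
        (tchart p).map_target h10
      have h12 := (tchart p).right_inv h10
      have hbd : ((tchart p).symm (B.flow (tchart p (ξ i)) (τ i))).proj ∈ (𝓡∂ n).boundary M := by
        refine (mem_boundary_iff_chart (mem_tchart_source.1 h11)).2 ?_
        have h13 := congrArg (fun ζ : Vec n × Vec n => ζ.1 0) h12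
        exact h13.trans h4
      refine ⟨hbd, ?_⟩
      rw [normalCoord_eq_tchart]
      refine (tchart_snd_zero_neg_iff h11 (self_mem_tchart_source _) hbd).1 ?_
      rw [h12]
      have h14 : (B.flow (tchart p (ξ i)) (τ i)).2 0 < -m :=
        hBN (B.mem _ h1 _ ⟨by linarith [h3.1], h3.2.le⟩)
      linarith

/-- Turning the initial vector of a scattering geodesic inward gives scattering geodesics. -/
theorem IsScatteringGeodesic.exists_nearby [T2Space M] {g : LorentzMetric n M}
    {θ₀ : ℝ → TangentBundle (𝓡∂ n) M} {T : ℝ} (h₀ : IsScatteringGeodesic g θ₀ T) {y : M}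
    {v u : Vec n} (h0 : θ₀ 0 = ⟨y, v⟩) (hu : 0 < u 0)
    (hV : normalCoord (θ₀ T).proj (θ₀ T).2 < 0) :
    ∃ (θ : ℝ → ℝ → TangentBundle (𝓡∂ n) M) (T' : ℝ → ℝ),
      Filter.Tendsto (fun l => θ l (T' l)) (𝓝[>] 0) (𝓝 (θ₀ T)) ∧
      ∀ᶠ l in 𝓝[>] 0, IsScatteringGeodesic g (θ l) (T' l) ∧ θ l 0 = ⟨y, v + l • u⟩ ∧
        normalCoord (θ l (T' l)).proj (θ l (T' l)).2 < 0 := by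
  -- Three pieces are joined: near the start by turning inward, on `[δ, r]` through the open
  -- interior, and near the end by the transversal arrival.
  obtain ⟨δ, hδ, γ₁, hγ₁⟩ := h₀.geodesic.exists_nearby_of_inward h₀.pos h0 hu
  obtain ⟨r, hr, hlast⟩ := h₀.geodesic.exists_nearby_arrival hδ.1.le hδ.2 h₀.interior h₀.boundary
    hV (𝓝[>] (0 : ℝ))
  have hlim0 : Filter.Tendsto (fun l : ℝ => (⟨y, v + l • u⟩ : TangentBundle (𝓡∂ n) M)) (𝓝[>] 0)
      (𝓝 (θ₀ 0)) := by
    have hd : HasDerivWithinAt (fun l : ℝ => v + l • u) ((1 : ℝ) • u) (Ioi 0) 0 :=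
      (((hasDerivAt_id (0 : ℝ)).smul_const u).const_add v).hasDerivWithinAt
    have h1 := (hasVariation_of_fiber g (y := y) hd).tendsto
    simp only [zero_smul, add_zero] at h1
    rw [h0]
    exact h1
  have hlim1 : Filter.Tendsto (fun l => γ₁ l δ) (𝓝[>] 0) (𝓝 (θ₀ δ)) := by
    refine (h₀.geodesic.mono (Icc_subset_Icc_right hδ.2.le)).tendsto_of_tendsto (σ := fun _ => δ)
      ⟨hδ.1.le, le_rfl⟩ tendsto_const_nhds (hγ₁.mono fun l hl => ⟨hδ.1.le, hl.1⟩) (hlim0.congr' ?_)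
    filter_upwards [hγ₁] with l hl using hl.2.1.symm
  have hsub : Icc δ r ⊆ Icc 0 T := Icc_subset_Icc hδ.1.le hr.2.le
  obtain ⟨γ₂, hγ₂⟩ := (h₀.geodesic.mono hsub).exists_nearby_interior hr.1.le
    (fun t ht => h₀.interior t ⟨hδ.1.trans_le ht.1, ht.2.trans_lt hr.2⟩) hlim1
  have hlim2 : Filter.Tendsto (fun l => γ₂ l r) (𝓝[>] 0) (𝓝 (θ₀ r)) := by
    refine (h₀.geodesic.mono hsub).tendsto_of_tendsto (σ := fun _ => r) ⟨hr.1.le, le_rfl⟩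
      tendsto_const_nhds (hγ₂.mono fun l hl => ⟨hr.1.le, hl.1⟩) (hlim1.congr' ?_)
    filter_upwards [hγ₂] with l hl using hl.2.1.symm
  obtain ⟨γ₃, T', hT', hγ₃⟩ := hlast _ hlim2
  set θ₁ : ℝ → ℝ → TangentBundle (𝓡∂ n) M := fun l t => if t ≤ δ then γ₁ l t else γ₂ l t
  set θ : ℝ → ℝ → TangentBundle (𝓡∂ n) M := fun l t => if t ≤ r then θ₁ l t else γ₃ l t
  have hall : ∀ᶠ l in 𝓝[>] 0, IsScatteringGeodesic g (θ l) (T' l) ∧ θ l 0 = ⟨y, v + l • u⟩ ∧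
      normalCoord (θ l (T' l)).proj (θ l (T' l)).2 < 0 := by
    filter_upwards [hγ₁, hγ₂, hγ₃] with l h1 h2 h3
    obtain ⟨h31, h32, h33, h34, h35, h36⟩ := h3
    have hθT : θ l (T' l) = γ₃ l (T' l) := by simp only [θ, not_le.2 h31, if_false]
    have hr0 : 0 ≤ r := hδ.1.le.trans hr.1.le
    have hg1 : IsGeodesicOn g (θ₁ l) (Icc 0 r) := h1.1.concat hδ.1.le hr.1.le h2.1 h2.2.1.symm
    refine ⟨⟨hr0.trans_lt h31, hg1.concat hr0 h31.le h32 ?_, fun t ht => ?_, ?_⟩, ?_, ?_⟩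
    · simp only [θ₁, not_le.2 hr.1, if_false, h33]
    · by_cases htr : t ≤ r
      · by_cases htδ : t ≤ δ
        · simp only [θ, θ₁, htr, htδ, if_true]
          exact h1.2.2 t ⟨ht.1, htδ⟩
        · simp only [θ, θ₁, htr, htδ, if_true, if_false]
          exact h2.2.2 t ⟨(not_le.1 htδ).le, htr⟩
      · simp only [θ, htr, if_false]
        exact h34 t ⟨(not_le.1 htr).le, ht.2⟩
    · rw [hθT]
      exact h35
    · simp only [θ, θ₁, hr0, hδ.1.le, if_true]
      exact h1.2.1
    · rw [hθT]
      exact h36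
  refine ⟨θ, T', h₀.geodesic.tendsto_of_tendsto ⟨h₀.pos.le, le_rfl⟩ hT'
    (hall.mono fun l hl => ⟨hl.1.pos.le, hl.1.geodesic⟩) (hlim0.congr' ?_), hall⟩
  filter_upwards [hall] with l hl using hl.2.1.symm

/-! ### Existence of scattering families -/

theorem isGeodesicOn_const (g : LorentzMetric n M) (y : M) (s : Set ℝ) :
    IsGeodesicOn g (fun _ => (⟨y, (0 : Vec n)⟩ : TangentBundle (𝓡∂ n) M)) s := by
  refine (isGeodesicOn_iff g).2 ⟨continuousOn_const, fun t _ =>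
    ⟨y, self_mem_tchart_source (⟨y, (0 : Vec n)⟩ : TangentBundle (𝓡∂ n) M), ?_⟩⟩
  have h : geodesicField g y (tchart y (⟨y, (0 : Vec n)⟩ : TangentBundle (𝓡∂ n) M)) = 0 := by
    rw [tchart_mk_self]
    have h0 : christoffelForm (metricForm g y) (range (𝓡∂ n)) (extChartAt (𝓡∂ n) y y) 0 = 0 := by
      ext b
      simp [christoffelForm_apply, formDeriv]
    refine Prod.ext rfl ?_
    change -(metricForm g y _).inverse (christoffelForm _ _ _ (0 : Vec n)) = 0
    rw [h0, map_zero, neg_zero]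
  rw [h]
  exact hasDerivWithinAt_const _ _ _

/-- With zero velocity the geodesic would be constant and never enter the interior. -/
theorem IsScatteringGeodesic.snd_ne_zero [T2Space M] {g : LorentzMetric n M}
    {θ : ℝ → TangentBundle (𝓡∂ n) M} {T : ℝ} (h : IsScatteringGeodesic g θ T)
    (h0 : (θ 0).proj ∈ (𝓡∂ n).boundary M) : (θ 0).2 ≠ 0 := by
  intro hz
  have heq : θ 0 = ⟨(θ 0).proj, (0 : Vec n)⟩ := by
    rw [show θ 0 = ⟨(θ 0).proj, (θ 0).2⟩ from rfl, hz]
    rfl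
  have h1 := h.geodesic.eqOn (isGeodesicOn_const g (θ 0).proj _) heq
    (x := T / 2) ⟨by linarith [h.pos], by linarith [h.pos]⟩
  have h2 := h.interior (T / 2) ⟨by linarith [h.pos], by linarith [h.pos]⟩
  rw [h1] at h2
  exact notMem_boundary_of_interior h2 h0

/-- A lightlike vector that does not point inward can be turned outward and timelike. -/
theorem exists_turning_vector {g : LorentzMetric n M} (hbd : HasTimelikeBoundary g) {y : M}
    (hy : y ∈ (𝓡∂ n).boundary M) {w : TangentSpace (𝓡∂ n) y} (hw : w ≠ 0)
    (hlight : g.inner y w w = 0) (hout : normalCoord y w ≤ 0) :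
    ∃ u : TangentSpace (𝓡∂ n) y, g.inner y w u = -1 ∧ normalCoord y u < 0 := by
  rcases eq_or_lt_of_le hout with h | h
  -- Glancing case: the boundary metric is nondegenerate, so a tangential vector already has nonzero
  -- product with `w`. Adding the normal, which is orthogonal to `w`, makes the vector point
  -- outward.
  · obtain ⟨u', hu', hne⟩ : ∃ u', TangentToBoundary y u' ∧ g.inner y w u' ≠ 0 := by
      by_contra hcon
      push Not at hcon
      exact hw ((hbd y hy).eq_zero h hcon (g.symm y))
    obtain ⟨ν, hν⟩ := exists_isOutwardUnitNormal hbd hy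
    refine ⟨(-(g.inner y w u')⁻¹) • u' + ν, ?_, ?_⟩
    · rw [map_add, map_smul, g.symm y w ν, hν.normal w h, smul_eq_mul, add_zero, neg_mul,
        inv_mul_cancel₀ hne]
    · rw [normalCoord_add, normalCoord_smul, show normalCoord y u' = 0 from hu', mul_zero, zero_add]
      exact hν.outward
  -- Transversal case: adding a large multiple of `w` makes the vector point outward without
  -- changing the product, since `w` is null.
  · obtain ⟨u', hne⟩ : ∃ u', g.inner y w u' ≠ 0 := by
      by_contra hcon
      push Not at hcon
      exact hw ((g.lorentzian y).eq_zero trivial (fun u _ => hcon u) (g.symm y))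
    obtain ⟨u₁, h1⟩ : ∃ u₁, g.inner y w u₁ = -1 := ⟨(-(g.inner y w u')⁻¹) • u', by
      rw [map_smul, smul_eq_mul, neg_mul, inv_mul_cancel₀ hne]⟩
    refine ⟨u₁ + ((|normalCoord y u₁| + 1) / -normalCoord y w) • w, ?_, ?_⟩
    · rw [map_add, map_smul, hlight, smul_zero, add_zero, h1]
    · rw [normalCoord_add, normalCoord_smul, div_mul_eq_mul_div, mul_div_assoc,
        div_neg, div_self h.ne]
      linarith [le_abs_self (normalCoord y u₁)]

theorem tendsto_tneg {ξ : TangentBundle (𝓡∂ n) M} :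
    Filter.Tendsto (tneg (n := n) (M := M)) (𝓝 ξ) (𝓝 (tneg ξ)) := by
  have hs := self_mem_tchart_source ξ
  have hs' : tneg ξ ∈ (tchart ξ.proj).source := mem_tchart_source.2 (mem_tchart_source.1 hs)
  have h1 : Filter.Tendsto (fun η => tchart ξ.proj (tneg η)) (𝓝 ξ) (𝓝 (tchart ξ.proj (tneg ξ))) := by
    simp only [tchart_tneg]
    exact ((by fun_prop : Continuous fun ζ : Vec n × Vec n => (ζ.1, -ζ.2)).tendsto _).comp
      (tendsto_tchart hs)
  have h2 := (continuousAt_tchart_symm hs').tendsto.comp h1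
  rw [(tchart ξ.proj).left_inv hs'] at h2
  refine h2.congr' ?_
  filter_upwards [(isOpen_tchart_source ξ.proj).mem_nhds hs] with η hη
  exact (tchart ξ.proj).left_inv (mem_tchart_source.2 (mem_tchart_source.1 hη))

/-- Through every lightlike inward vector there is a scattering family. -/
theorem exists_isScatteringFamily [T2Space M] {g : LorentzMetric n M}
    (hbd : HasTimelikeBoundary g) {U : Set (TangentBundle (𝓡∂ n) M)}
    (hU : IsNonTrappingConicNhd g U) {ξ : TangentBundle (𝓡∂ n) M}
    (hξ : ξ ∈ lightTM g ∩ inwardTM g) :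
    ∃ y ε w α, IsScatteringFamily g U y ε w α ∧ α 0 = ξ := by
  have hξU : ξ ∈ U := hU.light_subset ⟨hξ.1, hξ.2.1⟩
  obtain ⟨⟨y, w⟩, hη⟩ := (hU.nonTrapping ξ hξU).exists_interiorScattering hξ.2
  obtain ⟨β, T, hβ, hβ0, hβT, -⟩ := hη.exists_geodesic
  have hrev := hβ.reverse (by rw [hβ0]; exact hξ.2.1)
  set θ₀ : ℝ → TangentBundle (𝓡∂ n) M := fun t => tneg (β (T - t)) with hθ₀def
  have hθ₀0 : θ₀ 0 = ⟨y, -w⟩ := by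
    simp only [hθ₀def, sub_zero, hβT]
    rfl
  have hθ₀T : θ₀ T = tneg ξ := by simp only [hθ₀def, sub_self, hβ0]
  have hy : y ∈ (𝓡∂ n).boundary M := by
    have := hβ.boundary
    rwa [hβT] at this
  have hw0 : w ≠ 0 := by
    have h1 := hrev.snd_ne_zero (by rw [hθ₀0]; exact hy)
    rw [hθ₀0] at h1
    exact fun h => h1 (by rw [h]; exact neg_zero)
  -- Only the weak inequality is available: the lightlike geodesic may arrive tangentially.
  have hwout : normalCoord y w ≤ 0 := by
    have h1 := hrev.geodesic.normalCoord_nonneg hrev.pos (by rw [hθ₀0]; exact hy)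
    rw [hθ₀0] at h1
    have h2 : 0 ≤ -normalCoord y w := h1
    linarith
  have hwlight : g.inner y w w = 0 := by
    have h1 := hβ.geodesic.sq_eq (t := T) ⟨hβ.pos.le, le_rfl⟩
    rw [hβT, hβ0, hξ.1.2] at h1
    exact h1
  obtain ⟨u, hwu, hu⟩ := exists_turning_vector hbd hy hw0 hwlight hwout
  have hV : normalCoord (θ₀ T).proj (θ₀ T).2 < 0 := by
    rw [hθ₀T]
    exact neg_neg_of_pos (normalCoord_pos_of_mem_inwardTM hξ.2)
  obtain ⟨θ, T', hlim, hθ⟩ := hrev.exists_nearby (u := -(show Vec n from u)) hθ₀0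
    (neg_pos.2 hu) hV
  set W : ℝ → Vec n := fun l => (show Vec n from w) + l • (show Vec n from u) with hWdef
  have hW0 : W 0 = w := by
    have h1 : ∀ a b : Vec n, a + (0 : ℝ) • b = a := fun a b => by rw [zero_smul, add_zero]
    exact h1 w u
  set A : ℝ → TangentBundle (𝓡∂ n) M := fun l => tneg (θ l (T' l)) with hAdef
  have hAlim : Filter.Tendsto A (𝓝[>] 0) (𝓝 ξ) := by
    have h1 := tendsto_tneg.comp hlim
    rwa [hθ₀T, tneg_tneg] at h1
  have hsq : ∀ l, g.sq (⟨y, W l⟩ : TangentBundle (𝓡∂ n) M) = -2 * l + l ^ 2 * g.inner y u u := by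
    intro l
    have h1 : g.inner y (w + l • u) (w + l • u) = -2 * l + l ^ 2 * g.inner y u u := by
      rw [map_add, map_smul, g.symm y (w + l • u) w, g.symm y (w + l • u) u, map_add, map_add,
        map_smul, map_smul, hwlight, hwu, g.symm y u w, hwu]
      simp only [smul_eq_mul]
      ring
    exact h1
  have htime : ∀ᶠ l in 𝓝[>] (0 : ℝ), g.sq (⟨y, W l⟩ : TangentBundle (𝓡∂ n) M) < 0 := by
    have hq : Filter.Tendsto (fun l : ℝ => -2 + l * g.inner y u u) (𝓝[>] 0)
        (𝓝 (-2 + 0 * g.inner y u u)) :=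
      ((by fun_prop : Continuous fun l : ℝ => -2 + l * g.inner y u u).tendsto 0).mono_left
        nhdsWithin_le_nhds
    filter_upwards [hq (Iio_mem_nhds (show -2 + 0 * g.inner y u u < 0 by norm_num)),
      self_mem_nhdsWithin] with l h1 h2
    have h1 : -2 + l * g.inner y u u < 0 := h1
    have h2 : 0 < l := h2
    rw [hsq]
    have := mul_neg_of_pos_of_neg h2 h1
    linarith
  obtain ⟨O, hO, hUO⟩ := hU.isOpen
  -- Openness of `U` relative to the boundary vectors brings the nearby initial vectors into `U`.
  have hAO : ∀ᶠ l in 𝓝[>] (0 : ℝ), A l ∈ O := hAlim (hO.mem_nhds (hUO ▸ hξU).1)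
  have hmain : ∀ᶠ l in 𝓝[>] (0 : ℝ), (⟨y, W l⟩ : TangentBundle (𝓡∂ n) M) ∈ outwardTM g ∧
      g.sq (⟨y, W l⟩ : TangentBundle (𝓡∂ n) M) < 0 ∧ A l ∈ inwardCausal g U ∧
      InteriorScattering g (A l) ⟨y, W l⟩ := by
    filter_upwards [hθ, htime, hAO, self_mem_nhdsWithin] with l h1 h2 h3 h4
    obtain ⟨h5, h6, h7⟩ := h1
    have h4 : 0 < l := h4
    have hr := h5.reverse (by rw [h6]; exact hy)
    obtain ⟨ψ, hψ⟩ : ∃ ψ : ℝ → TangentBundle (𝓡∂ n) M, ψ = fun t => tneg (θ l (T' l - t)) :=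
      ⟨_, rfl⟩
    rw [← hψ] at hr
    have hr0 : ψ 0 = A l := by simp only [hψ, sub_zero, hAdef]
    have hrT : ψ (T' l) = ⟨y, W l⟩ := by
      simp only [hψ, sub_self, h6]
      refine congrArg (fun a : Vec n => (⟨y, a⟩ : TangentBundle (𝓡∂ n) M)) ?_
      change -(-(show Vec n from w) + l • -(show Vec n from u)) = _
      rw [smul_neg, neg_add, neg_neg, neg_neg]
    have hAb : (A l).proj ∈ (𝓡∂ n).boundary M := h5.boundary
    obtain ⟨ν, hν⟩ := exists_isOutwardUnitNormal hbd hAb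
    obtain ⟨ν', hν'⟩ := exists_isOutwardUnitNormal hbd hy
    have hAn : 0 < normalCoord (A l).proj (A l).2 := neg_pos.2 h7
    have hAin : A l ∈ inwardTM g := mem_inwardTM_of_normalCoord_pos hAb hν hAn
    have hscat := hr.interiorScattering (by rw [hr0]; exact hAin)
    rw [hr0, hrT] at hscat
    have hAsq : g.sq (A l) = g.sq (⟨y, W l⟩ : TangentBundle (𝓡∂ n) M) := by
      have := hr.geodesic.sq_eq (t := T' l) ⟨hr.pos.le, le_rfl⟩
      rw [hr0, hrT] at this
      exact this.symm
    refine ⟨mem_outwardTM_of_normalCoord_neg (ξ := (⟨y, W l⟩ : TangentBundle (𝓡∂ n) M)) hy hν' ?_,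
      h2, ⟨⟨?_, ?_, ?_⟩, hAin⟩, hscat⟩
    · have h8 : normalCoord y (w + l • u) < 0 := by
        rw [normalCoord_add, normalCoord_smul]
        have := mul_neg_of_pos_of_neg h4 hu
        linarith
      exact h8
    · rw [hUO]
      exact ⟨h3, hAb⟩
    · intro h0
      rw [h0] at hAn
      exact lt_irrefl _ hAn
    · rw [hAsq]
      exact h2.le
  obtain ⟨ε, hε, hεsub⟩ := mem_nhdsGT_iff_exists_Ioo_subset.1 hmain
  have hε : 0 < ε := hε
  -- The constructed curves are controlled only for small positive `l`, so the value at zero is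
  -- prescribed.
  set α : ℝ → TangentBundle (𝓡∂ n) M := Function.update A 0 ξ with hαdef
  have hα0 : α 0 = ξ := Function.update_self ..
  have hαl : ∀ l ∈ Ioo 0 ε, α l = A l := fun l hl => Function.update_of_ne hl.1.ne' ..
  have hcases : ∀ l ∈ Ico 0 ε, l = 0 ∨ l ∈ Ioo 0 ε := fun l hl =>
    (eq_or_lt_of_le hl.1).imp Eq.symm fun h => ⟨h, hl.2⟩
  refine ⟨y, ε, W, α, ⟨hε, ?_, fun l hl => (hεsub hl).1, fun l hl => (hεsub hl).2.1, ?_, ?_, ?_,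
    fun l hl => ?_, fun l hl => ?_⟩, hα0⟩
  · exact ContDiff.contDiffOn (by fun_prop)
  · simp only [hsq]
    have h1 : HasDerivAt (fun l : ℝ => -2 * l + l ^ 2 * g.inner y u u)
        (-2 * 1 + ((2 : ℕ) * (0 : ℝ) ^ (2 - 1) * 1) * g.inner y u u) 0 :=
      ((hasDerivAt_id (0 : ℝ)).const_mul (-2)).add
        (((hasDerivAt_id (0 : ℝ)).pow 2).mul_const _)
    have h2 := h1.hasDerivWithinAt (s := Ico 0 ε)
    simpa using h2
  · rw [hα0]
    exact hξ.1
  · have h1 : ContinuousWithinAt α (Ioi 0) 0 := by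
      rw [ContinuousWithinAt, hα0]
      refine hAlim.congr' ?_
      filter_upwards [Ioo_mem_nhdsGT hε] with l hl using (hαl l hl).symm
    exact (continuousWithinAt_Ioi_iff_Ici.1 h1).mono Ico_subset_Ici_self
  · rcases hcases l hl with rfl | h
    · rw [hα0]
      exact ⟨⟨hξU, hξ.1.1, hξ.1.2.le⟩, hξ.2⟩
    · rw [hαl l h]
      exact (hεsub h).2.2.1
  · rcases hcases l hl with rfl | h
    · rw [hα0, hW0]
      exact hη
    · rw [hαl l h]
      exact (hεsub h).2.2.2

theorem IsOutwardUnitNormal.inner_congr {g : LorentzMetric n M} {x : M}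
    (hx : x ∈ (𝓡∂ n).boundary M) {ν ν' : TangentSpace (𝓡∂ n) x} (hν : IsOutwardUnitNormal g x ν)
    (hν' : IsOutwardUnitNormal g x ν') (v : TangentSpace (𝓡∂ n) x) :
    g.inner x v ν = g.inner x v ν' :=
  (hν.inner_eq_chart (mem_extChartAt_source x) hx v).trans
    (hν'.inner_eq_chart (mem_extChartAt_source x) hx v).symm

/-- The normal component is negative at `l = 0` and continuous; half its limit is a uniform bound.
This bound, unlike continuity of the vectors, visibly passes to the image under a boundary isometry.
-/
theorem IsScatteringFamily.exists_inner_normal_le {g : LorentzMetric n M}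
    (hbd : HasTimelikeBoundary g) {U : Set (TangentBundle (𝓡∂ n) M)} {y : M} {ε : ℝ}
    {w : ℝ → Vec n} {α : ℝ → TangentBundle (𝓡∂ n) M} (h : IsScatteringFamily g U y ε w α) :
    ∃ c > 0, ∀ᶠ l in 𝓝[>] (0 : ℝ), ∀ ν, IsOutwardUnitNormal g (α l).proj ν →
      g.inner (α l).proj (α l).2 ν ≤ -c := by
  have hin : ∀ l ∈ Ico 0 ε, α l ∈ inwardTM g := fun l hl => (h.mem l hl).2
  have h0 := hin 0 ⟨le_rfl, h.pos⟩
  obtain ⟨ν₀, hν₀, hneg⟩ := h0.2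
  have hIoo : ∀ᶠ l in 𝓝[>] (0 : ℝ), l ∈ Ioo 0 ε := Ioo_mem_nhdsGT h.pos
  have hbdry : ∀ᶠ l in 𝓝[>] (0 : ℝ), (α l).proj ∈ (𝓡∂ n).boundary M := by
    filter_upwards [hIoo] with l hl using (hin l (Ioo_subset_Ico_self hl)).1
  have hlim : Filter.Tendsto α (𝓝[>] 0) (𝓝 (α 0)) :=
    h.continuousAt.mono_of_mem_nhdsWithin
      (Filter.mem_of_superset (Ioo_mem_nhdsGT h.pos) Ioo_subset_Ico_self)
  have hnormal : ∀ l, ∃ ν, (α l).proj ∈ (𝓡∂ n).boundary M → IsOutwardUnitNormal g (α l).proj ν := by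
    intro l
    by_cases hl : (α l).proj ∈ (𝓡∂ n).boundary M
    · exact (exists_isOutwardUnitNormal hbd hl).imp fun _ hν _ => hν
    · exact ⟨0, fun h => absurd h hl⟩
  choose ν hν using hnormal
  have h1 := tendsto_inner_normal hbd hlim hbdry h0.1 (hbdry.mono hν) hν₀
  refine ⟨-(g.inner (α 0).proj (α 0).2 ν₀) / 2, by linarith, ?_⟩
  filter_upwards [hbdry, h1 (Iio_mem_nhds (show g.inner (α 0).proj (α 0).2 ν₀ <
    g.inner (α 0).proj (α 0).2 ν₀ / 2 by linarith))] with l hl hlt ν' hν'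
  have hlt : g.inner (α l).proj (α l).2 (ν l) < g.inner (α 0).proj (α 0).2 ν₀ / 2 := hlt
  rw [hν'.inner_congr hl (hν l hl)]
  linarith

theorem IsScatteringFamily.hasDerivWithinAt {g : LorentzMetric n M}
    {U : Set (TangentBundle (𝓡∂ n) M)} {y : M} {ε : ℝ}
    {w : ℝ → Vec n} {α : ℝ → TangentBundle (𝓡∂ n) M} (h : IsScatteringFamily g U y ε w α) :
    ∃ w', HasDerivWithinAt w w' (Ioi 0) 0 := by
  have h1 := (h.smooth.differentiableOn (by simp)) 0 ⟨le_rfl, h.pos⟩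
  exact ⟨_, h1.hasDerivWithinAt.mono_of_mem_nhdsWithin
    (Filter.mem_of_superset (Ioo_mem_nhdsGT h.pos) Ioo_subset_Ico_self)⟩

theorem IsScatteringFamily.continuousWithinAt_proj {g : LorentzMetric n M}
    {U : Set (TangentBundle (𝓡∂ n) M)} {y : M} {ε : ℝ}
    {w : ℝ → Vec n} {α : ℝ → TangentBundle (𝓡∂ n) M} (h : IsScatteringFamily g U y ε w α) :
    ContinuousWithinAt (fun l => (α l).proj) (Ico 0 ε) 0 :=
  (FiberBundle.continuous_proj (Vec n) (TangentSpace (𝓡∂ n) : M → Type _)).continuousAt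
    |>.comp_continuousWithinAt h.continuousAt

theorem IsScatteringFamily.travelTime [T2Space M] {g : LorentzMetric n M}
    (hbd : HasTimelikeBoundary g) {U : Set (TangentBundle (𝓡∂ n) M)} {y : M} {ε : ℝ}
    {w : ℝ → Vec n} {α : ℝ → TangentBundle (𝓡∂ n) M} (h : IsScatteringFamily g U y ε w α) :
    ∃ x' : ℝ →L[ℝ] TangentSpace (𝓡∂ n) (α 0).proj,
      HasMFDerivWithinAt 𝓘(ℝ, ℝ) (𝓡∂ n) (fun l => (α l).proj) (Ico 0 ε) 0 x' ∧
      interiorTravelTime g (α 0) = (g.inner (α 0).proj (x' 1) (α 0).2 : ℝ) := by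
  obtain ⟨c, hc, hnorm⟩ := h.exists_inner_normal_le hbd
  obtain ⟨w', hw'⟩ := h.hasDerivWithinAt
  exact travelTime_formula hbd h.pos hw' h.deriv_sq h.light.2 h.continuousWithinAt_proj hc hnorm
    h.scattering

/-! ### Boundary isometries -/

variable {M' : Type*} [TopologicalSpace M'] [ChartedSpace (EuclideanHalfSpace n) M']
variable [IsManifold (𝓡∂ n) ∞ M']

namespace BoundaryIsometry

variable {g : LorentzMetric n M} {g' : LorentzMetric n M'} (Φ : BoundaryIsometry g g')

theorem mem_boundary {x : M} (hx : x ∈ (𝓡∂ n).boundary M) : Φ.φ x ∈ (𝓡∂ n).boundary M' := by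
  rw [← Φ.target_eq]
  exact Φ.φ.map_source (by rwa [Φ.source_eq])

/-- Along a line in the boundary, the boundary coordinate of the image is nonnegative and vanishes
at the base point. It has a minimum there, so its derivative is zero. -/
theorem push_tangent {x : M} (hx : x ∈ (𝓡∂ n).boundary M) {u : TangentSpace (𝓡∂ n) x}
    (hu : TangentToBoundary x u) : TangentToBoundary (Φ.φ x) (Φ.push x u) := by
  have hf := (Φ.hasMFDerivWithinAt x hx).2
  obtain ⟨u₀, rfl⟩ : ∃ u₀ : Vec n, u₀ = u := ⟨u, rfl⟩
  have hu0 : u₀ 0 = 0 := hu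
  set z : Vec n := extChartAt (𝓡∂ n) x x with hz
  have hz0 : z 0 = 0 := (mem_boundary_iff_chart (mem_extChartAt_source x)).1 hx
  have hc : HasDerivWithinAt (fun t : ℝ => z + t • u₀) u₀ univ 0 := by
    have h := ((hasDerivAt_id (0 : ℝ)).smul_const u₀).const_add z
    rw [one_smul] at h
    exact h.hasDerivWithinAt
  have hline : ∀ t : ℝ, (z + t • u₀) 0 = 0 := fun t => by
    simp only [PiLp.add_apply, PiLp.smul_apply, smul_eq_mul, hz0, hu0, mul_zero, zero_add]
  have hrange : ∀ t : ℝ, z + t • u₀ ∈ range (𝓡∂ n) := fun t => mem_range_iff.2 (hline t).ge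
  have hmem : ∀ᶠ t in 𝓝[univ] (0 : ℝ), z + t • u₀ ∈
      (extChartAt (𝓡∂ n) x).symm ⁻¹' (𝓡∂ n).boundary M ∩ range (𝓡∂ n) := by
    have h1 : Filter.Tendsto (fun t : ℝ => z + t • u₀) (𝓝[univ] 0) (𝓝[range (𝓡∂ n)] z) := by
      refine tendsto_nhdsWithin_iff.2 ⟨?_, Filter.Eventually.of_forall hrange⟩
      have := hc.continuousWithinAt.tendsto
      simpa using this
    filter_upwards [h1 (extChartAt_target_mem_nhdsWithin x)] with t ht
    have ht : z + t • u₀ ∈ (extChartAt (𝓡∂ n) x).target := ht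
    refine ⟨(mem_boundary_iff_chart ((extChartAt (𝓡∂ n) x).map_target ht)).2 ?_, hrange t⟩
    rw [(extChartAt (𝓡∂ n) x).right_inv ht]
    exact hline t
  have hz' : z + (0 : ℝ) • u₀ = z := by rw [zero_smul, add_zero]
  have hf' : HasFDerivWithinAt (𝕜 := ℝ) (E := Vec n) (F := Vec n)
      (writtenInExtChartAt (𝓡∂ n) (𝓡∂ n) x Φ.φ) (show Vec n →L[ℝ] Vec n from Φ.push x)
      ((extChartAt (𝓡∂ n) x).symm ⁻¹' (𝓡∂ n).boundary M ∩ range (𝓡∂ n)) (z + (0 : ℝ) • u₀) := by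
    rw [hz']
    exact hf
  have h2 := hasDerivWithinAt_comp_of_eventually_mem (f := fun t : ℝ => z + t • u₀) (x := 0)
    hf' hc hmem
  have h3 := (hasDerivWithinAt_apply_zero h2).hasDerivAt Filter.univ_mem
  refine IsLocalMin.hasDerivAt_eq_zero (Filter.Eventually.of_forall fun t => ?_) h3
  have h0 : writtenInExtChartAt (𝓡∂ n) (𝓡∂ n) x Φ.φ (z + (0 : ℝ) • u₀) 0 = 0 := by
    rw [zero_smul, add_zero, writtenInExtChartAt, Function.comp_apply, Function.comp_apply, hz,
      extChartAt_to_inv]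
    exact (mem_boundary_iff_chart (mem_extChartAt_source _)).1 (Φ.mem_boundary hx)
  rw [h0]
  exact extChartAt_apply_zero_nonneg _ _

/-- The splitting into tangential and normal parts is orthogonal on both sides and preserved by
`Φ.push`, which is isometric on each part. -/
theorem inner_push (hbd : HasTimelikeBoundary g) {x : M} (hx : x ∈ (𝓡∂ n).boundary M)
    (v w : TangentSpace (𝓡∂ n) x) :
    g'.inner (Φ.φ x) (Φ.push x v) (Φ.push x w) = g.inner x v w := by
  obtain ⟨ν, hν⟩ := exists_isOutwardUnitNormal hbd hx
  have hν' := Φ.push_normal x hx ν hν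
  have hdec : ∀ v : TangentSpace (𝓡∂ n) x, ∃ u a, TangentToBoundary x u ∧ v = u + a • ν :=
    fun v => ⟨_, normalCoord x v / normalCoord x ν, hν.tangent_sub v, (sub_add_cancel _ _).symm⟩
  obtain ⟨u, a, hu, rfl⟩ := hdec v
  obtain ⟨u', b, hu', rfl⟩ := hdec w
  have e1 : ∀ u, TangentToBoundary x u → g.inner x u ν = 0 := fun u hu =>
    (g.symm x u ν).trans (hν.normal u hu)
  have e2 : ∀ u, TangentToBoundary x u → g'.inner (Φ.φ x) (Φ.push x u) (Φ.push x ν) = 0 :=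
    fun u hu => (g'.symm _ _ _).trans (hν'.normal _ (Φ.push_tangent hx hu))
  simp only [map_add, map_smul, add_apply, smul_apply,
    smul_eq_mul]
  rw [Φ.isometry x hx u u' hu hu', e1 u hu, e2 u hu, hν.normal u' hu',
    hν'.normal _ (Φ.push_tangent hx hu'), hν.unit, hν'.unit]

theorem sq_map (hbd : HasTimelikeBoundary g) {ξ : TangentBundle (𝓡∂ n) M}
    (hξ : ξ ∈ boundaryTM n M) : g'.sq (Φ.map ξ) = g.sq ξ :=
  Φ.inner_push hbd hξ _ _

theorem map_mem_inwardTM (hbd : HasTimelikeBoundary g) {ξ : TangentBundle (𝓡∂ n) M}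
    (hξ : ξ ∈ inwardTM g) : Φ.map ξ ∈ inwardTM g' := by
  obtain ⟨hb, ν, hν, hneg⟩ := hξ
  exact ⟨Φ.mem_boundary hb, Φ.push _ ν, Φ.push_normal _ hb ν hν,
    (Φ.inner_push hbd hb _ _).trans_lt hneg⟩

theorem snd_ne_zero_of_mem_inwardTM {ξ : TangentBundle (𝓡∂ n) M} (hξ : ξ ∈ inwardTM g) :
    ξ.2 ≠ 0 := by
  intro h
  have h1 := normalCoord_pos_of_mem_inwardTM hξ
  rw [h] at h1
  exact lt_irrefl _ h1

/-- For surjectivity, a lightlike inward vector of `g'` lies in the image of the inward causal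
vectors in `U`, and its preimage is lightlike because scalar squares are preserved. -/
theorem map_image_light (hbd : HasTimelikeBoundary g) {U : Set (TangentBundle (𝓡∂ n) M)}
    {U' : Set (TangentBundle (𝓡∂ n) M')} (hU' : IsNonTrappingConicNhd g' U')
    (himage : Φ.map '' inwardCausal g U = inwardCausal g' U') :
    Φ.map '' (lightTM g ∩ inwardTM g) = lightTM g' ∩ inwardTM g' := by
  apply Subset.antisymm
  · rintro _ ⟨ξ, ⟨hlight, hin⟩, rfl⟩
    have h := Φ.map_mem_inwardTM hbd hin
    exact ⟨⟨snd_ne_zero_of_mem_inwardTM h, (Φ.sq_map hbd hin.1).trans hlight.2⟩, h⟩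
  · intro η hη
    have h : η ∈ inwardCausal g' U' :=
      ⟨⟨hU'.light_subset ⟨hη.1, hη.2.1⟩, hη.1.1, hη.1.2.le⟩, hη.2⟩
    rw [← himage] at h
    obtain ⟨ξ, hξ, rfl⟩ := h
    exact ⟨ξ, ⟨⟨hξ.1.2.1, (Φ.sq_map hbd hξ.2.1).symm.trans hη.1.2⟩, hξ.2⟩, rfl⟩

/-- A boundary isometry that intertwines the scattering relations on the inward causal vectors
preserves the travel times of lightlike vectors. -/
theorem interiorTravelTime_map [T2Space M] [T2Space M'] (hbd : HasTimelikeBoundary g)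
    (hbd' : HasTimelikeBoundary g') {U : Set (TangentBundle (𝓡∂ n) M)}
    (hscat : ∀ ξ ∈ inwardCausal g U, ∀ η, InteriorScattering g ξ η →
      InteriorScattering g' (Φ.map ξ) (Φ.map η)) {y : M} {ε : ℝ} {w : ℝ → Vec n}
    {α : ℝ → TangentBundle (𝓡∂ n) M} (h : IsScatteringFamily g U y ε w α) :
    interiorTravelTime g' (Φ.map (α 0)) = interiorTravelTime g (α 0) := by
  have hb : ∀ l ∈ Ico 0 ε, (α l).proj ∈ (𝓡∂ n).boundary M := fun l hl => (h.mem l hl).2.1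
  have h0 : (0 : ℝ) ∈ Ico 0 ε := ⟨le_rfl, h.pos⟩
  have hy : y ∈ (𝓡∂ n).boundary M :=
    (h.outward (ε / 2) ⟨by linarith [h.pos], by linarith [h.pos]⟩).1
  obtain ⟨x', hx', hτ⟩ := h.travelTime hbd
  obtain ⟨w', hw'⟩ := h.hasDerivWithinAt
  obtain ⟨c, hc, hnorm⟩ := h.exists_inner_normal_le hbd
  have hsub : Ico 0 ε ⊆ (fun l => (α l).proj) ⁻¹' (𝓡∂ n).boundary M := hb
  have hcomp := (Φ.hasMFDerivWithinAt _ (hb 0 h0)).comp (0 : ℝ) hx' hsub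
  -- The image family need not satisfy `IsScatteringFamily`: neither its membership in the domain
  -- nor continuity of its vectors is used, only continuity of the foot points and the normal bound.
  obtain ⟨x'', hx'', hτ'⟩ := travelTime_formula (g := g') hbd' (α := fun l => Φ.map (α l))
    (y := Φ.φ y) (w := fun l => (show Vec n →L[ℝ] Vec n from Φ.push y) (w l)) h.pos
    ((show Vec n →L[ℝ] Vec n from Φ.push y).hasFDerivAt.comp_hasDerivWithinAt 0 hw')
    (h.deriv_sq.congr (fun l _ => Φ.sq_map hbd (ξ := (⟨y, w l⟩ : TangentBundle (𝓡∂ n) M)) hy)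
      (Φ.sq_map hbd (ξ := (⟨y, w 0⟩ : TangentBundle (𝓡∂ n) M)) hy))
    ((Φ.sq_map hbd (hb 0 h0)).trans h.light.2)
    (ContinuousWithinAt.comp (g := Φ.φ) (Φ.contMDiffOn.continuousOn _ (hb 0 h0))
      h.continuousWithinAt_proj hb) hc (by
    filter_upwards [hnorm, Ioo_mem_nhdsGT h.pos] with l hl hlε ν' hν'
    have hbl := hb l (Ioo_subset_Ico_self hlε)
    obtain ⟨ν, hν⟩ := exists_isOutwardUnitNormal hbd hbl
    refine le_of_eq_of_le ?_ (hl ν hν)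
    exact (hν'.inner_congr (Φ.mem_boundary hbl) (Φ.push_normal _ hbl ν hν) _).trans
      (Φ.inner_push hbd hbl _ _))
    (fun l hl => hscat _ (h.mem l hl) _ (h.scattering l hl))
  have hunique : UniqueMDiffWithinAt 𝓘(ℝ, ℝ) (Ico 0 ε) (0 : ℝ) :=
    (uniqueDiffOn_Ico 0 ε 0 h0).uniqueMDiffWithinAt
  -- Both are derivatives at `0` of the same curve of foot points, so the derivative of the image
  -- family is the pushed one.
  have heq := hunique.eq hx'' hcomp
  rw [hτ, hτ', heq]
  exact congrArg _ (Φ.inner_push hbd (hb 0 h0) _ _)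

end BoundaryIsometry

end LorentzScattering

end

/-! ### The theorem -/

open LorentzScattering in
/-- Recovery of the lightlike interior travel time data from the boundary metric and the interior
scattering relation on the causal inward directions `U₋` near the light cone. -/
theorem lemma6p3 {n : ℕ} [NeZero n]
    {M : Type*} [TopologicalSpace M] [T2Space M] [ChartedSpace (EuclideanHalfSpace n) M]
    [IsManifold (𝓡∂ n) ∞ M]
    (g : LorentzMetric n M) (hbd : HasTimelikeBoundary g)
    (hnt : ∀ ξ ∈ lightTM g, IsNonTrapping g ξ)
    (U : Set (TangentBundle (𝓡∂ n) M)) (hU : IsNonTrappingConicNhd g U)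
    {M' : Type*} [TopologicalSpace M'] [T2Space M'] [ChartedSpace (EuclideanHalfSpace n) M']
    [IsManifold (𝓡∂ n) ∞ M']
    (g' : LorentzMetric n M') (hbd' : HasTimelikeBoundary g')
    (hnt' : ∀ ξ ∈ lightTM g', IsNonTrapping g' ξ)
    (U' : Set (TangentBundle (𝓡∂ n) M')) (hU' : IsNonTrappingConicNhd g' U') :
    -- `Sⁱⁿ` is well defined on `U₋`
    (∀ ξ ∈ inwardCausal g U, ∃! η, InteriorScattering g ξ η) ∧
    -- through every `ξ ∈ ∂₋LM` there is a scattering family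
    (∀ ξ ∈ lightTM g ∩ inwardTM g, ∃ y ε w α, IsScatteringFamily g U y ε w α ∧ α 0 = ξ) ∧
    -- for every scattering family `x'(0)` exists and `τⁱⁿ(x, v) = g(x'(0), v)`
    (∀ y ε w α, IsScatteringFamily g U y ε w α →
      ∃ x' : ℝ →L[ℝ] TangentSpace (𝓡∂ n) (α 0).proj,
        HasMFDerivWithinAt 𝓘(ℝ, ℝ) (𝓡∂ n) (fun l => (α l).proj) (Ico 0 ε) 0 x' ∧
        interiorTravelTime g (α 0) = (g.inner (α 0).proj (x' 1) (α 0).2 : ℝ)) ∧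
    -- equal boundary metrics and equal `Sⁱⁿ` on `U₋` give equal data `(Sⁱⁿ, τⁱⁿ)` on `∂₋LM`
    (∀ Φ : BoundaryIsometry g g',
      Φ.map '' inwardCausal g U = inwardCausal g' U' →
      (∀ ξ ∈ inwardCausal g U, ∀ η, InteriorScattering g ξ η →
        InteriorScattering g' (Φ.map ξ) (Φ.map η)) →
      Φ.map '' (lightTM g ∩ inwardTM g) = lightTM g' ∩ inwardTM g' ∧
      ∀ ξ ∈ lightTM g ∩ inwardTM g, ∃ (η : TangentBundle (𝓡∂ n) M) (T : ℝ), 0 < T ∧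
        InteriorScattering g ξ η ∧ interiorTravelTime g ξ = T ∧
        InteriorScattering g' (Φ.map ξ) (Φ.map η) ∧ interiorTravelTime g' (Φ.map ξ) = T) := by
  refine ⟨fun ξ hξ => ?_, fun ξ hξ => exists_isScatteringFamily hbd hU hξ,
    fun y ε w α h => h.travelTime hbd, fun Φ himage hscat => ⟨Φ.map_image_light hbd hU' himage,
      fun ξ hξ => ?_⟩⟩
  · obtain ⟨η, hη⟩ := (hU.nonTrapping ξ hξ.1.1).exists_interiorScattering hξ.2
    exact ⟨η, hη, fun η' hη' => hη'.unique hη⟩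
  · obtain ⟨y, ε, w, α, h, rfl⟩ := exists_isScatteringFamily hbd hU hξ
    have h0 : (0 : ℝ) ∈ Ico 0 ε := ⟨le_rfl, h.pos⟩
    obtain ⟨β, T, hβ, -, -, hT⟩ := (h.scattering 0 h0).exists_geodesic
    exact ⟨⟨y, w 0⟩, T, hβ.pos, h.scattering 0 h0, hT,
      hscat _ (h.mem 0 h0) _ (h.scattering 0 h0),
      (Φ.interiorTravelTime_map hbd hbd' hscat h).trans hT⟩
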